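/- Let $K$ be an algebraically closed field of characteristic $0$ (for instance $\mathbb C$). Let $\mathfrak g$ be a finite-dimensional simple Lie algebra over $K$, $\mathfrak t\subset\mathfrak g$ a Cartan subalgebra, $\Delta$ the root system of $(\mathfrak g,\mathfrak t)$, $\Pi$ a base of $\Delta$, $\Delta^+$ the corresponding positive roots, and $\mathfrak b=\mathfrak t\oplus\bigoplus_{\gamma\in\Delta^+}\mathfrak g_\gamma$. An Abelian ideal $\mathfrak a$ of $\mathfrak b$ is called long if every root $\gamma\in\Delta^+$ with $\mathfrak g_\gamma\subseteq\mathfrak a$ is long (the zero ideal is long). (1) The number of long Abelian ideals of $\mathfrak b$ is - $2^{p-1}$ if $\mathfrak g\cong\mathfrak{so}_{2p+1}$, $p\ge 2$; - $2$ if $\mathfrak g\cong\mathfrak{sp}_{2p}$, $p\ge 2$; - $4$ if $\mathfrak g$ is of type $F_4$; - $3$ if $\mathfrak g$ is of type $G_2$. (2) Let $\tilde{\mathfrak g}=\mathfrak g\oplus V$ be a finite-dimensional simple $\mathbb Z/2$-graded Lie algebra with even part $\mathfrak g$ and odd part $V$ (so $[\mathfrak g,V]\subseteq V$ and $[V,V]\subseteq\mathfrak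 g$), where $V$ is the little adjoint $\mathfrak g$-module, that is, the simple $\mathfrak g$-module whose highest weight is the short dominant root of $\Delta$. The number of $\mathfrak b$-stable commutative subalgebras of $\tilde{\mathfrak g}$ contained in $V$ is - $2^{p-1}$ if $\mathfrak g\cong\mathfrak{sp}_{2p}$, $p\ge 2$; - $2$ if $\mathfrak g\cong\mathfrak{so}_{2p+1}$, $p\ge 2$; - $4$ if $\mathfrak g$ is of type $F_4$. -/

import Mathlib

noncomputable section

namespace LongAbelian

open LieAlgebra LieAlgebra.IsKilling

section RootSystem

variable {ι R M N : Type*} [Fintype ι] [Field R] [CharZero R] [AddCommGroup M] [Module R M]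
  [AddCommGroup N] [Module R N]

/-- A root is long if no root is longer, where (squared) lengths are taken with respect to the
canonical Weyl-invariant positive form. -/
def IsLongRoot (P : RootPairing ι R M N) [P.IsCrystallographic] (i : ι) : Prop :=
  ∀ j, (P.posRootForm ℤ).rootLength j ≤ (P.posRootForm ℤ).rootLength i

/-- A root is short if some root is longer. -/
def IsShortRoot (P : RootPairing ι R M N) [P.IsCrystallographic] (i : ι) : Prop :=
  ∃ j, (P.posRootForm ℤ).rootLength i < (P.posRootForm ℤ).rootLength j

/-- A root is dominant if its pairing with every simple coroot is nonnegative. -/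
def IsDominantRoot {P : RootPairing ι R M N} [P.IsCrystallographic] (b : P.Base) (i : ι) : Prop :=
  ∀ j ∈ b.support, 0 ≤ P.pairingIn ℤ i j

/-- The Cartan matrix with respect to `b` is `A`, up to a renumbering of the simple roots. -/
def HasCartanMatrix {P : RootPairing ι R M N} [P.IsCrystallographic] {n : ℕ} (b : P.Base)
    (A : Matrix (Fin n) (Fin n) ℤ) : Prop :=
  ∃ e : b.support ≃ Fin n, ∀ i j, b.cartanMatrix i j = A (e i) (e j)

end RootSystem

section Borel

variable {K L : Type*} [Field K] [CharZero K] [IsAlgClosed K] [LieRing L] [LieAlgebra K L]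
  [FiniteDimensional K L] [IsKilling K L] {H : LieSubalgebra K L} [H.IsCartanSubalgebra]

theorem lie_rootSpace_mem (b : (rootSystem H).Base) {α β : H.root} (hα : b.IsPos α)
    (hβ : b.IsPos β) {x y : L} (hx : x ∈ rootSpace H α.1) (hy : y ∈ rootSpace H β.1) :
    ⁅x, y⁆ ∈ ⨆ γ : {γ : H.root // b.IsPos γ}, (rootSpace H γ.1.1).toSubmodule := by
  have hxy : ⁅x, y⁆ ∈ rootSpace H (α.1 + β.1 : H → K) :=
    lie_mem_genWeightSpace_of_mem_genWeightSpace hx hy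
  by_cases h0 : rootSpace H (α.1 + β.1 : H → K) = ⊥
  · rw [h0] at hxy
    simp only [LieSubmodule.mem_bot] at hxy
    rw [hxy]
    exact Submodule.zero_mem _
  · let γ : LieModule.Weight K H L := ⟨α.1 + β.1, h0⟩
    have hγ : γ.IsNonZero := by
      intro hz
      have hz' : (α.1 + β.1 : H → K) = 0 := hz
      have hneg : (rootSystem H).root β = - (rootSystem H).root α := by
        ext z
        have := congrFun hz' z
        simp only [Pi.add_apply, Pi.zero_apply] at this
        simpa [eq_neg_iff_add_eq_zero, add_comm] using this
      let : InvolutiveNeg H.root := (rootSystem H).indexNeg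
      have hβα : β = -α := (rootSystem H).root.injective (by
        rw [hneg, RootPairing.indexNeg_neg, RootPairing.root_reflectionPerm,
          RootPairing.reflection_apply_self])
      rw [hβα, RootPairing.Base.IsPos.neg_iff_not] at hβ
      exact hβ hα
    let γ' : H.root := ⟨γ, by simpa using hγ⟩
    have hpos : b.IsPos γ' := hα.add hβ (k := γ') (by ext z; rfl)
    exact Submodule.mem_iSup_of_mem (p := fun γ : {γ : H.root // b.IsPos γ} =>
      (rootSpace H γ.1.1).toSubmodule) ⟨γ', hpos⟩ hxy

theorem lie_cartan_mem (b : (rootSystem H).Base) {x y : L} (hx : x ∈ H)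
    (hy : y ∈ ⨆ γ : {γ : H.root // b.IsPos γ}, (rootSpace H γ.1.1).toSubmodule) :
    ⁅x, y⁆ ∈ ⨆ γ : {γ : H.root // b.IsPos γ}, (rootSpace H γ.1.1).toSubmodule := by
  induction hy using Submodule.iSup_induction' with
  | mem γ y hy =>
    exact Submodule.mem_iSup_of_mem (p := fun γ : {γ : H.root // b.IsPos γ} =>
      (rootSpace H γ.1.1).toSubmodule) γ ((rootSpace H γ.1.1).lie_mem (x := ⟨x, hx⟩) hy)
  | zero => simp
  | add y z _ _ h1 h2 => rw [lie_add]; exact Submodule.add_mem _ h1 h2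

theorem lie_nilradical_mem (b : (rootSystem H).Base) {x y : L}
    (hx : x ∈ ⨆ γ : {γ : H.root // b.IsPos γ}, (rootSpace H γ.1.1).toSubmodule)
    (hy : y ∈ ⨆ γ : {γ : H.root // b.IsPos γ}, (rootSpace H γ.1.1).toSubmodule) :
    ⁅x, y⁆ ∈ ⨆ γ : {γ : H.root // b.IsPos γ}, (rootSpace H γ.1.1).toSubmodule := by
  induction hx using Submodule.iSup_induction' with
  | mem α x hx =>
    induction hy using Submodule.iSup_induction' with
    | mem β y hy => exact lie_rootSpace_mem b α.2 β.2 hx hy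
    | zero => simp
    | add y z _ _ h1 h2 => rw [lie_add]; exact Submodule.add_mem _ h1 h2
  | zero => simp
  | add y z _ _ h1 h2 => rw [add_lie]; exact Submodule.add_mem _ h1 h2

/-- The Borel subalgebra `𝔱 ⊕ ⨁_{γ > 0} 𝔤_γ` given by a Cartan subalgebra `𝔱 = H` and a base `b`
of the root system of `(𝔤, 𝔱)`. -/
def borel (b : (rootSystem H).Base) : LieSubalgebra K L where
  toSubmodule := H.toSubmodule ⊔
    ⨆ γ : {γ : H.root // b.IsPos γ}, (rootSpace H γ.1.1).toSubmodule
  lie_mem' := by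
    intro x y hx hy
    obtain ⟨h, hh, n, hn, rfl⟩ := Submodule.mem_sup.mp hx
    obtain ⟨h', hh', n', hn', rfl⟩ := Submodule.mem_sup.mp hy
    rw [add_lie, lie_add, lie_add]
    refine Submodule.add_mem _ (Submodule.add_mem _ ?_ ?_) (Submodule.add_mem _ ?_ ?_)
    · exact Submodule.mem_sup_left (H.lie_mem hh hh')
    · exact Submodule.mem_sup_right (lie_cartan_mem b hh hn')
    · rw [← lie_skew]
      exact Submodule.mem_sup_right (Submodule.neg_mem _ (lie_cartan_mem b hh' hn))
    · exact Submodule.mem_sup_right (lie_nilradical_mem b hn hn')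

/-- The set of roots of an ideal `𝔞` of the Borel subalgebra: the positive roots `γ` with
`𝔤_γ ⊆ 𝔞`. -/
def rootsOf (b : (rootSystem H).Base) (a : LieIdeal K (borel b)) : Set H.root :=
  {γ | b.IsPos γ ∧ ∀ x : borel b, (x : L) ∈ rootSpace H γ.1 → x ∈ a}

/-- The long Abelian ideals of the Borel subalgebra: the Abelian ideals all of whose roots
are long. -/
def longAbelianIdeals (b : (rootSystem H).Base) : Set (LieIdeal K (borel b)) :=
  {a | IsLieAbelian a ∧ ∀ γ ∈ rootsOf b a, IsLongRoot (rootSystem H) γ}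

end Borel

section LittleAdjoint

variable {K L : Type*} [Field K] [CharZero K] [IsAlgClosed K] [LieRing L] [LieAlgebra K L]
  [FiniteDimensional K L] {g : LieSubalgebra K L} [IsKilling K g] {H : LieSubalgebra K g}
  [H.IsCartanSubalgebra]

/-- `L = 𝔤 ⊕ V` is a `ℤ/2`-grading of the Lie algebra `L` with even part the subalgebra `𝔤` and odd
part the `𝔤`-submodule `V`, and `V` is the little adjoint `𝔤`-module: the simple module whose highest
weight, with respect to the base `b`, is the short dominant root. -/
structure IsLittleAdjointGrading (b : (rootSystem H).Base) (V : LieSubmodule K g L) : Prop where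
  isCompl : IsCompl g.toSubmodule V.toSubmodule
  lie_mem : ∀ x ∈ V, ∀ y ∈ V, ⁅x, y⁆ ∈ g
  irreducible : LieModule.IsIrreducible K g V
  highestWeight : ∃ θ : H.root, IsShortRoot (rootSystem H) θ ∧ IsDominantRoot b θ ∧
    ∃ v ∈ V, v ≠ 0 ∧ (∀ h : H, ⁅(h : g), v⁆ = θ.1 h • v) ∧
      ∀ α : H.root, b.IsPos α → ∀ x ∈ rootSpace H α.1, ⁅x, v⁆ = 0

/-- The commutative subalgebras of `L` that are contained in `V` and are stable under the Borel
subalgebra of `𝔤` given by `H` and `b`. -/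
def stableCommutativeSubalgebras (b : (rootSystem H).Base) (V : LieSubmodule K g L) :
    Set (LieSubalgebra K L) :=
  {a | (∀ x ∈ a, x ∈ V) ∧ IsLieAbelian a ∧ ∀ x ∈ borel b, ∀ y ∈ a, ⁅x, y⁆ ∈ a}

end LittleAdjoint

end LongAbelian

end

noncomputable section

set_option linter.unusedSectionVars false

/-! Both parts reduce to one count. A subspace stable under the Borel subalgebra is stable under the
Cartan subalgebra, so it is a sum of parts of weight spaces. Commutativity rules out weight zero,
and the weight spaces that remain are lines. The subspace is therefore a set `S` of weights, subject
to two conditions: adding a positive root to an element of `S` does not leave `S` as long as the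
result is a weight in play, and no two elements of `S` add up to a positive root. These sets form
`stableFamily A T D`, where `A` is the set of positive roots. For long Abelian ideals `T` is the set
of all positive roots and `D` the long ones; for the little adjoint module both `T` and `D` are the
short positive roots. The translation is `ncard_eq_ncard_stableFamily`. It needs brackets of weight
lines to be nonzero whenever the combinatorics allows it. This follows from `sl₂`-theory and
invariance of the Killing form, of `𝔤` in the first part (`lie_ne_zero_of_add_root`) and of the
whole graded algebra in the second (`IsLittleAdjointGrading.lie_ne_zero`).

The weights of the little adjoint module are found by length. Every nonzero element of the root
lattice is at least as long as a short root, and a longest weight is conjugate under reflections to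
the highest one. So the nonzero weights are exactly the short roots, each of multiplicity one.

The combinatorics takes place in coordinates. In type `B` (long roots) and type `C` (short roots)
the sets `S` consist of sums `ε i + ε j` with `i < j` and are the order ideals of a shifted
staircase; the number of these doubles with each step in rank. In type `B` (short) and type `C`
(long) only the empty set and the one containing the highest axis root survive. In types `F₄` and
`G₂` the sets `S` are the initial segments of an explicit chain.

The root systems of `so` and `sp` with respect to an arbitrary Cartan subalgebra are read off from
the weights of the natural representation; those of `F₄` and `G₂` are generated from the Cartan
matrix. -/

namespace LongAbelian

/-! ### Stable families of weights. -/

section StableFamily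

/-- The sets `S ⊆ D` that are stable under adding elements of `A` (as long as the result lies in
`T`), and in which no two elements add up to an element of `A`. -/
def stableFamily {G : Type*} [Add G] (A T D : Set G) : Set (Set G) :=
  {S | S ⊆ D ∧ (∀ x ∈ S, ∀ α ∈ A, x + α ∈ T → x + α ∈ S) ∧ ∀ x ∈ S, ∀ y ∈ S, x + y ∉ A}

/-- The definition uses nothing but addition, so a stable family in the dual of a Cartan subalgebra
can be counted in `ℤ ^ n`. -/
theorem stableFamily_image {G G' : Type*} [AddGroup G] [AddGroup G'] (v : G →+ G')
    (hv : Function.Injective v) (A T D : Set G) :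
    stableFamily (v '' A) (v '' T) (v '' D) = Set.image v '' stableFamily A T D := by
  ext S
  constructor
  · rintro ⟨h1, h2, h3⟩
    have hS : v '' (v ⁻¹' S) = S := by
      rw [Set.image_preimage_eq_iff]
      exact h1.trans (Set.image_subset_range _ _)
    refine ⟨v ⁻¹' S, ⟨?_, ?_, ?_⟩, hS⟩
    · intro x hx
      obtain ⟨y, hy, hxy⟩ := h1 hx
      rwa [← hv hxy]
    · intro x hx α hα hxα
      have := h2 _ hx _ ⟨α, hα, rfl⟩ (by rw [← map_add]; exact ⟨_, hxα, rfl⟩)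
      rwa [← map_add] at this
    · intro x hx y hy hxy
      exact h3 _ hx _ hy (by rw [← map_add]; exact ⟨_, hxy, rfl⟩)
  · rintro ⟨S, ⟨h1, h2, h3⟩, rfl⟩
    refine ⟨Set.image_mono h1, ?_, ?_⟩
    · rintro _ ⟨x, hx, rfl⟩ _ ⟨α, hα, rfl⟩ h
      rw [← map_add] at h ⊢
      rw [hv.mem_set_image] at h ⊢
      exact h2 _ hx _ hα h
    · rintro _ ⟨x, hx, rfl⟩ _ ⟨y, hy, rfl⟩ h
      rw [← map_add, hv.mem_set_image] at h
      exact h3 _ hx _ hy h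

theorem ncard_stableFamily_image {G G' : Type*} [AddGroup G] [AddGroup G'] (v : G →+ G')
    (hv : Function.Injective v) (A T D : Set G) :
    (stableFamily (v '' A) (v '' T) (v '' D)).ncard = (stableFamily A T D).ncard := by
  rw [stableFamily_image v hv, Set.ncard_image_of_injective _ hv.image_injective]

end StableFamily

/-! ### Order ideals of the shifted staircase. -/

section Staircase

/-- The order ideals of the shifted staircase `{(i, j) | i < j < m}`. -/
def stairIdeals (m : ℕ) : Set (Set (ℕ × ℕ)) :=
  {T | (∀ q ∈ T, q.1 < q.2 ∧ q.2 < m) ∧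
    ∀ q ∈ T, ∀ k l, k < l → k ≤ q.1 → l ≤ q.2 → (k, l) ∈ T}

/-- Adding a full first row to an order ideal of the shifted staircase. -/
def addRow (m : ℕ) (T : Set (ℕ × ℕ)) : Set (ℕ × ℕ) :=
  {q | q.1 = 0 ∧ 0 < q.2 ∧ q.2 < m} ∪ {q | 0 < q.1 ∧ 0 < q.2 ∧ (q.1 - 1, q.2 - 1) ∈ T}

theorem addRow_injective (m : ℕ) : Function.Injective (addRow m) := by
  intro T T' h
  ext ⟨i, j⟩
  have : (i + 1, j + 1) ∈ addRow m T ↔ (i + 1, j + 1) ∈ addRow m T' := by rw [h]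
  simpa [addRow] using this

/-- The corner `(0, m)` decides. If it is absent, no pair has second entry `m`, because such a pair
would force the corner, and the ideal lives in the smaller staircase. If it is present, so is the
whole first row, and deleting that row and shifting along the diagonal leaves an ideal of the
smaller staircase. -/
theorem stairIdeals_succ (m : ℕ) (hm : 0 < m) :
    stairIdeals (m + 1) = stairIdeals m ∪ addRow (m + 1) '' stairIdeals m := by
  ext T
  constructor
  · rintro ⟨h1, h2⟩
    by_cases hT : (0, m) ∈ T
    · right
      refine ⟨{q | (q.1 + 1, q.2 + 1) ∈ T}, ⟨?_, ?_⟩, ?_⟩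
      · rintro q hq
        have := h1 _ hq
        simp only at this
        omega
      · rintro q hq k l hkl hk hl
        exact h2 _ hq _ _ (by omega) (by simpa using hk) (by simpa using hl)
      · ext ⟨i, j⟩
        simp only [addRow, Set.mem_union, Set.mem_ofPred_eq]
        constructor
        · rintro (⟨rfl, h, h'⟩ | ⟨h, h', h''⟩)
          · exact h2 _ hT _ _ h le_rfl (by simp only; omega)
          · rwa [Nat.sub_add_cancel h, Nat.sub_add_cancel h'] at h''
        · intro h
          have := h1 _ h
          simp only at this
          rcases Nat.eq_zero_or_pos i with rfl | hi
          · left; omega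
          · right
            refine ⟨hi, by omega, ?_⟩
            rwa [Nat.sub_add_cancel hi, Nat.sub_add_cancel (by omega)]
    · left
      refine ⟨fun q hq ↦ ⟨(h1 q hq).1, ?_⟩, h2⟩
      by_contra hlt
      exact hT (h2 q hq 0 m hm (Nat.zero_le _) (by omega))
  · rintro (⟨h1, h2⟩ | ⟨T, ⟨h1, h2⟩, rfl⟩)
    · exact ⟨fun q hq ↦ ⟨(h1 q hq).1, (h1 q hq).2.trans (Nat.lt_succ_self m)⟩, h2⟩
    · refine ⟨?_, ?_⟩
      · rintro ⟨i, j⟩ (⟨h, h', h''⟩ | ⟨h, h', h''⟩)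
        · simp only at *; omega
        · have := h1 _ h''
          simp only at *; omega
      · rintro ⟨i, j⟩ hij k l hkl hk hl
        simp only at hk hl
        rcases Nat.eq_zero_or_pos k with rfl | hk0
        · left
          refine ⟨rfl, hkl, ?_⟩
          rcases hij with ⟨h, h', h''⟩ | ⟨h, h', h''⟩
          · simp only at *; omega
          · have := h1 _ h''
            simp only at *; omega
        · rcases hij with ⟨h, h', h''⟩ | ⟨h, h', h''⟩
          · simp only at *; omega
          · exact Or.inr ⟨hk0, hk0.trans hkl,
              h2 _ h'' _ _ (by simp only; omega) (by simp only; omega) (by simp only; omega)⟩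

/-- Finiteness is carried through the induction because `Set.ncard` is additive on disjoint unions
only for finite sets. The two halves are disjoint since only the second contains the new corner. -/
theorem finite_stairIdeals_and_ncard (m : ℕ) :
    (stairIdeals (m + 1)).Finite ∧ (stairIdeals (m + 1)).ncard = 2 ^ m := by
  induction m with
  | zero =>
    have : stairIdeals 1 = {∅} := by
      ext T
      simp only [stairIdeals, Set.mem_ofPred_eq, Set.mem_singleton_iff]
      constructor
      · rintro ⟨h, -⟩
        ext q
        simp only [Set.mem_empty_iff_false, iff_false]
        intro hq
        have := h q hq
        omega
      · rintro rfl
        simp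
    rw [zero_add, this]
    simp
  | succ m ih =>
    obtain ⟨hf, hc⟩ := ih
    rw [stairIdeals_succ (m + 1) (Nat.succ_pos m)]
    refine ⟨hf.union (hf.image _), ?_⟩
    rw [Set.ncard_union_eq ?_ hf (hf.image _), Set.ncard_image_of_injective _ (addRow_injective _),
      hc, pow_succ]
    · omega
    · rw [Set.disjoint_left]
      rintro T ⟨h, -⟩ ⟨T', -, rfl⟩
      have := h (0, m + 1) (Or.inl ⟨rfl, by simp, by simp⟩)
      simp at this

theorem ncard_stairIdeals {p : ℕ} (hp : 2 ≤ p) : (stairIdeals p).ncard = 2 ^ (p - 1) := by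
  obtain ⟨m, rfl⟩ : ∃ m, p = m + 1 := ⟨p - 1, by omega⟩
  exact (finite_stairIdeals_and_ncard m).2

end Staircase

/-! ### Types B and C: counts in standard coordinates. -/

section Coordinates

variable {p : ℕ}

/-- The positive roots of type `B` (`c = 1`) and `C` (`c = 2`) in coordinates `ε`. -/
def bcPos {G : Type*} [AddCommGroup G] (c : ℤ) (ε : Fin p → G) : Set G :=
  {x | (∃ i, x = c • ε i) ∨ ∃ i j, i < j ∧ (x = ε i + ε j ∨ x = ε i - ε j)}

/-- The positive roots with two nonzero coordinates. -/
def bcMixed {G : Type*} [AddCommGroup G] (ε : Fin p → G) : Set G :=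
  {x | ∃ i j, i < j ∧ (x = ε i + ε j ∨ x = ε i - ε j)}

/-- The positive roots with one nonzero coordinate. -/
def bcAxis {G : Type*} [AddCommGroup G] (c : ℤ) (ε : Fin p → G) : Set G :=
  {x | ∃ i, x = c • ε i}

/-- The standard basis vectors of `ℤ ^ p`. -/
def stdVec (i : Fin p) : Fin p → ℤ := Pi.single i 1

theorem stdVec_apply (i j : Fin p) : stdVec i j = if j = i then 1 else 0 := by
  simp [stdVec, Pi.single_apply]

theorem sum_stdVec (i : Fin p) : ∑ j, stdVec i j = 1 := by
  simp [stdVec_apply]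

theorem stdVec_add_eq {i j k l : Fin p} (h : stdVec i + stdVec j = stdVec k + stdVec l) :
    (i = k ∧ j = l) ∨ (i = l ∧ j = k) := by
  have h1 := congrFun h i
  have h2 := congrFun h j
  have h3 := congrFun h k
  have h4 := congrFun h l
  simp only [Pi.add_apply, stdVec_apply] at h1 h2 h3 h4
  grind

/-- The sum of the coordinates decides: it is `2` for `ε i + ε j` and at most `2` on `bcPos 1`, so
`α` has sum zero and is some `ε a - ε b`. The result has sum `2`, so the negative entry must cancel:
`b` is `i` or `j`, and it is replaced by the smaller index `a`. -/
theorem add_mem_bcPos {c : ℤ} (hc : c = 1 ∨ c = 2) {i j : Fin p} (hij : i < j) {α : Fin p → ℤ}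
    (hα : α ∈ bcPos c stdVec) (h : stdVec i + stdVec j + α ∈ bcPos 1 stdVec) :
    ∃ k l, k < l ∧ k ≤ i ∧ l ≤ j ∧ stdVec i + stdVec j + α = stdVec k + stdVec l := by
  obtain ⟨a, b, hab, rfl⟩ : ∃ a b, a < b ∧ α = stdVec a - stdVec b := by
    rcases hα with ⟨a, rfl⟩ | ⟨a, b, hab, rfl | rfl⟩
    · exfalso
      rcases h with ⟨k, h⟩ | ⟨k, l, hkl, h | h⟩ <;>
      · have := congrArg (fun x ↦ ∑ j, x j) h
        simp [Finset.sum_add_distrib, ← Finset.mul_sum, sum_stdVec] at this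
        omega
    · exfalso
      rcases h with ⟨k, h⟩ | ⟨k, l, hkl, h | h⟩ <;>
      · have := congrArg (fun x ↦ ∑ j, x j) h
        simp [Finset.sum_add_distrib, sum_stdVec] at this
    · exact ⟨a, b, hab, rfl⟩
  rcases h with ⟨k, h⟩ | ⟨k, l, hkl, h | h⟩
  · exfalso
    have := congrArg (fun x ↦ ∑ j, x j) h
    simp [Finset.sum_add_distrib, sum_stdVec] at this
  · have hb : b = i ∨ b = j := by
      by_contra! hb
      have := congrFun h b
      simp only [Pi.add_apply, Pi.sub_apply, stdVec_apply] at this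
      grind
    rcases hb with rfl | rfl
    · have h' : stdVec a + stdVec j = stdVec k + stdVec l := by rw [← h]; abel
      rcases stdVec_add_eq h' with ⟨rfl, rfl⟩ | ⟨rfl, rfl⟩
      · exact ⟨_, _, hkl, hab.le, le_rfl, h⟩
      · exact absurd (hkl.trans hab) hij.not_gt
    · have h' : stdVec i + stdVec a = stdVec k + stdVec l := by rw [← h]; abel
      rcases stdVec_add_eq h' with ⟨rfl, rfl⟩ | ⟨rfl, rfl⟩
      · exact ⟨_, _, hkl, le_rfl, hab.le, h⟩
      · exact ⟨_, _, hkl, hkl.le, hij.le, h⟩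
  · exfalso
    have := congrArg (fun x ↦ ∑ j, x j) h
    simp [Finset.sum_add_distrib, sum_stdVec] at this

/-- The sums `ε i + ε j` for pairs `(i, j)` in a set of pairs. -/
def pairSums (T : Set (ℕ × ℕ)) : Set (Fin p → ℤ) :=
  {x | ∃ i j : Fin p, i < j ∧ ((i : ℕ), (j : ℕ)) ∈ T ∧ x = stdVec i + stdVec j}

theorem pairSums_mem {T : Set (ℕ × ℕ)} {i j : Fin p} (hij : i < j) :
    stdVec i + stdVec j ∈ pairSums (p := p) T ↔ ((i : ℕ), (j : ℕ)) ∈ T := by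
  constructor
  · rintro ⟨k, l, hkl, hT, h⟩
    rcases stdVec_add_eq h with ⟨rfl, rfl⟩ | ⟨rfl, rfl⟩
    · exact hT
    · exact absurd hkl hij.not_gt
  · exact fun h ↦ ⟨i, j, hij, h, rfl⟩

/-- This treats the long roots of type `B` and the short roots of type `C` together; the two differ
only in the reason why differences are excluded, which is `hsub`. Adding `ε a - ε b` lowers an
index, so `S` is an ideal of the staircase. Conversely commutativity is automatic: two sums add up
to a vector of coordinate sum `4`, which no positive root has. -/
theorem stableFamily_eq_image_pairSums {c : ℤ} (hc : c = 1 ∨ c = 2) {T D : Set (Fin p → ℤ)}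
    (hT : T ⊆ bcPos 1 stdVec) (hD : D ⊆ bcMixed stdVec)
    (hTp : ∀ i j : Fin p, i < j → stdVec i + stdVec j ∈ T)
    (hDp : ∀ i j : Fin p, i < j → stdVec i + stdVec j ∈ D)
    (hsub : ∀ S ∈ stableFamily (bcPos c stdVec) T D, ∀ i j, i < j → stdVec i - stdVec j ∉ S) :
    stableFamily (bcPos c stdVec) T D = pairSums '' stairIdeals p := by
  ext S
  constructor
  · intro hS
    have hS' := hS
    obtain ⟨h1, h2, h3⟩ := hS
    have hform : ∀ x ∈ S, ∃ i j : Fin p, i < j ∧ x = stdVec i + stdVec j := by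
      intro x hx
      obtain ⟨i, j, hij, rfl | rfl⟩ := hD (h1 hx)
      · exact ⟨i, j, hij, rfl⟩
      · exact absurd hx (hsub S hS' i j hij)
    refine ⟨{q | ∃ i j : Fin p, i < j ∧ q = ((i : ℕ), (j : ℕ)) ∧ stdVec i + stdVec j ∈ S},
      ⟨?_, ?_⟩, ?_⟩
    · rintro _ ⟨i, j, hij, rfl, -⟩
      exact ⟨hij, j.2⟩
    · rintro _ ⟨i, j, hij, rfl, hx⟩ k l hkl hk hl
      simp only at hk hl
      have hlp : l < p := hl.trans_lt j.2
      obtain ⟨k, rfl⟩ : ∃ k' : Fin p, k = k' := ⟨⟨k, hkl.trans hlp⟩, rfl⟩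
      obtain ⟨l, rfl⟩ : ∃ l' : Fin p, l = l' := ⟨⟨l, hlp⟩, rfl⟩
      simp only [Fin.val_fin_lt, Fin.val_fin_le] at hkl hk hl
      -- The first index is lowered before the second: `k < l ≤ j` guarantees that the intermediate
      -- vector is again a sum with increasing indices.
      have hkj : stdVec k + stdVec j ∈ S := by
        rcases hk.eq_or_lt with rfl | hk
        · exact hx
        · have e : stdVec i + stdVec j + (stdVec k - stdVec i) = stdVec k + stdVec j := by abel
          rw [← e]
          refine h2 _ hx _ (Or.inr ⟨k, i, hk, Or.inr rfl⟩) ?_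
          rw [e]
          exact hTp _ _ (hkl.trans_le hl)
      refine ⟨k, l, hkl, rfl, ?_⟩
      rcases hl.eq_or_lt with rfl | hl
      · exact hkj
      · have e : stdVec k + stdVec j + (stdVec l - stdVec j) = stdVec k + stdVec l := by abel
        rw [← e]
        refine h2 _ hkj _ (Or.inr ⟨l, j, hl, Or.inr rfl⟩) ?_
        rw [e]
        exact hTp _ _ hkl
    · ext x
      constructor
      · rintro ⟨i, j, hij, ⟨i', j', -, hq, hx⟩, rfl⟩
        simp only [Prod.mk.injEq, Fin.val_inj] at hq
        rwa [hq.1, hq.2]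
      · intro hx
        obtain ⟨i, j, hij, rfl⟩ := hform x hx
        exact ⟨i, j, hij, ⟨i, j, hij, rfl, hx⟩, rfl⟩
  · rintro ⟨T', ⟨h1, h2⟩, rfl⟩
    refine ⟨?_, ?_, ?_⟩
    · rintro _ ⟨i, j, hij, -, rfl⟩
      exact hDp i j hij
    · rintro _ ⟨i, j, hij, hq, rfl⟩ α hα h
      obtain ⟨k, l, hkl, hk, hl, h'⟩ := add_mem_bcPos hc hij hα (hT h)
      rw [h']
      exact ⟨k, l, hkl, h2 _ hq _ _ hkl hk hl, rfl⟩
    · rintro _ ⟨i, j, hij, hq, rfl⟩ _ ⟨k, l, hkl, hq', rfl⟩ h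
      rcases h with ⟨a, h⟩ | ⟨a, b, hab, h | h⟩ <;>
      · have := congrArg (fun x ↦ ∑ j, x j) h
        simp [Finset.sum_add_distrib, ← Finset.mul_sum, sum_stdVec] at this
        try omega

theorem ncard_stableFamily_of_pairSums {p : ℕ} (hp : 2 ≤ p) {F : Set (Set (Fin p → ℤ))}
    (hF : F = pairSums '' stairIdeals p) : F.ncard = 2 ^ (p - 1) := by
  rw [hF, Set.InjOn.ncard_image, ncard_stairIdeals hp]
  rintro T hT T' hT' h
  ext ⟨i, j⟩
  constructor
  · intro hq
    obtain ⟨hij, hj⟩ := hT.1 _ hq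
    have : stdVec (⟨i, hij.trans hj⟩ : Fin p) + stdVec ⟨j, hj⟩ ∈ pairSums T :=
      (pairSums_mem hij).2 hq
    rw [h] at this
    exact (pairSums_mem hij).1 this
  · intro hq
    obtain ⟨hij, hj⟩ := hT'.1 _ hq
    have : stdVec (⟨i, hij.trans hj⟩ : Fin p) + stdVec ⟨j, hj⟩ ∈ pairSums T' :=
      (pairSums_mem hij).2 hq
    rw [← h] at this
    exact (pairSums_mem hij).1 this

theorem bcMixed_subset_bcPos (c : ℤ) : bcMixed (p := p) stdVec ⊆ bcPos c stdVec :=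
  fun _ h ↦ Or.inr h

theorem stdVec_notMem_bcMixed (c : ℤ) (i : Fin p) : c • stdVec i ∉ bcMixed stdVec := by
  rintro ⟨k, l, hkl, h | h⟩
  · have h1 := congrFun h k
    have h2 := congrFun h l
    simp [stdVec_apply] at h1 h2
    grind
  · have h1 := congrFun h k
    have h2 := congrFun h l
    simp [stdVec_apply] at h1 h2
    grind

/-- Long stable sets in type `B`. -/
theorem ncard_stableFamily_long_B (hp : 2 ≤ p) :
    (stableFamily (bcPos 1 (stdVec (p := p))) (bcPos 1 stdVec) (bcMixed stdVec)).ncard =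
      2 ^ (p - 1) := by
  refine ncard_stableFamily_of_pairSums hp (stableFamily_eq_image_pairSums (Or.inl rfl) le_rfl
    le_rfl (fun i j hij ↦ Or.inr ⟨i, j, hij, Or.inl rfl⟩) (fun i j hij ↦ ⟨i, j, hij, Or.inl rfl⟩) ?_)
  rintro S ⟨h1, h2, h3⟩ i j hij h
  -- Adding `ε j` to `ε i - ε j` gives `ε i`, a positive root that is not long.
  have := h2 _ h ((1 : ℤ) • stdVec j) (Or.inl ⟨j, rfl⟩)
    (Or.inl ⟨i, by rw [one_smul, one_smul, sub_add_cancel]⟩)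
  apply stdVec_notMem_bcMixed 1 i
  rw [one_smul, sub_add_cancel] at this
  rw [one_smul]
  exact h1 this

/-- Short stable sets in type `C`. -/
theorem ncard_stableFamily_short_C (hp : 2 ≤ p) :
    (stableFamily (bcPos 2 (stdVec (p := p))) (bcMixed stdVec) (bcMixed stdVec)).ncard =
      2 ^ (p - 1) := by
  refine ncard_stableFamily_of_pairSums hp (stableFamily_eq_image_pairSums (Or.inr rfl)
    (bcMixed_subset_bcPos 1) le_rfl (fun i j hij ↦ ⟨i, j, hij, Or.inl rfl⟩)
    (fun i j hij ↦ ⟨i, j, hij, Or.inl rfl⟩) ?_)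
  rintro S ⟨h1, h2, h3⟩ i j hij h
  -- Stability forces `ε i + ε j` into `S`, but together with `ε i - ε j` it adds up to the root `2
  -- ε i`.
  have e : stdVec i - stdVec j + (2 : ℤ) • stdVec j = stdVec i + stdVec j := by
    rw [two_smul]; abel
  have := h2 _ h ((2 : ℤ) • stdVec j) (Or.inl ⟨j, rfl⟩)
    (by rw [e]; exact ⟨i, j, hij, Or.inl rfl⟩)
  rw [e] at this
  exact h3 _ h _ this (Or.inl ⟨i, by rw [two_smul]; abel⟩)

/-- Serves the cases in which only the highest axis root can occur. That root alone forms a stable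
set: by `hmax` nothing can be added to it, and its double is never a positive root. -/
theorem stableFamily_eq_pair {c : ℤ} (hc : 0 < c) (h0 : 0 < p) {T : Set (Fin p → ℤ)}
    (hmax : ∀ α ∈ bcPos c stdVec, c • stdVec ⟨0, h0⟩ + α ∉ T)
    (hS : ∀ S ∈ stableFamily (bcPos c stdVec) T (bcAxis c stdVec),
      ∀ i, c • stdVec i ∈ S → i = ⟨0, h0⟩) :
    stableFamily (bcPos c stdVec) T (bcAxis c stdVec) = {∅, {c • stdVec ⟨0, h0⟩}} := by
  ext S
  simp only [Set.mem_insert_iff, Set.mem_singleton_iff]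
  constructor
  · intro h
    apply Set.subset_singleton_iff_eq.1
    intro x hx
    obtain ⟨i, rfl⟩ := h.1 hx
    rw [hS S h i hx]
    rfl
  · rintro (rfl | rfl)
    · simp [stableFamily]
    · refine ⟨?_, ?_, ?_⟩
      · rintro _ rfl
        exact ⟨_, rfl⟩
      · rintro _ rfl α hα h
        exact absurd h (hmax α hα)
      · rintro _ rfl _ rfl h
        rcases h with ⟨k, h⟩ | ⟨k, l, hkl, h | h⟩ <;>
        · have e1 := congrFun h ⟨0, h0⟩
          have e2 := congrFun h k
          try have e4 := congrFun h l
          simp [stdVec_apply] at e1 e2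
          try simp [stdVec_apply] at e4
          grind

theorem ncard_pair_stdVec {c : ℤ} (h0 : 0 < p) :
    ({∅, {c • stdVec ⟨0, h0⟩}} : Set (Set (Fin p → ℤ))).ncard = 2 := by
  rw [Set.ncard_pair]
  exact (Set.singleton_ne_empty _).symm

/-- Long stable sets in type `C`. -/
theorem ncard_stableFamily_long_C (hp : 2 ≤ p) :
    (stableFamily (bcPos 2 (stdVec (p := p))) (bcPos 2 stdVec) (bcAxis 2 stdVec)).ncard = 2 := by
  have h0 : 0 < p := by omega
  rw [stableFamily_eq_pair (by norm_num) h0 ?_ ?_, ncard_pair_stdVec]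
  · intro α hα h
    rcases h with ⟨k, h⟩ | ⟨k, l, hkl, h | h⟩ <;>
    rcases hα with ⟨a, rfl⟩ | ⟨a, b, hab, rfl | rfl⟩
    all_goals
      have e1 := congrFun h ⟨0, h0⟩
      have e2 := congrFun h k
      have e3 := congrFun h a
      try have e4 := congrFun h l
      try have e5 := congrFun h b
      have h0' : ∀ j : Fin p, ¬ j < ⟨0, h0⟩ := fun j hj ↦ Nat.not_lt_zero _ hj
      simp [stdVec_apply] at e1 e2 e3
      try simp [stdVec_apply] at e4
      try simp [stdVec_apply] at e5
      grind
  rintro S ⟨h1, h2, h3⟩ i hi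
  by_contra hne
  have hlt : (⟨0, h0⟩ : Fin p) < i :=
    lt_of_le_of_ne (Nat.zero_le _) (Ne.symm hne)
  -- From a lower axis root one reaches the mixed root `ε 0 + ε i`, which is not long.
  have e : (2 : ℤ) • stdVec i + (stdVec ⟨0, h0⟩ - stdVec i) = stdVec ⟨0, h0⟩ + stdVec i := by
    rw [two_smul]; abel
  have := h2 _ hi (stdVec ⟨0, h0⟩ - stdVec i) (Or.inr ⟨_, _, hlt, Or.inr rfl⟩)
    (by rw [e]; exact Or.inr ⟨_, _, hlt, Or.inl rfl⟩)
  rw [e] at this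
  obtain ⟨k, hk⟩ := h1 this
  exact stdVec_notMem_bcMixed 2 k (by rw [← hk]; exact ⟨_, _, hlt, Or.inl rfl⟩)

/-- Short stable sets in type `B`. -/
theorem ncard_stableFamily_short_B (hp : 2 ≤ p) :
    (stableFamily (bcPos 1 (stdVec (p := p))) (bcAxis 1 stdVec) (bcAxis 1 stdVec)).ncard = 2 := by
  have h0 : 0 < p := by omega
  rw [stableFamily_eq_pair (by norm_num) h0 ?_ ?_, ncard_pair_stdVec]
  · intro α hα h
    obtain ⟨k, h⟩ := h
    rcases hα with ⟨a, rfl⟩ | ⟨a, b, hab, rfl | rfl⟩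
    all_goals
      have e1 := congrFun h ⟨0, h0⟩
      have e2 := congrFun h k
      have e3 := congrFun h a
      try have e5 := congrFun h b
      have h0' : ∀ j : Fin p, ¬ j < ⟨0, h0⟩ := fun j hj ↦ Nat.not_lt_zero _ hj
      simp [stdVec_apply] at e1 e2 e3
      try simp [stdVec_apply] at e5
      grind
  rintro S ⟨h1, h2, h3⟩ i hi
  by_contra hne
  have hlt : (⟨0, h0⟩ : Fin p) < i :=
    lt_of_le_of_ne (Nat.zero_le _) (Ne.symm hne)
  -- Together with `ε i` the set would contain `ε 0`, and these two add up to a root.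
  have e : (1 : ℤ) • stdVec i + (stdVec ⟨0, h0⟩ - stdVec i) = (1 : ℤ) • stdVec ⟨0, h0⟩ := by
    rw [one_smul, one_smul]; abel
  have := h2 _ hi (stdVec ⟨0, h0⟩ - stdVec i) (Or.inr ⟨_, _, hlt, Or.inr rfl⟩)
    (by rw [e]; exact ⟨_, rfl⟩)
  rw [e] at this
  exact h3 _ this _ hi (Or.inr ⟨_, _, hlt, Or.inl (by rw [one_smul, one_smul])⟩)

end Coordinates

end LongAbelian

namespace LongAbelian

/-! ### Root systems of types B and C: lengths and positive roots. -/

section AbstractRoots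

variable {ι K M N : Type*} [Fintype ι] [Field K] [CharZero K] [AddCommGroup M] [Module K M]
  [AddCommGroup N] [Module K N] {P : RootPairing ι K M N}

theorem exists_coordinates {p : ℕ} {ε : Fin p → M} (hε : LinearIndependent K ε) :
    ∃ ξ : M →ₗ[K] (Fin p → K), ∀ i, ξ (ε i) = Pi.single i 1 := by
  obtain ⟨g, hg⟩ := LinearMap.exists_leftInverse_of_injective (Fintype.linearCombination K ε)
    (LinearMap.ker_eq_bot.2 hε.fintypeLinearCombination_injective)
  refine ⟨g, fun i ↦ ?_⟩
  have := LinearMap.congr_fun hg (Pi.single i 1)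
  simpa [Fintype.linearCombination_apply_single] using this

/-- The roots of type `B` (`c = 1`) and `C` (`c = 2`) in coordinates `ε`. -/
def bcRoots {G : Type*} [AddCommGroup G] {p : ℕ} (c : ℤ) (ε : Fin p → G) : Set G :=
  {x | (∃ i, ∃ s : ℤˣ, x = (s : ℤ) • c • ε i) ∨
    ∃ i j, i ≠ j ∧ ∃ s t : ℤˣ, x = (s : ℤ) • ε i + (t : ℤ) • ε j}

theorem bcRoots_sign_subset {G : Type*} [AddCommGroup G] {p : ℕ} (c : ℤ) (ε : Fin p → G)
    (s : Fin p → ℤˣ) : bcRoots c (fun i ↦ (s i : ℤ) • ε i) ⊆ bcRoots c ε := by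
  rintro x (⟨i, t, rfl⟩ | ⟨i, j, hij, t, u, rfl⟩)
  · refine Or.inl ⟨i, t * s i, ?_⟩
    simp only [smul_smul, Units.val_mul]
    congr 1
    ring
  · exact Or.inr ⟨i, j, hij, t * s i, u * s j, by simp only [smul_smul, Units.val_mul]⟩

theorem bcRoots_sign {G : Type*} [AddCommGroup G] {p : ℕ} (c : ℤ) (ε : Fin p → G)
    (s : Fin p → ℤˣ) : bcRoots c (fun i ↦ (s i : ℤ) • ε i) = bcRoots c ε := by
  refine (bcRoots_sign_subset c ε s).antisymm ?_
  have := bcRoots_sign_subset c (fun i ↦ (s i : ℤ) • ε i) s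
  simp only [smul_smul] at this
  simpa only [← Units.val_mul, Int.units_mul_self, Units.val_one, one_smul] using this

theorem bcRoots_perm {G : Type*} [AddCommGroup G] {p : ℕ} (c : ℤ) (ε : Fin p → G)
    (σ : Equiv.Perm (Fin p)) : bcRoots c (ε ∘ σ) = bcRoots c ε := by
  ext x
  constructor
  · rintro (⟨i, t, rfl⟩ | ⟨i, j, hij, t, u, rfl⟩)
    · exact Or.inl ⟨σ i, t, rfl⟩
    · exact Or.inr ⟨σ i, σ j, fun h ↦ hij (σ.injective h), t, u, rfl⟩
  · rintro (⟨i, t, rfl⟩ | ⟨i, j, hij, t, u, rfl⟩)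
    · exact Or.inl ⟨σ.symm i, t, by simp⟩
    · exact Or.inr ⟨σ.symm i, σ.symm j, fun h ↦ hij (σ.symm.injective h), t, u, by simp⟩

theorem bcPos_subset_bcRoots {G : Type*} [AddCommGroup G] {p : ℕ} (c : ℤ) (ε : Fin p → G) :
    bcPos c ε ⊆ bcRoots c ε := by
  rintro x (⟨i, rfl⟩ | ⟨i, j, hij, rfl | rfl⟩)
  · exact Or.inl ⟨i, 1, by simp⟩
  · exact Or.inr ⟨i, j, hij.ne, 1, 1, by simp⟩
  · exact Or.inr ⟨i, j, hij.ne, 1, -1, by simp [sub_eq_add_neg]⟩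

/-- Lists the roots in the plane of two coordinate vectors. It turns the fact that a reflection
permutes the roots into equations for its coefficients. -/
theorem smul_add_smul_mem_bcRoots {p : ℕ} {ε : Fin p → M} (hε : LinearIndependent K ε) {c : ℤ}
    {a b : Fin p} (hab : a ≠ b) {x y : K} (h : x • ε a + y • ε b ∈ bcRoots c ε) :
    (x = 0 ∧ (y = c ∨ y = -c)) ∨ (y = 0 ∧ (x = c ∨ x = -c)) ∨
      ((x = 1 ∨ x = -1) ∧ (y = 1 ∨ y = -1)) := by
  obtain ⟨ξ, hξ⟩ := exists_coordinates hε
  rcases h with ⟨i, s, h⟩ | ⟨i, j, hij, s, t, h⟩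
  · have key : ∀ k, x * Pi.single (M := fun _ ↦ K) a 1 k + y * Pi.single (M := fun _ ↦ K) b 1 k =
        s * (c * Pi.single (M := fun _ ↦ K) i 1 k) := by
      intro k
      have := congrFun (congrArg ξ h) k
      simpa [hξ, ← Int.cast_smul_eq_zsmul K] using this
    have h1 := key a
    have h2 := key b
    have h3 := key i
    simp only [Pi.single_apply] at h1 h2 h3
    rcases Int.units_eq_one_or s with rfl | rfl <;> simp at h1 h2 h3 <;> grind
  · have key : ∀ k, x * Pi.single (M := fun _ ↦ K) a 1 k + y * Pi.single (M := fun _ ↦ K) b 1 k =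
        s * Pi.single (M := fun _ ↦ K) i 1 k + t * Pi.single (M := fun _ ↦ K) j 1 k := by
      intro k
      have := congrFun (congrArg ξ h) k
      simpa [hξ, ← Int.cast_smul_eq_zsmul K] using this
    have h1 := key a
    have h2 := key b
    have h3 := key i
    have h4 := key j
    simp only [Pi.single_apply] at h1 h2 h3 h4
    rcases Int.units_eq_one_or s with rfl | rfl <;> rcases Int.units_eq_one_or t with rfl | rfl <;>
      simp at h1 h2 h3 h4 <;> grind

section Lengths

variable [P.IsCrystallographic]

/-- A fixed ratio between the two classes suffices: comparison with a member of the other class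
shows that the length is constant on each. -/
theorem isLongRoot_isShortRoot_iff {k : ℤ} (hk : 1 < k) (X : ι → Prop) (hx : ∃ i, X i)
    (hn : ∃ i, ¬ X i)
    (h : ∀ i j, X i → ¬ X j →
      (P.posRootForm ℤ).rootLength i = k * (P.posRootForm ℤ).rootLength j) :
    (∀ i, IsLongRoot P i ↔ X i) ∧ ∀ i, IsShortRoot P i ↔ ¬ X i := by
  obtain ⟨u, hu⟩ := hx
  obtain ⟨w, hw⟩ := hn
  have hpos := fun i ↦ (P.posRootForm ℤ).rootLength_pos i
  have hX : ∀ i j, X i → (P.posRootForm ℤ).rootLength j ≤ (P.posRootForm ℤ).rootLength i := by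
    intro i j hi
    by_cases hj : X j
    · rw [h i w hi hw, h j w hj hw]
    · rw [h i j hi hj]
      nlinarith [hpos j]
  have hX' : ∀ i, ¬ X i → (P.posRootForm ℤ).rootLength i < (P.posRootForm ℤ).rootLength u := by
    intro i hi
    rw [h u i hu hi]
    nlinarith [hpos i]
  refine ⟨fun i ↦ ⟨fun hl ↦ ?_, fun hi j ↦ hX i j hi⟩, fun i ↦ ⟨?_, fun hi ↦ ⟨u, hX' i hi⟩⟩⟩
  · by_contra hi
    exact (hX' i hi).not_ge (hl u)
  · rintro ⟨j, hj⟩ hi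
    exact hj.not_ge (hX i j hi)

theorem two_mul_form_root (B : P.InvariantForm) (x : M) (j : ι) :
    2 * B.form x (P.root j) = P.coroot' j x * B.form (P.root j) (P.root j) := by
  have h := B.apply_reflection_reflection j x (P.root j)
  rw [RootPairing.reflection_apply_self, RootPairing.reflection_apply] at h
  simp only [map_sub, map_neg, map_smul, LinearMap.sub_apply, LinearMap.smul_apply,
    smul_eq_mul] at h
  linear_combination -h

/-- The form is known only to be invariant under reflections, and these only to permute the roots.
The reflection in `c ε a` maps both `ε b + ε a` and `ε b - ε a` to roots, which is possible only if
its coroot vanishes on `ε b`; hence orthogonality. The reflection in `ε a - ε b` is likewise forced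
to take the value `1` on `ε a`, and then invariance equates the two lengths. -/
theorem bc_form {p : ℕ} (hp : 2 ≤ p) {c : ℤ} (hc : c = 1 ∨ c = 2) {ε : Fin p → M}
    (hε : LinearIndependent K ε) (hR : Set.range P.root = bcRoots c ε) (B : P.InvariantForm) :
    ∃ q : K, (∀ a, B.form (ε a) (ε a) = q) ∧ ∀ a b, a ≠ b → B.form (ε a) (ε b) = 0 := by
  have hc0 : (c : K) ≠ 0 := by rcases hc with rfl | rfl <;> norm_num
  have hrefl : ∀ i, ∀ x ∈ bcRoots c ε, x - P.coroot' i x • P.root i ∈ bcRoots c ε := by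
    intro i x hx
    rw [← hR] at hx ⊢
    obtain ⟨j, rfl⟩ := hx
    exact ⟨P.reflectionPerm i j, by
      rw [RootPairing.root_reflectionPerm, RootPairing.reflection_apply]⟩
  have horth : ∀ a b, a ≠ b → B.form (ε b) (ε a) = 0 := by
    intro a b hab
    obtain ⟨i, hi⟩ : (c • ε a) ∈ Set.range P.root := by
      rw [hR]; exact Or.inl ⟨a, 1, by simp⟩
    set φ := P.coroot' i with hφ
    have hi' : P.root i = (c : K) • ε a := by rw [hi, Int.cast_smul_eq_zsmul]
    have h2 : φ (ε a) * c = 2 := by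
      have : φ (P.root i) = 2 := by
        rw [hφ, RootPairing.root_coroot'_eq_pairing, RootPairing.pairing_same]
      rw [hi', map_smul, smul_eq_mul] at this
      linear_combination this
    have e1 := hrefl i (ε b + ε a) (Or.inr ⟨b, a, hab.symm, 1, 1, by simp⟩)
    have e2 := hrefl i (ε b - ε a) (Or.inr ⟨b, a, hab.symm, 1, -1, by simp [sub_eq_add_neg]⟩)
    have e1' : (-(φ (ε b) * c) - 1) • ε a + (1 : K) • ε b ∈ bcRoots c ε := by
      convert e1 using 1
      rw [← hφ, hi', map_add, smul_smul, add_mul, h2]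
      module
    have e2' : (-(φ (ε b) * c) + 1) • ε a + (1 : K) • ε b ∈ bcRoots c ε := by
      convert e2 using 1
      rw [← hφ, hi', map_sub, smul_smul, sub_mul, h2]
      module
    have hz : φ (ε b) * c = 0 := by
      rcases smul_add_smul_mem_bcRoots hε hab e1' with h | h | h <;>
      rcases smul_add_smul_mem_bcRoots hε hab e2' with h' | h' | h' <;> grind
    have hz' : φ (ε b) = 0 := by simpa [hc0] using hz
    have h3 := two_mul_form_root B (ε b) i
    rw [← hφ, hz', zero_mul, hi', map_smul, smul_eq_mul] at h3
    simpa [hc0] using h3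
  have heq : ∀ a b, a ≠ b → B.form (ε a) (ε a) = B.form (ε b) (ε b) := by
    intro a b hab
    obtain ⟨i, hi⟩ : (ε a - ε b) ∈ Set.range P.root := by
      rw [hR]; exact Or.inr ⟨a, b, hab, 1, -1, by simp [sub_eq_add_neg]⟩
    set φ := P.coroot' i with hφ
    have h2 : φ (ε b) = φ (ε a) - 2 := by
      have : φ (P.root i) = 2 := by
        rw [hφ, RootPairing.root_coroot'_eq_pairing, RootPairing.pairing_same]
      rw [hi, map_sub] at this
      linear_combination -this
    have e1 := hrefl i (c • ε a) (Or.inl ⟨a, 1, by simp⟩)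
    have e2 := hrefl i (c • ε b) (Or.inl ⟨b, 1, by simp⟩)
    have e1' : (c * (1 - φ (ε a))) • ε a + (c * φ (ε a)) • ε b ∈ bcRoots c ε := by
      convert e1 using 1
      rw [← hφ, hi, map_zsmul, ← Int.cast_smul_eq_zsmul K, ← Int.cast_smul_eq_zsmul K]
      module
    have e2' : (c * (2 - φ (ε a))) • ε a + (c * (φ (ε a) - 1)) • ε b ∈ bcRoots c ε := by
      convert e2 using 1
      rw [← hφ, hi, map_zsmul, ← Int.cast_smul_eq_zsmul K, ← Int.cast_smul_eq_zsmul K, h2]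
      module
    -- The image of `c ε a` alone would still permit `φ (ε a) = 0`, and `1 / 2` when `c = 2`; the
    -- image of `c ε b` excludes these.
    have hz : φ (ε a) = 1 := by
      rcases hc with rfl | rfl <;>
      rcases smul_add_smul_mem_bcRoots hε hab e1' with h | h | h <;>
      rcases smul_add_smul_mem_bcRoots hε hab e2' with h' | h' | h' <;> push_cast at h h' <;> grind
    have h3 := two_mul_form_root B (ε a) i
    rw [← hφ, hz, hi] at h3
    simp only [map_sub, LinearMap.sub_apply, horth _ _ hab, horth _ _ hab.symm] at h3
    linear_combination h3
  refine ⟨B.form (ε ⟨0, by omega⟩) (ε ⟨0, by omega⟩), fun a ↦ ?_, fun a b hab ↦ horth _ _ hab.symm⟩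
  by_cases h : a = ⟨0, by omega⟩
  · rw [h]
  · exact heq _ _ h

theorem mixed_form {p : ℕ} {ε : Fin p → M} {B : P.InvariantForm} {q : K}
    (h1 : ∀ a, B.form (ε a) (ε a) = q) (h2 : ∀ a b, a ≠ b → B.form (ε a) (ε b) = 0)
    {a b : Fin p} (hab : a ≠ b) (s t : ℤˣ) :
    B.form ((s : ℤ) • ε a + (t : ℤ) • ε b) ((s : ℤ) • ε a + (t : ℤ) • ε b) = 2 * q := by
  rcases Int.units_eq_one_or s with rfl | rfl <;> rcases Int.units_eq_one_or t with rfl | rfl <;>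
  · simp [h1, h2 _ _ hab, h2 _ _ hab.symm]
    try ring

theorem axis_form {p : ℕ} {ε : Fin p → M} {B : P.InvariantForm} {q : K}
    (h1 : ∀ a, B.form (ε a) (ε a) = q) (c : ℤ) (a : Fin p) (s : ℤˣ) :
    B.form ((s : ℤ) • c • ε a) ((s : ℤ) • c • ε a) = c * c * q := by
  rcases Int.units_eq_one_or s with rfl | rfl <;>
  · simp [h1, ← Int.cast_smul_eq_zsmul K]
    try ring

theorem mixed_ne_axis {p : ℕ} {ε : Fin p → M} (hε : LinearIndependent K ε) {c : ℤ} {a b k : Fin p}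
    (hab : a ≠ b) (s t u : ℤˣ) : (s : ℤ) • ε a + (t : ℤ) • ε b ≠ (u : ℤ) • c • ε k := by
  intro h
  obtain ⟨ξ, hξ⟩ := exists_coordinates hε
  have key : ∀ j, (s : K) * Pi.single (M := fun _ ↦ K) a 1 j + t * Pi.single (M := fun _ ↦ K) b 1 j =
      u * (c * Pi.single (M := fun _ ↦ K) k 1 j) := by
    intro k
    have := congrFun (congrArg ξ h) k
    simpa [hξ, ← Int.cast_smul_eq_zsmul K] using this
  have h1 := key a
  have h2 := key b
  simp only [Pi.single_apply] at h1 h2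
  rcases Int.units_eq_one_or s with rfl | rfl <;> rcases Int.units_eq_one_or t with rfl | rfl <;>
    simp at h1 h2 <;> grind

/-- An axis root has form value `c² q` and a mixed root `2 q`. The ratio is `2` for either `c`, and
the axis roots are the long ones exactly for `c = 2`; the inner equivalences encode both types at
once. -/
theorem bc_long_short {p : ℕ} (hp : 2 ≤ p) {c : ℤ} (hc : c = 1 ∨ c = 2) {ε : Fin p → M}
    (hε : LinearIndependent K ε) (hR : Set.range P.root = bcRoots c ε) :
    (∀ i, IsLongRoot P i ↔ ((∃ a, ∃ s : ℤˣ, P.root i = (s : ℤ) • c • ε a) ↔ c = 2)) ∧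
    (∀ i, IsShortRoot P i ↔ ((∃ a, ∃ s : ℤˣ, P.root i = (s : ℤ) • c • ε a) ↔ c = 1)) := by
  obtain ⟨q, h1, h2⟩ := bc_form hp hc hε hR (P.posRootForm ℤ).toInvariantForm
  have hdich : ∀ i, (∃ a, ∃ s : ℤˣ, P.root i = (s : ℤ) • c • ε a) ∨
      ∃ a b, a ≠ b ∧ ∃ s t : ℤˣ, P.root i = (s : ℤ) • ε a + (t : ℤ) • ε b := by
    intro i
    have : P.root i ∈ bcRoots c ε := hR ▸ ⟨i, rfl⟩
    exact this
  have hlen : ∀ i, ((P.posRootForm ℤ).rootLength i : K) =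
      (P.posRootForm ℤ).toInvariantForm.form (P.root i) (P.root i) := fun i ↦
    (P.posRootForm ℤ).algebraMap_rootLength i
  have hm : ∀ i, (¬ ∃ a, ∃ s : ℤˣ, P.root i = (s : ℤ) • c • ε a) →
      ((P.posRootForm ℤ).rootLength i : K) = 2 * q := by
    intro i hi
    obtain ⟨a, b, hab, s, t, h⟩ := (hdich i).resolve_left hi
    rw [hlen, h, mixed_form h1 h2 hab]
  have ha : ∀ i, (∃ a, ∃ s : ℤˣ, P.root i = (s : ℤ) • c • ε a) →
      ((P.posRootForm ℤ).rootLength i : K) = c * c * q := by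
    rintro i ⟨a, s, h⟩
    rw [hlen, h, axis_form h1]
  have hexa : ∃ i, ∃ a, ∃ s : ℤˣ, P.root i = (s : ℤ) • c • ε a := by
    obtain ⟨i, hi⟩ : (c • ε ⟨0, by omega⟩) ∈ Set.range P.root := by
      rw [hR]; exact Or.inl ⟨⟨0, by omega⟩, 1, by simp⟩
    exact ⟨i, ⟨0, by omega⟩, 1, by simp [hi]⟩
  have hexm : ∃ i, ¬ ∃ a, ∃ s : ℤˣ, P.root i = (s : ℤ) • c • ε a := by
    have h01 : (⟨0, by omega⟩ : Fin p) ≠ ⟨1, by omega⟩ := by simp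
    obtain ⟨i, hi⟩ : ((1 : ℤˣ) : ℤ) • ε ⟨0, by omega⟩ + ((1 : ℤˣ) : ℤ) • ε ⟨1, by omega⟩ ∈
        Set.range P.root := by
      rw [hR]; exact Or.inr ⟨_, _, h01, 1, 1, rfl⟩
    refine ⟨i, ?_⟩
    rintro ⟨a, s, h⟩
    rw [hi] at h
    exact mixed_ne_axis hε h01 _ _ _ h
  rcases hc with rfl | rfl
  · obtain ⟨hl, hs⟩ := isLongRoot_isShortRoot_iff (P := P) (k := 2) (by norm_num)
      (fun i ↦ ¬ ∃ a, ∃ s : ℤˣ, P.root i = (s : ℤ) • (1 : ℤ) • ε a) hexm (by simpa using hexa) (by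
        intro i j hi hj
        apply Int.cast_injective (α := K)
        push_cast
        rw [hm i hi, ha j (not_not.1 hj)]
        push_cast
        ring)
    refine ⟨fun i ↦ ?_, fun i ↦ ?_⟩
    · rw [hl i]; simp
    · rw [hs i]; simp
  · obtain ⟨hl, hs⟩ := isLongRoot_isShortRoot_iff (P := P) (k := 2) (by norm_num)
      (fun i ↦ ∃ a, ∃ s : ℤˣ, P.root i = (s : ℤ) • (2 : ℤ) • ε a) hexa hexm (by
        intro i j hi hj
        apply Int.cast_injective (α := K)
        push_cast
        rw [hm j hj, ha i hi]
        push_cast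
        ring)
    refine ⟨fun i ↦ ?_, fun i ↦ ?_⟩
    · rw [hl i]; simp
    · rw [hs i]; simp

end Lengths

section Positive

variable [P.IsCrystallographic] [P.IsReduced] [P.IsRootSystem] (b : P.Base)

/-- The positive roots. -/
def posRoots : Set M := P.root '' {i | b.IsPos i}

/-- The long positive roots. -/
def longPosRoots : Set M := P.root '' {i | b.IsPos i ∧ IsLongRoot P i}

/-- The short positive roots. -/
def shortPosRoots : Set M := P.root '' {i | b.IsPos i ∧ IsShortRoot P i}

/-- As a linear functional, the height can be evaluated on vectors such as `ε i` that need not be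
roots, so positivity of a root can be read off its coordinates. -/
theorem exists_heightFunctional : ∃ f : M →ₗ[K] K, ∀ i, f (P.root i) = b.height i := by
  refine ⟨b.toWeightBasis.constr K (fun _ ↦ (1 : K)), fun i ↦ ?_⟩
  obtain ⟨f, hf, -, h⟩ := b.exists_root_eq_sum_int i
  rw [RootPairing.Base.height_eq_sum h, h, map_sum]
  push_cast
  refine Finset.sum_congr rfl fun j hj ↦ ?_
  have : b.toWeightBasis.constr K (fun _ ↦ (1 : K)) (P.root j) = 1 := by
    have := b.toWeightBasis.constr_basis K (fun _ ↦ (1 : K)) ⟨j, hj⟩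
    simpa using this
  rw [map_zsmul, this]
  simp

/-- Any base becomes the standard one after signed permutation of the coordinates. Signs are chosen
so that the height functional is positive on each `ε i`, and the indices are sorted by decreasing
value. The values are distinct because `ε i - ε j` is a root and roots have nonzero height. The sign
of the height of every root is then determined. -/
theorem exists_normalized {p : ℕ} {c : ℤ} (hc : c = 1 ∨ c = 2) {ε : Fin p → M}
    (hε : LinearIndependent K ε) (hR : Set.range P.root = bcRoots c ε) :
    ∃ ε' : Fin p → M, LinearIndependent K ε' ∧ Set.range P.root = bcRoots c ε' ∧
      posRoots b = bcPos c ε' := by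
  have hc0 : 0 < c := by rcases hc with rfl | rfl <;> norm_num
  obtain ⟨f, hf⟩ := exists_heightFunctional b
  -- The factor `c` makes the value an integer: `c ε i` is a root, whereas `ε i` itself need not be.
  have hg : ∀ i, ∃ g : ℤ, g ≠ 0 ∧ (c : K) * f (ε i) = g := by
    intro i
    obtain ⟨j, hj⟩ : (c • ε i) ∈ Set.range P.root := by rw [hR]; exact Or.inl ⟨i, 1, by simp⟩
    refine ⟨b.height j, b.height_ne_zero j, ?_⟩
    rw [← hf j, hj, map_zsmul, zsmul_eq_mul]
  choose g hg0 hg using hg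
  have hs : ∀ i, ∃ s : ℤˣ, 0 < (s : ℤ) * g i := by
    intro i
    rcases lt_or_gt_of_ne (hg0 i) with h | h
    · exact ⟨-1, by simpa using h⟩
    · exact ⟨1, by simpa using h⟩
  choose s hs using hs
  set h : Fin p → ℤ := fun i ↦ s i * g i with hh
  set ε₁ : Fin p → M := fun i ↦ (s i : ℤ) • ε i with hε₁
  have hfε₁ : ∀ i, (c : K) * f (ε₁ i) = h i := by
    intro i
    simp only [hε₁, hh, map_zsmul, zsmul_eq_mul]
    push_cast
    rw [← hg i]
    ring
  have hR₁ : Set.range P.root = bcRoots c ε₁ := by rw [hR, hε₁, bcRoots_sign]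
  have hinj : Function.Injective h := by
    intro i j hij
    by_contra hne
    obtain ⟨k, hk⟩ : (ε₁ i - ε₁ j) ∈ Set.range P.root := by
      rw [hR₁]; exact Or.inr ⟨i, j, hne, 1, -1, by simp [sub_eq_add_neg]⟩
    have h1 := hf k
    rw [hk, map_sub] at h1
    have h2 : (c : K) * b.height k = 0 := by
      rw [← h1, mul_sub, hfε₁, hfε₁, hij, sub_self]
    have h3 : c * b.height k = 0 := by exact_mod_cast h2
    rcases mul_eq_zero.1 h3 with h4 | h4
    · omega
    · exact b.height_ne_zero k h4
  have hli₁ : LinearIndependent K ε₁ := by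
    have : ε₁ = fun i ↦ ((Units.map (Int.castRingHom K).toMonoidHom (s i) : Kˣ)) • ε i := by
      funext i
      rw [Units.smul_def]
      simp [hε₁, Int.cast_smul_eq_zsmul]
    rw [this]
    exact hε.units_smul _
  -- `Tuple.sort` sorts increasingly, hence the negation.
  set σ := Tuple.sort (fun i ↦ - h i) with hσ
  have hmono : Monotone ((fun i ↦ - h i) ∘ σ) := Tuple.monotone_sort _
  have hanti : ∀ i j : Fin p, i < j → h (σ j) < h (σ i) := by
    intro i j hij
    have h1 : h (σ j) ≤ h (σ i) := by simpa using hmono hij.le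
    refine lt_of_le_of_ne h1 fun h2 ↦ ?_
    exact hij.ne' (σ.injective (hinj h2))
  refine ⟨ε₁ ∘ σ, hli₁.comp _ σ.injective, by rw [bcRoots_perm, hR₁], ?_⟩
  have hfε : ∀ i, (c : K) * f ((ε₁ ∘ σ) i) = h (σ i) := fun i ↦ hfε₁ _
  have hpos : ∀ i, 0 < h (σ i) := fun i ↦ hs _
  have hR₂ : Set.range P.root = bcRoots c (ε₁ ∘ σ) := by rw [bcRoots_perm, hR₁]
  generalize ε₁ ∘ σ = ε' at hfε hR₂
  have haxis : ∀ k i (u : ℤˣ), P.root k = (u : ℤ) • c • ε' i → b.height k = u * h (σ i) := by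
    intro k i u hk
    have h1 := hf k
    rw [hk, map_zsmul, map_zsmul, zsmul_eq_mul, zsmul_eq_mul, hfε] at h1
    exact_mod_cast h1.symm
  have hmixed : ∀ k i j (u v : ℤˣ), P.root k = (u : ℤ) • ε' i + (v : ℤ) • ε' j →
      c * b.height k = u * h (σ i) + v * h (σ j) := by
    intro k i j u v hk
    have h1 := hf k
    rw [hk, map_add, map_zsmul, map_zsmul, zsmul_eq_mul, zsmul_eq_mul] at h1
    have : (c : K) * b.height k = u * h (σ i) + v * h (σ j) := by
      rw [← h1, ← hfε, ← hfε]
      ring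
    exact_mod_cast this
  ext x
  constructor
  · rintro ⟨k, hk, rfl⟩
    replace hk : 0 < b.height k := hk
    have hmem : P.root k ∈ bcRoots c ε' := hR₂ ▸ ⟨k, rfl⟩
    rcases hmem with ⟨i, u, hx⟩ | ⟨i, j, hij, u, v, hx⟩
    · rcases Int.units_eq_one_or u with rfl | rfl
      · exact Or.inl ⟨i, by simpa using hx⟩
      · have := hpos i
        have := haxis k i _ hx
        rw [Units.val_neg, Units.val_one] at this
        omega
    · wlog hlt : i < j generalizing i j u v with H
      · exact H j i hij.symm v u (by rw [hx, add_comm])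
          (lt_of_le_of_ne (not_lt.1 hlt) hij.symm)
      have h1 := hmixed k i j u v hx
      have h2 := hanti i j hlt
      have h3 := hpos j
      have h4 : 0 < c * b.height k := mul_pos hc0 hk
      rcases Int.units_eq_one_or u with rfl | rfl
      · rcases Int.units_eq_one_or v with rfl | rfl
        · exact Or.inr ⟨i, j, hlt, Or.inl (by simpa using hx)⟩
        · exact Or.inr ⟨i, j, hlt, Or.inr (by simpa [sub_eq_add_neg] using hx)⟩
      · exfalso
        rcases Int.units_eq_one_or v with rfl | rfl <;> simp at h1 <;> omega
  · intro hx
    obtain ⟨k, rfl⟩ : x ∈ Set.range P.root := hR₂ ▸ bcPos_subset_bcRoots c ε' hx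
    refine ⟨k, ?_, rfl⟩
    change 0 < b.height k
    rcases hx with ⟨i, hx⟩ | ⟨i, j, hij, hx | hx⟩
    · rw [haxis k i 1 (by simpa using hx), Units.val_one, one_mul]
      exact hpos i
    · have h1 := hmixed k i j 1 1 (by simpa using hx)
      have h2 := hpos i
      have h3 := hpos j
      simp at h1
      exact pos_of_mul_pos_right (by omega) hc0.le
    · have h1 := hmixed k i j 1 (-1) (by simpa [sub_eq_add_neg] using hx)
      have h2 := hanti i j hij
      simp at h1
      exact pos_of_mul_pos_right (by omega) hc0.le

end Positive

end AbstractRoots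

end LongAbelian

namespace LongAbelian

/-! ### Counts for types B and C in an abstract root system. -/

section BCCounts

variable {ι K M N : Type*} [Fintype ι] [Field K] [CharZero K] [AddCommGroup M] [Module K M]
  [AddCommGroup N] [Module K N] {P : RootPairing ι K M N}

/-- Integral linear combinations of a family of vectors. -/
def intComb {n : ℕ} (ε : Fin n → M) : (Fin n → ℤ) →+ M :=
  (Fintype.linearCombination ℤ ε).toAddMonoidHom

theorem intComb_apply {n : ℕ} (ε : Fin n → M) (x : Fin n → ℤ) :
    intComb ε x = ∑ i, x i • ε i := by
  simp [intComb, Fintype.linearCombination_apply]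

theorem intComb_single {n : ℕ} (ε : Fin n → M) (i : Fin n) :
    intComb ε (Pi.single i 1) = ε i := by
  simp [intComb, Fintype.linearCombination_apply_single]

theorem intComb_injective {n : ℕ} {ε : Fin n → M} (hε : LinearIndependent K ε) :
    Function.Injective (intComb ε) :=
  (hε.restrict_scalars' ℤ).fintypeLinearCombination_injective

theorem bcPos_eq_image {p : ℕ} (c : ℤ) (ε : Fin p → M) :
    bcPos c ε = intComb ε '' bcPos c stdVec := by
  ext x
  constructor
  · rintro (⟨i, rfl⟩ | ⟨i, j, hij, rfl | rfl⟩)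
    · exact ⟨_, Or.inl ⟨i, rfl⟩, by rw [map_zsmul, stdVec, intComb_single]⟩
    · exact ⟨_, Or.inr ⟨i, j, hij, Or.inl rfl⟩, by simp [stdVec, intComb_single]⟩
    · exact ⟨_, Or.inr ⟨i, j, hij, Or.inr rfl⟩, by simp [stdVec, intComb_single]⟩
  · rintro ⟨_, ⟨i, rfl⟩ | ⟨i, j, hij, rfl | rfl⟩, rfl⟩
    · exact Or.inl ⟨i, by rw [map_zsmul, stdVec, intComb_single]⟩
    · exact Or.inr ⟨i, j, hij, Or.inl (by simp [stdVec, intComb_single])⟩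
    · exact Or.inr ⟨i, j, hij, Or.inr (by simp [stdVec, intComb_single])⟩

theorem bcMixed_eq_image {p : ℕ} (ε : Fin p → M) :
    bcMixed ε = intComb ε '' bcMixed stdVec := by
  ext x
  constructor
  · rintro ⟨i, j, hij, rfl | rfl⟩
    · exact ⟨_, ⟨i, j, hij, Or.inl rfl⟩, by simp [stdVec, intComb_single]⟩
    · exact ⟨_, ⟨i, j, hij, Or.inr rfl⟩, by simp [stdVec, intComb_single]⟩
  · rintro ⟨_, ⟨i, j, hij, rfl | rfl⟩, rfl⟩
    · exact ⟨i, j, hij, Or.inl (by simp [stdVec, intComb_single])⟩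
    · exact ⟨i, j, hij, Or.inr (by simp [stdVec, intComb_single])⟩

theorem bcAxis_eq_image {p : ℕ} (c : ℤ) (ε : Fin p → M) :
    bcAxis c ε = intComb ε '' bcAxis c stdVec := by
  ext x
  constructor
  · rintro ⟨i, rfl⟩
    exact ⟨_, ⟨i, rfl⟩, by rw [map_zsmul, stdVec, intComb_single]⟩
  · rintro ⟨_, ⟨i, rfl⟩, rfl⟩
    exact ⟨i, by rw [map_zsmul, stdVec, intComb_single]⟩

theorem exists_axis_iff {p : ℕ} {ε : Fin p → M} (hε : LinearIndependent K ε) {c : ℤ} {x : M}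
    (hx : x ∈ bcPos c ε) :
    ((∃ a, ∃ s : ℤˣ, x = (s : ℤ) • c • ε a) ↔ x ∈ bcAxis c ε) ∧
    ((¬ ∃ a, ∃ s : ℤˣ, x = (s : ℤ) • c • ε a) ↔ x ∈ bcMixed ε) := by
  rcases hx with ⟨i, rfl⟩ | ⟨i, j, hij, hx⟩
  · have h1 : ∃ a, ∃ s : ℤˣ, c • ε i = (s : ℤ) • c • ε a := ⟨i, 1, by simp⟩
    refine ⟨iff_of_true h1 ⟨i, rfl⟩, iff_of_false (not_not.2 h1) ?_⟩
    rintro ⟨k, l, hkl, h | h⟩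
    · exact mixed_ne_axis hε hkl.ne 1 1 1 (by simpa using h.symm)
    · exact mixed_ne_axis hε hkl.ne 1 (-1) 1 (by simpa [sub_eq_add_neg] using h.symm)
  · obtain ⟨t, rfl⟩ : ∃ t : ℤˣ, x = ((1 : ℤˣ) : ℤ) • ε i + (t : ℤ) • ε j := by
      rcases hx with rfl | rfl
      · exact ⟨1, by simp⟩
      · exact ⟨-1, by simp [sub_eq_add_neg]⟩
    have h1 : ¬ ∃ a, ∃ s : ℤˣ, ((1 : ℤˣ) : ℤ) • ε i + (t : ℤ) • ε j = (s : ℤ) • c • ε a := by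
      rintro ⟨a, s, h⟩
      exact mixed_ne_axis hε hij.ne _ _ _ h
    refine ⟨iff_of_false h1 ?_, iff_of_true h1 ⟨i, j, hij, hx⟩⟩
    rintro ⟨a, h⟩
    exact h1 ⟨a, 1, by rw [h]; simp⟩

variable [P.IsCrystallographic] [P.IsReduced] [P.IsRootSystem] (b : P.Base)

theorem longPosRoots_shortPosRoots_of_typeB {p : ℕ} (hp : 2 ≤ p) {ε : Fin p → M}
    (hε : LinearIndependent K ε) (hR : Set.range P.root = bcRoots 1 ε)
    (hb : posRoots b = bcPos 1 ε) :
    longPosRoots b = bcMixed ε ∧ shortPosRoots b = bcAxis 1 ε := by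
  obtain ⟨hl, hs⟩ := bc_long_short hp (Or.inl rfl) hε hR
  refine ⟨?_, ?_⟩
  · ext x
    constructor
    · rintro ⟨i, ⟨hi, hi'⟩, rfl⟩
      have hx : P.root i ∈ bcPos 1 ε := hb ▸ ⟨i, hi, rfl⟩
      rw [hl] at hi'
      rw [← (exists_axis_iff (c := 1) hε hx).2]
      simpa using hi'
    · intro hx
      obtain ⟨i, hi, rfl⟩ : x ∈ posRoots b := hb ▸ Or.inr hx
      refine ⟨i, ⟨hi, ?_⟩, rfl⟩
      rw [hl]
      rw [← (exists_axis_iff (c := 1) hε (Or.inr hx)).2] at hx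
      simpa using hx
  · ext x
    constructor
    · rintro ⟨i, ⟨hi, hi'⟩, rfl⟩
      have hx : P.root i ∈ bcPos 1 ε := hb ▸ ⟨i, hi, rfl⟩
      rw [hs] at hi'
      rw [← (exists_axis_iff (c := 1) hε hx).1]
      simpa using hi'
    · intro hx
      obtain ⟨i, hi, rfl⟩ : x ∈ posRoots b := hb ▸ Or.inl hx
      refine ⟨i, ⟨hi, ?_⟩, rfl⟩
      rw [hs]
      rw [← (exists_axis_iff (c := 1) hε (Or.inl hx)).1] at hx
      simpa using hx

theorem longPosRoots_shortPosRoots_of_typeC {p : ℕ} (hp : 2 ≤ p) {ε : Fin p → M}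
    (hε : LinearIndependent K ε) (hR : Set.range P.root = bcRoots 2 ε)
    (hb : posRoots b = bcPos 2 ε) :
    longPosRoots b = bcAxis 2 ε ∧ shortPosRoots b = bcMixed ε := by
  obtain ⟨hl, hs⟩ := bc_long_short hp (Or.inr rfl) hε hR
  refine ⟨?_, ?_⟩
  · ext x
    constructor
    · rintro ⟨i, ⟨hi, hi'⟩, rfl⟩
      have hx : P.root i ∈ bcPos 2 ε := hb ▸ ⟨i, hi, rfl⟩
      rw [hl] at hi'
      rw [← (exists_axis_iff (c := 2) hε hx).1]
      simpa using hi'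
    · intro hx
      obtain ⟨i, hi, rfl⟩ : x ∈ posRoots b := hb ▸ Or.inl hx
      refine ⟨i, ⟨hi, ?_⟩, rfl⟩
      rw [hl]
      rw [← (exists_axis_iff (c := 2) hε (Or.inl hx)).1] at hx
      simpa using hx
  · ext x
    constructor
    · rintro ⟨i, ⟨hi, hi'⟩, rfl⟩
      have hx : P.root i ∈ bcPos 2 ε := hb ▸ ⟨i, hi, rfl⟩
      rw [hs] at hi'
      rw [← (exists_axis_iff (c := 2) hε hx).2]
      simpa using hi'
    · intro hx
      obtain ⟨i, hi, rfl⟩ : x ∈ posRoots b := hb ▸ Or.inr hx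
      refine ⟨i, ⟨hi, ?_⟩, rfl⟩
      rw [hs]
      rw [← (exists_axis_iff (c := 2) hε (Or.inr hx)).2] at hx
      simpa using hx

theorem ncard_stableFamily_typeB {p : ℕ} (hp : 2 ≤ p) {ε : Fin p → M}
    (hε : LinearIndependent K ε) (hR : Set.range P.root = bcRoots 1 ε) :
    (stableFamily (posRoots b) (posRoots b) (longPosRoots b)).ncard = 2 ^ (p - 1) ∧
    (stableFamily (posRoots b) (shortPosRoots b) (shortPosRoots b)).ncard = 2 := by
  obtain ⟨ε', hε', hR', hb⟩ := exists_normalized b (Or.inl rfl) hε hR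
  obtain ⟨hl, hs⟩ := longPosRoots_shortPosRoots_of_typeB b hp hε' hR' hb
  rw [hl, hs, hb, bcPos_eq_image, bcMixed_eq_image, bcAxis_eq_image,
    ncard_stableFamily_image _ (intComb_injective hε'),
    ncard_stableFamily_image _ (intComb_injective hε')]
  exact ⟨ncard_stableFamily_long_B hp, ncard_stableFamily_short_B hp⟩

theorem ncard_stableFamily_typeC {p : ℕ} (hp : 2 ≤ p) {ε : Fin p → M}
    (hε : LinearIndependent K ε) (hR : Set.range P.root = bcRoots 2 ε) :
    (stableFamily (posRoots b) (posRoots b) (longPosRoots b)).ncard = 2 ∧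
    (stableFamily (posRoots b) (shortPosRoots b) (shortPosRoots b)).ncard = 2 ^ (p - 1) := by
  obtain ⟨ε', hε', hR', hb⟩ := exists_normalized b (Or.inr rfl) hε hR
  obtain ⟨hl, hs⟩ := longPosRoots_shortPosRoots_of_typeC b hp hε' hR' hb
  rw [hl, hs, hb, bcPos_eq_image, bcMixed_eq_image, bcAxis_eq_image,
    ncard_stableFamily_image _ (intComb_injective hε'),
    ncard_stableFamily_image _ (intComb_injective hε')]
  exact ⟨ncard_stableFamily_long_C hp, ncard_stableFamily_short_C hp⟩

end BCCounts

/-! ### Families that are initial segments of a chain. -/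

section ChainFamilies

variable {G : Type*} [AddGroup G] [DecidableEq G]

/-- If every stable set is forced to lie in the list `ch`, in which each term is obtained from the
next one by adding a positive root, then the stable sets are the initial segments of `ch`. -/
theorem ncard_stableFamily_of_chain {A T D : Set G} {ch : List G} (hc : ch.Nodup) (ht : G → ℤ) (B : ℤ)
    (hB : ∀ x ∈ D, ht x < B)
    (h1 : ∀ x ∈ D, x ∉ ch → (∃ α ∈ A, x + α ∈ T ∧ x + α ∉ ch ∧ ht x < ht (x + α)) ∨
      ∃ α ∈ A, x + α ∈ T ∧ x + (x + α) ∈ A)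
    (h2 : ∀ i : ℕ, ∀ h : i + 1 < ch.length, ∃ α ∈ A, ch[i + 1] + α = ch[i] ∧ ch[i] ∈ T)
    (h3 : ∀ k ≤ ch.length, ∀ x ∈ ch.take k, x ∈ D ∧ (∀ α ∈ A, x + α ∈ T → x + α ∈ ch.take k) ∧
      ∀ y ∈ ch.take k, x + y ∉ A) :
    (stableFamily A T D).ncard = ch.length + 1 := by
  have key : stableFamily A T D =
      (fun k ↦ {x | x ∈ ch.take k}) '' (Finset.range (ch.length + 1) : Set ℕ) := by
    ext S
    constructor
    · rintro ⟨hS1, hS2, hS3⟩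
      -- Induction on the distance to the bound `B`: an element outside the chain either produces a
      -- higher one outside the chain or two elements whose sum lies in `A`.
      have hsub : ∀ n : ℕ, ∀ x ∈ S, x ∉ ch → B ≤ ht x + n → False := by
        intro n
        induction n with
        | zero =>
          intro x hx _ hn
          have := hB x (hS1 hx)
          simp at hn
          omega
        | succ n ih =>
          intro x hx hxc hn
          rcases h1 x (hS1 hx) hxc with ⟨α, hα, hT, hαc, hlt⟩ | ⟨α, hα, hT, hA⟩
          · refine ih (x + α) (hS2 x hx α hα hT) hαc ?_
            push_cast at hn
            omega
          · exact hS3 x hx _ (hS2 x hx α hα hT) hA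
      have hsub' : ∀ x ∈ S, x ∈ ch := by
        intro x hx
        by_contra hxc
        exact hsub (B - ht x).toNat x hx hxc (by have := Int.self_le_toNat (B - ht x); omega)
      -- The least position whose entry is missing from `S` is the length of the segment; the
      -- position past the end counts as missing.
      have hex : ∃ k, ∀ x, ch[k]? = some x → x ∉ S := ⟨ch.length, by simp⟩
      classical
      set k := Nat.find hex with hk
      have hkS := Nat.find_spec hex
      have hup : ∀ i, k ≤ i → ∀ x, ch[i]? = some x → x ∉ S := by
        intro i hi
        induction i, hi using Nat.le_induction with
        | base => exact hkS
        | succ i hi ih =>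
          intro x hx hxS
          obtain ⟨hlt, rfl⟩ := List.getElem?_eq_some_iff.1 hx
          obtain ⟨α, hα, he, hT⟩ := h2 i hlt
          refine ih ch[i] (List.getElem?_eq_getElem (by omega)) ?_
          rw [← he]
          exact hS2 _ hxS α hα (he ▸ hT)
      have hkle : k ≤ ch.length := Nat.find_min' hex (by simp)
      refine ⟨k, by simpa using Nat.lt_succ_of_le hkle, ?_⟩
      ext x
      simp only [Set.mem_ofPred_eq]
      constructor
      · intro hx
        obtain ⟨i, hi, rfl⟩ := List.getElem_of_mem hx
        rw [List.length_take] at hi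
        have hik : i < k := by omega
        have := Nat.find_min hex hik
        push Not at this
        obtain ⟨y, hy, hyS⟩ := this
        rw [List.getElem_take]
        rw [List.getElem?_eq_getElem (by omega), Option.some_inj] at hy
        rwa [hy]
      · intro hx
        obtain ⟨i, hi, rfl⟩ := List.getElem_of_mem (hsub' x hx)
        have hik : i < k := by
          by_contra hik
          exact hup i (not_lt.1 hik) _ (List.getElem?_eq_getElem hi) hx
        rw [List.mem_take_iff_getElem]
        exact ⟨i, by omega, rfl⟩
    · rintro ⟨k, hk, rfl⟩
      have hk' : k ≤ ch.length := by simpa [Nat.lt_succ_iff] using hk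
      exact ⟨fun x hx ↦ (h3 k hk' x hx).1, fun x hx ↦ (h3 k hk' x hx).2.1,
        fun x hx ↦ (h3 k hk' x hx).2.2⟩
  rw [key, Set.InjOn.ncard_image, Set.ncard_coe_finset, Finset.card_range]
  intro k hk l hl hkl
  have hk' : k ≤ ch.length := by simpa [Nat.lt_succ_iff] using hk
  have hl' : l ≤ ch.length := by simpa [Nat.lt_succ_iff] using hl
  have : (ch.take k).toFinset = (ch.take l).toFinset := by
    ext x
    simpa using Set.ext_iff.1 hkl x
  have := congrArg Finset.card this
  rw [List.toFinset_card_of_nodup (hc.sublist (List.take_sublist _ _)),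
    List.toFinset_card_of_nodup (hc.sublist (List.take_sublist _ _)), List.length_take,
    List.length_take] at this
  omega

end ChainFamilies

/-! ### Positive roots and lengths from a Cartan matrix. -/

section CartanMatrix

variable {ι K M N : Type*} [Fintype ι] [Field K] [CharZero K] [AddCommGroup M] [Module K M]
  [AddCommGroup N] [Module K N] {P : RootPairing ι K M N} {n : ℕ}

/-- The action of a simple reflection on coordinates with respect to the simple roots. -/
def simpleRefl (A : Matrix (Fin n) (Fin n) ℤ) (j : Fin n) (x : Fin n → ℤ) : Fin n → ℤ :=
  x - Pi.single j (∑ k, x k * A k j)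

/-- The quadratic form given by a Cartan matrix `A` symmetrized by `d`. -/
def cartanForm (A : Matrix (Fin n) (Fin n) ℤ) (d : Fin n → ℤ) (x : Fin n → ℤ) : ℤ :=
  ∑ i, ∑ j, x i * x j * (A i j * d j)

variable [P.IsCrystallographic] (b : P.Base) {A : Matrix (Fin n) (Fin n) ℤ}
  {e : b.support ≃ Fin n} (he : ∀ i j, b.cartanMatrix i j = A (e i) (e j))

include he

theorem pairing_simple (i j : Fin n) : P.pairing (e.symm i) (e.symm j) = A i j := by
  have := he (e.symm i) (e.symm j)
  rw [Equiv.apply_symm_apply, Equiv.apply_symm_apply] at this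
  rw [← this, ← P.algebraMap_pairingIn ℤ]
  rfl

theorem reflection_intComb (j : Fin n) (x : Fin n → ℤ) :
    P.reflection (e.symm j) (intComb (fun i ↦ P.root (e.symm i)) x) =
      intComb (fun i ↦ P.root (e.symm i)) (simpleRefl A j x) := by
  have hsingle : ∀ m : ℤ, intComb (fun i ↦ P.root (e.symm i)) (Pi.single j m) =
      m • P.root (e.symm j) := by
    intro m
    simp [intComb, Fintype.linearCombination_apply_single]
  rw [simpleRefl, map_sub, hsingle, RootPairing.reflection_apply, intComb_apply, map_sum]
  congr 1
  rw [Finset.sum_smul, Finset.sum_smul]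
  refine Finset.sum_congr rfl fun i _ ↦ ?_
  rw [map_zsmul, RootPairing.root_coroot'_eq_pairing, pairing_simple b he, zsmul_eq_mul,
    ← Int.cast_smul_eq_zsmul K]
  push_cast
  rfl

variable [P.IsReduced] [P.IsRootSystem]

/-- The hypotheses are finite checks on `L`. The set `L ∪ -L` contains the simple roots and is
stable under simple reflections, so it contains every root. Conversely each element of `L` that is
not simple is carried by a simple reflection to an element of smaller coordinate sum, so it is a
root by induction. The coordinate sum is the height, which separates `L` from `-L`. -/
theorem posRoots_eq_image {L : List (Fin n → ℤ)} (hbase : ∀ j, Pi.single j 1 ∈ L)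
    (hrefl : ∀ x ∈ L, ∀ j, simpleRefl A j x ∈ L ∨ -simpleRefl A j x ∈ L)
    (hgen : ∀ x ∈ L, (∃ j, x = Pi.single j 1) ∨
      ∃ j, simpleRefl A j (simpleRefl A j x) = x ∧ simpleRefl A j x ∈ L ∧
        ∑ i, simpleRefl A j x i < ∑ i, x i)
    (hpos : ∀ x ∈ L, 0 < ∑ i, x i) :
    posRoots b = intComb (fun i ↦ P.root (e.symm i)) '' {x | x ∈ L} := by
  set v := intComb (fun i ↦ P.root (e.symm i)) with hv
  obtain ⟨f, hf⟩ := exists_heightFunctional b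
  have hfv : ∀ x, f (v x) = (∑ i, x i : ℤ) := by
    intro x
    rw [hv, intComb_apply, map_sum]
    push_cast
    refine Finset.sum_congr rfl fun i _ ↦ ?_
    rw [map_zsmul, hf, RootPairing.Base.height_one_of_mem_support (e.symm i).2]
    simp
  have hht : ∀ i x, P.root i = v x → b.height i = ∑ j, x j := by
    intro i x hi
    have := hf i
    rw [hi, hfv] at this
    exact_mod_cast this.symm
  have hroots : ∀ i, ∃ x, (x ∈ L ∨ -x ∈ L) ∧ P.root i = v x := by
    intro i
    induction i using b.induction_reflect with
    | h₀ i hi =>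
      obtain ⟨x, hx, hi⟩ := hi
      refine ⟨-x, by rwa [neg_neg, or_comm], ?_⟩
      rw [RootPairing.root_reflectionPerm, RootPairing.reflection_apply_self, hi, map_neg]
    | h₁ i hi =>
      refine ⟨Pi.single (e ⟨i, hi⟩) 1, Or.inl (hbase _), ?_⟩
      rw [hv, intComb_single]
      simp
    | h₂ i j hi hj =>
      obtain ⟨x, hx, hi⟩ := hi
      refine ⟨simpleRefl A (e ⟨j, hj⟩) x, ?_, ?_⟩
      · rcases hx with hx | hx
        · exact hrefl x hx _
        · have := hrefl _ hx (e ⟨j, hj⟩)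
          have hneg : simpleRefl A (e ⟨j, hj⟩) (-x) = -simpleRefl A (e ⟨j, hj⟩) x := by
            simp only [simpleRefl, Pi.neg_apply, neg_mul, Finset.sum_neg_distrib, Pi.single_neg]
            abel
          rwa [hneg, neg_neg, or_comm] at this
      · rw [RootPairing.root_reflectionPerm, hi, hv, ← reflection_intComb b he]
        simp
  have hex : ∀ m : ℕ, ∀ x ∈ L, ∑ i, x i ≤ m → ∃ i, P.root i = v x := by
    intro m
    induction m with
    | zero =>
      intro x hx hm
      have := hpos x hx
      simp at hm
      omega
    | succ m ih =>
      intro x hx hm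
      rcases hgen x hx with ⟨j, rfl⟩ | ⟨j, hj, hjL, hlt⟩
      · exact ⟨e.symm j, by rw [hv, intComb_single]⟩
      · obtain ⟨i, hi⟩ := ih _ hjL (by push_cast at hm; omega)
        refine ⟨P.reflectionPerm (e.symm j) i, ?_⟩
        rw [RootPairing.root_reflectionPerm, hi, hv, reflection_intComb b he, hj]
  ext y
  constructor
  · rintro ⟨i, hi, rfl⟩
    obtain ⟨x, hx, hix⟩ := hroots i
    refine ⟨x, hx.resolve_right fun hx' ↦ ?_, hix.symm⟩
    have h1 := hpos _ hx'
    have h2 : 0 < b.height i := hi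
    rw [hht i x hix] at h2
    simp only [Pi.neg_apply, Finset.sum_neg_distrib] at h1
    omega
  · rintro ⟨x, hx, rfl⟩
    obtain ⟨i, hi⟩ := hex (∑ i, x i).toNat x hx (Int.self_le_toNat _)
    refine ⟨i, ?_, hi⟩
    change 0 < b.height i
    rw [hht i x hi]
    exact hpos x hx

omit [P.IsReduced] [P.IsRootSystem] in
-- Since `A i j * d j * q` is twice the form on two simple roots, `cartanForm` gives twice the
-- squared length in units of `q`. This is the origin of the values `2` and `2 * k` below.
theorem two_mul_rootLength {d : Fin n → ℤ} {q : ℤ}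
    (hd : ∀ j, (P.posRootForm ℤ).rootLength (e.symm j) = d j * q) {i : ι} {x : Fin n → ℤ}
    (hi : P.root i = intComb (fun i ↦ P.root (e.symm i)) x) :
    2 * (P.posRootForm ℤ).rootLength i = cartanForm A d x * q := by
  apply Int.cast_injective (α := K)
  have hlen : ∀ i, ((P.posRootForm ℤ).rootLength i : K) =
      (P.posRootForm ℤ).toInvariantForm.form (P.root i) (P.root i) := fun i ↦
    (P.posRootForm ℤ).algebraMap_rootLength i
  have hB : ∀ i j, 2 * (P.posRootForm ℤ).toInvariantForm.form (P.root (e.symm i))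
      (P.root (e.symm j)) = A i j * (d j * q) := by
    intro i j
    rw [(P.posRootForm ℤ).toInvariantForm.two_mul_apply_root_root, ← hlen, hd,
      pairing_simple b he]
    push_cast
    rfl
  have hcast : ((cartanForm A d x : ℤ) : K) = ∑ i, ∑ j, (x i : K) * x j * (A i j * d j) := by
    simp only [cartanForm]
    push_cast
    rfl
  rw [Int.cast_mul, Int.cast_mul, hcast, hlen, hi, intComb_apply, map_sum, Finset.sum_comm,
    Finset.sum_mul, Finset.mul_sum]
  refine Finset.sum_congr rfl fun j _ ↦ ?_
  rw [map_zsmul, map_sum, LinearMap.sum_apply, Finset.sum_mul, Finset.smul_sum, Finset.mul_sum]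
  refine Finset.sum_congr rfl fun i _ ↦ ?_
  rw [map_zsmul, ← Int.cast_smul_eq_zsmul K, ← Int.cast_smul_eq_zsmul K, LinearMap.smul_apply,
    smul_eq_mul, smul_eq_mul]
  push_cast
  linear_combination (x i : K) * x j * hB i j

theorem longPosRoots_shortPosRoots_of_cartanMatrix {L : List (Fin n → ℤ)} {d : Fin n → ℤ} {k q : ℤ}
    (hk : 1 < k) (hL : posRoots b = intComb (fun i ↦ P.root (e.symm i)) '' {x | x ∈ L})
    (hd : ∀ j, (P.posRootForm ℤ).rootLength (e.symm j) = d j * q)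
    (hform : ∀ x ∈ L, cartanForm A d x = 2 * k ∨ cartanForm A d x = 2)
    (hlong : ∃ x ∈ L, cartanForm A d x = 2 * k) (hshort : ∃ x ∈ L, cartanForm A d x = 2) :
    longPosRoots b = intComb (fun i ↦ P.root (e.symm i)) ''
      {x | x ∈ L ∧ cartanForm A d x = 2 * k} ∧
    shortPosRoots b = intComb (fun i ↦ P.root (e.symm i)) ''
      {x | x ∈ L ∧ cartanForm A d x = 2} := by
  set v := intComb (fun i ↦ P.root (e.symm i)) with hv
  have hlen : ∀ i x, P.root i = v x →
      2 * (P.posRootForm ℤ).rootLength i = cartanForm A d x * q :=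
    fun i x hi ↦ two_mul_rootLength b he hd hi
  have hmem : ∀ x ∈ L, ∃ i, b.IsPos i ∧ P.root i = v x := by
    intro x hx
    have : v x ∈ posRoots b := hL ▸ ⟨x, hx, rfl⟩
    exact this
  have hmem' : ∀ i, b.IsPos i → ∃ x ∈ L, P.root i = v x := by
    intro i hi
    have : P.root i ∈ v '' {x | x ∈ L} := hL ▸ ⟨i, hi, rfl⟩
    obtain ⟨x, hx, h⟩ := this
    exact ⟨x, hx, h.symm⟩
  obtain ⟨xs, hxs, hs⟩ := hshort
  obtain ⟨xl, hxl, hl⟩ := hlong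
  obtain ⟨is, -, his⟩ := hmem xs hxs
  obtain ⟨il, -, hil⟩ := hmem xl hxl
  -- The list describes positive roots only; a negative root has the length of its negative.
  have hq : ∀ i, (P.posRootForm ℤ).rootLength i = q ∨ (P.posRootForm ℤ).rootLength i = k * q := by
    have aux : ∀ i, b.IsPos i → (P.posRootForm ℤ).rootLength i = q ∨
        (P.posRootForm ℤ).rootLength i = k * q := by
      intro i hi
      obtain ⟨x, hx, hix⟩ := hmem' i hi
      have h1 := hlen i x hix
      rcases hform x hx with h2 | h2
      · right; rw [h2] at h1; linarith
      · left; rw [h2] at h1; linarith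
    intro i
    let := P.indexNeg
    rcases RootPairing.Base.IsPos.or_neg b i with hi | hi
    · exact aux i hi
    · have := aux _ hi
      rwa [RootPairing.indexNeg_neg, RootPairing.RootPositiveForm.rootLength_reflectionPerm_self]
        at this
  have hqs : (P.posRootForm ℤ).rootLength is = q := by
    have := hlen is xs his
    rw [hs] at this
    linarith
  have hql : (P.posRootForm ℤ).rootLength il = k * q := by
    have := hlen il xl hil
    rw [hl] at this
    linarith
  have hq0 : 0 < q := hqs ▸ (P.posRootForm ℤ).rootLength_pos is
  have hkq : q ≠ k * q := by nlinarith
  obtain ⟨hL1, hS1⟩ := isLongRoot_isShortRoot_iff (P := P) hk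
    (fun i ↦ (P.posRootForm ℤ).rootLength i = k * q) ⟨il, hql⟩ ⟨is, by rw [hqs]; exact hkq⟩ (by
      intro i j hi hj
      rw [hi, (hq j).resolve_right hj])
  refine ⟨?_, ?_⟩
  · ext y
    constructor
    · rintro ⟨i, ⟨hi, hi'⟩, rfl⟩
      obtain ⟨x, hx, hix⟩ := hmem' i hi
      refine ⟨x, ⟨hx, ?_⟩, hix.symm⟩
      have h1 := hlen i x hix
      rw [(hL1 i).1 hi'] at h1
      exact mul_right_cancel₀ hq0.ne' (by linarith)
    · rintro ⟨x, ⟨hx, hx'⟩, rfl⟩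
      obtain ⟨i, hi, hix⟩ := hmem x hx
      refine ⟨i, ⟨hi, (hL1 i).2 ?_⟩, hix⟩
      have h1 := hlen i x hix
      rw [hx'] at h1
      linarith
  · ext y
    constructor
    · rintro ⟨i, ⟨hi, hi'⟩, rfl⟩
      obtain ⟨x, hx, hix⟩ := hmem' i hi
      refine ⟨x, ⟨hx, ?_⟩, hix.symm⟩
      have h1 := hlen i x hix
      rw [(hq i).resolve_right ((hS1 i).1 hi')] at h1
      exact mul_right_cancel₀ hq0.ne' (by linarith)
    · rintro ⟨x, ⟨hx, hx'⟩, rfl⟩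
      obtain ⟨i, hi, hix⟩ := hmem x hx
      refine ⟨i, ⟨hi, (hS1 i).2 ?_⟩, hix⟩
      have h1 := hlen i x hix
      rw [hx'] at h1
      have : (P.posRootForm ℤ).rootLength i = q := by linarith
      rw [this]
      exact hkq

omit [P.IsReduced] [P.IsRootSystem] in
-- Both sides are twice the form on the two simple roots. Along the edges of the Dynkin diagram this
-- fixes the ratios of the lengths.
theorem rootLength_simple_swap (i j : Fin n) :
    A j i * (P.posRootForm ℤ).rootLength (e.symm i) =
      A i j * (P.posRootForm ℤ).rootLength (e.symm j) := by
  have h := (P.posRootForm ℤ).pairingIn_mul_eq_pairingIn_mul_swap (e.symm i) (e.symm j)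
  have h1 := he (e.symm i) (e.symm j)
  have h2 := he (e.symm j) (e.symm i)
  rw [Equiv.apply_symm_apply, Equiv.apply_symm_apply] at h1 h2
  rw [← h1, ← h2]
  exact h

omit he [P.IsReduced] [P.IsRootSystem] in
theorem linearIndependent_simple (e : b.support ≃ Fin n) :
    LinearIndependent K fun i ↦ P.root (e.symm i) :=
  (linearIndependent_equiv e.symm).2 b.linearIndepOn_root

end CartanMatrix

/-! ### Types F₄ and G₂. -/

section Exceptional

/-- The positive roots of type `F₄` in coordinates with respect to the simple roots. -/
def f4Roots : List (Fin 4 → ℤ) :=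
  [![0, 0, 0, 1], ![0, 0, 1, 0], ![0, 1, 0, 0], ![1, 0, 0, 0], ![0, 0, 1, 1], ![0, 1, 1, 0],
    ![1, 1, 0, 0], ![0, 1, 1, 1], ![0, 1, 2, 0], ![1, 1, 1, 0], ![0, 1, 2, 1], ![1, 1, 1, 1],
    ![1, 1, 2, 0], ![0, 1, 2, 2], ![1, 1, 2, 1], ![1, 2, 2, 0], ![1, 1, 2, 2], ![1, 2, 2, 1],
    ![1, 2, 2, 2], ![1, 2, 3, 1], ![1, 2, 3, 2], ![1, 2, 4, 2], ![1, 3, 4, 2], ![2, 3, 4, 2]]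

/-- The positive roots of type `G₂` in coordinates with respect to the simple roots. -/
def g2Roots : List (Fin 2 → ℤ) :=
  [![0, 1], ![1, 0], ![1, 1], ![1, 2], ![1, 3], ![2, 3]]

/-- The squared lengths of the simple roots of type `F₄`, up to a scalar. -/
def f4Diag : Fin 4 → ℤ := ![2, 2, 1, 1]

/-- The squared lengths of the simple roots of type `G₂`, up to a scalar. -/
def g2Diag : Fin 2 → ℤ := ![3, 1]

theorem ncard_stableFamily_f4_long :
    (stableFamily {x | x ∈ f4Roots} {x | x ∈ f4Roots}
      {x | x ∈ f4Roots ∧ cartanForm CartanMatrix.F₄ f4Diag x = 2 * 2}).ncard = 4 := by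
  -- The three highest long roots. The next one, `(1, 2, 2, 2)`, is raised by a simple root to the
  -- short root `(1, 2, 3, 2)`. The highest root has height `11`, so `12` is a strict bound.
  refine ncard_stableFamily_of_chain (ch := [![2, 3, 4, 2], ![1, 3, 4, 2], ![1, 2, 4, 2]])
    (by decide +kernel) (fun x ↦ ∑ i, x i) 12 ?_ ?_ ?_ ?_
  · rintro x ⟨hx, hq⟩
    revert x
    decide +kernel
  · rintro x ⟨hx, hq⟩
    revert x
    simp only [Set.mem_ofPred_eq]
    decide +kernel
  · intro i hi
    simp only [List.length_cons, List.length_nil] at hi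
    have hi' : i < 2 := by omega
    simp only [Set.mem_ofPred_eq]
    interval_cases i <;> decide +kernel +revert
  · intro k hk
    simp only [List.length_cons, List.length_nil] at hk
    simp only [Set.mem_ofPred_eq]
    interval_cases k <;> decide +kernel

theorem ncard_stableFamily_f4_short :
    (stableFamily {x | x ∈ f4Roots} {x | x ∈ f4Roots ∧ cartanForm CartanMatrix.F₄ f4Diag x = 2}
      {x | x ∈ f4Roots ∧ cartanForm CartanMatrix.F₄ f4Diag x = 2}).ncard = 4 := by
  -- The three highest short roots. The next one, `(1, 1, 2, 1)`, is raised to `(1, 2, 2, 1)`, and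
  -- these two add up to the highest root.
  refine ncard_stableFamily_of_chain (ch := [![1, 2, 3, 2], ![1, 2, 3, 1], ![1, 2, 2, 1]])
    (by decide +kernel) (fun x ↦ ∑ i, x i) 12 ?_ ?_ ?_ ?_
  · rintro x ⟨hx, hq⟩
    revert x
    decide +kernel
  · rintro x ⟨hx, hq⟩
    revert x
    simp only [Set.mem_ofPred_eq]
    decide +kernel
  · intro i hi
    simp only [List.length_cons, List.length_nil] at hi
    have hi' : i < 2 := by omega
    simp only [Set.mem_ofPred_eq]
    interval_cases i <;> decide +kernel +revert
  · intro k hk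
    simp only [List.length_cons, List.length_nil] at hk
    simp only [Set.mem_ofPred_eq]
    interval_cases k <;> decide +kernel

theorem ncard_stableFamily_g2_long :
    (stableFamily {x | x ∈ g2Roots} {x | x ∈ g2Roots}
      {x | x ∈ g2Roots ∧ cartanForm CartanMatrix.G₂ g2Diag x = 2 * 3}).ncard = 3 := by
  -- The remaining long positive root is simple; adding the short simple root to it gives a short
  -- root.
  refine ncard_stableFamily_of_chain (ch := [![2, 3], ![1, 3]])
    (by decide +kernel) (fun x ↦ ∑ i, x i) 6 ?_ ?_ ?_ ?_
  · rintro x ⟨hx, hq⟩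
    revert x
    decide +kernel
  · rintro x ⟨hx, hq⟩
    revert x
    simp only [Set.mem_ofPred_eq]
    decide +kernel
  · intro i hi
    simp only [List.length_cons, List.length_nil] at hi
    have hi' : i < 1 := by omega
    simp only [Set.mem_ofPred_eq]
    interval_cases i <;> decide +kernel +revert
  · intro k hk
    simp only [List.length_cons, List.length_nil] at hk
    simp only [Set.mem_ofPred_eq]
    interval_cases k <;> decide +kernel

variable {ι K M N : Type*} [Fintype ι] [Field K] [CharZero K] [AddCommGroup M] [Module K M]
  [AddCommGroup N] [Module K N] {P : RootPairing ι K M N} [P.IsCrystallographic]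
  [P.IsReduced] [P.IsRootSystem] (b : P.Base)

theorem ncard_stableFamily_typeF4 (h : HasCartanMatrix b CartanMatrix.F₄) :
    (stableFamily (posRoots b) (posRoots b) (longPosRoots b)).ncard = 4 ∧
    (stableFamily (posRoots b) (shortPosRoots b) (shortPosRoots b)).ncard = 4 := by
  obtain ⟨e, he⟩ := h
  have hL := posRoots_eq_image b he (L := f4Roots) (by decide +kernel) (by decide +kernel)
    (by decide +kernel) (by decide +kernel)
  obtain ⟨hl, hs⟩ := longPosRoots_shortPosRoots_of_cartanMatrix b he (d := f4Diag) (k := 2)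
    (q := (P.posRootForm ℤ).rootLength (e.symm 3)) (by norm_num) hL
    (by
      have h1 := rootLength_simple_swap b he 0 1
      have h2 := rootLength_simple_swap b he 1 2
      have h3 := rootLength_simple_swap b he 2 3
      simp [CartanMatrix.F₄] at h1 h2 h3
      intro j
      fin_cases j <;> simp [f4Diag] <;> linarith)
    (by decide +kernel) (by decide +kernel) (by decide +kernel)
  rw [hl, hs, hL, ncard_stableFamily_image _ (intComb_injective (linearIndependent_simple b e)),
    ncard_stableFamily_image _ (intComb_injective (linearIndependent_simple b e))]
  exact ⟨ncard_stableFamily_f4_long, ncard_stableFamily_f4_short⟩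

theorem ncard_stableFamily_typeG2 (h : HasCartanMatrix b CartanMatrix.G₂) :
    (stableFamily (posRoots b) (posRoots b) (longPosRoots b)).ncard = 3 := by
  obtain ⟨e, he⟩ := h
  have hL := posRoots_eq_image b he (L := g2Roots) (by decide +kernel) (by decide +kernel)
    (by decide +kernel) (by decide +kernel)
  obtain ⟨hl, -⟩ := longPosRoots_shortPosRoots_of_cartanMatrix b he (d := g2Diag) (k := 3)
    (q := (P.posRootForm ℤ).rootLength (e.symm 1)) (by norm_num) hL
    (by
      have h1 := rootLength_simple_swap b he 0 1
      simp [CartanMatrix.G₂] at h1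
      intro j
      fin_cases j <;> simp [g2Diag] <;> linarith)
    (by decide +kernel) (by decide +kernel) (by decide +kernel)
  rw [hl, hL, ncard_stableFamily_image _ (intComb_injective (linearIndependent_simple b e))]
  exact ncard_stableFamily_g2_long

end Exceptional

end LongAbelian

namespace LongAbelian

/-! ### Simultaneous eigenspaces and stable subspaces. -/

section SimultaneousWeights

variable {I κ K W : Type*} [Field K] [AddCommGroup W] [Module K W]

/-- The simultaneous eigenspace of a family of endomorphisms. -/
def simWeight (T : I → Module.End K W) (χ : I → K) : Submodule K W where
  carrier := {w | ∀ i, T i w = χ i • w}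
  add_mem' := by
    intro a b ha hb i
    rw [map_add, ha i, hb i, smul_add]
  zero_mem' := by
    intro i
    simp
  smul_mem' := by
    intro c x hx i
    rw [map_smul, hx i, smul_comm]

/-- The components of an element of a stable subspace with respect to simultaneous eigenspaces lie
in that subspace. -/
theorem component_mem_of_sum_mem {T : I → Module.End K W} {χ : κ → I → K}
    (hχ : Function.Injective χ) {U : Submodule K W} (hU : ∀ i, ∀ u ∈ U, T i u ∈ U) (F : Finset κ) :
    ∀ w : κ → W, (∀ k ∈ F, w k ∈ simWeight T (χ k)) → ∑ k ∈ F, w k ∈ U → ∀ k ∈ F, w k ∈ U := by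
  classical
  induction F using Finset.induction_on with
  | empty => simp
  | insert a F ha ih =>
    intro w hw hsum
    have hF : ∀ k ∈ F, w k ∈ U := by
      intro k hk
      have hne : χ k ≠ χ a := fun h ↦ ha (hχ h ▸ hk)
      obtain ⟨i, hi⟩ := Function.ne_iff.1 hne
      -- Applying `T i - χ a i` kills the component at `a` and multiplies the one at `k` by a
      -- nonzero scalar, leaving a shorter sum in `U`.
      have h1 := ih (fun k ↦ (χ k i - χ a i) • w k)
        (fun k hk ↦ Submodule.smul_mem _ _ (hw k (Finset.mem_insert_of_mem hk))) (by
          have h2 : T i (∑ k ∈ insert a F, w k) - χ a i • ∑ k ∈ insert a F, w k ∈ U :=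
            U.sub_mem (hU i _ hsum) (U.smul_mem _ hsum)
          convert h2 using 1
          rw [map_sum, Finset.smul_sum, ← Finset.sum_sub_distrib, Finset.sum_insert ha,
            hw a (Finset.mem_insert_self a F) i, sub_self, zero_add]
          refine Finset.sum_congr rfl fun k hk ↦ ?_
          rw [hw k (Finset.mem_insert_of_mem hk) i, sub_smul]) k hk
      have h3 := U.smul_mem (χ k i - χ a i)⁻¹ h1
      rwa [smul_smul, inv_mul_cancel₀ (sub_ne_zero.2 hi), one_smul] at h3
    intro k hk
    rcases Finset.mem_insert.1 hk with rfl | hk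
    · rw [Finset.sum_insert ha] at hsum
      have := U.sub_mem hsum (U.sum_mem hF)
      rwa [add_sub_cancel_right] at this
    · exact hF k hk

theorem iSupIndep_simWeight {T : I → Module.End K W} {χ : κ → I → K}
    (hχ : Function.Injective χ) : iSupIndep fun k ↦ simWeight T (χ k) := by
  rw [iSupIndep_iff_finsetSum_eq_zero_imp_eq_zero]
  intro F w hw hsum k hk
  have := component_mem_of_sum_mem (U := ⊥) hχ (by simp) F w hw (by simpa using hsum) k hk
  simpa using this

theorem exists_sum_of_mem_iSup {p : κ → Submodule K W} {x : W} (hx : x ∈ ⨆ k, p k) :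
    ∃ (F : Finset κ) (w : κ → W), (∀ k, w k ∈ p k) ∧ ∑ k ∈ F, w k = x := by
  obtain ⟨f, hf, h⟩ := (Submodule.mem_iSup_iff_exists_finsupp p x).1 hx
  exact ⟨f.support, f, hf, h⟩

theorem le_iSup_inf_simWeight {T : I → Module.End K W} {χ : κ → I → K}
    (hχ : Function.Injective χ) {U : Submodule K W} (hU : ∀ i, ∀ u ∈ U, T i u ∈ U)
    (hle : U ≤ ⨆ k, simWeight T (χ k)) : U ≤ ⨆ k, U ⊓ simWeight T (χ k) := by
  intro x hx
  obtain ⟨F, w, hw, rfl⟩ := exists_sum_of_mem_iSup (hle hx)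
  have := component_mem_of_sum_mem hχ hU F w (fun k _ ↦ hw k) hx
  exact Submodule.sum_mem _ fun k hk ↦ Submodule.mem_iSup_of_mem k ⟨this k hk, hw k⟩

end SimultaneousWeights

/-! ### Weights of the natural representation of a classical Lie algebra. -/

section Classical

open LieAlgebra LieAlgebra.IsKilling

variable {K L W : Type*} [Field K] [CharZero K] [IsAlgClosed K] [LieRing L] [LieAlgebra K L]
  [FiniteDimensional K L] [AddCommGroup W] [Module K W] [FiniteDimensional K W]

/-- A faithful representation of a Lie algebra on a space with a nondegenerate `s`-symmetric
form, by which the Lie algebra becomes the algebra of all skew-adjoint endomorphisms. -/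
structure ClassicalAction (ρ : L →ₗ[K] Module.End K W) (B : W →ₗ[K] W →ₗ[K] K) (s : K) : Prop where
  map_lie : ∀ x y w, ρ ⁅x, y⁆ w = ρ x (ρ y w) - ρ y (ρ x w)
  faithful : ∀ x, ρ x = 0 → x = 0
  symm : ∀ u v, B u v = s * B v u
  nondegenerate : ∀ u, (∀ v, B u v = 0) → u = 0
  skew : ∀ x u v, B (ρ x u) v + B u (ρ x v) = 0
  surj : ∀ u v, ∃ x, ∀ w, ρ x w = B u w • v - (s * B v w) • u

variable {ρ : L →ₗ[K] Module.End K W} {B : W →ₗ[K] W →ₗ[K] K} {s : K}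

theorem ClassicalAction.exists_apply_ne_zero (h : ClassicalAction ρ B s) {u : W} (hu : u ≠ 0) :
    ∃ v, B u v ≠ 0 := by
  by_contra! hv
  exact hu (h.nondegenerate u hv)

theorem ClassicalAction.apply_ne_zero_comm (h : ClassicalAction ρ B s) {u v : W}
    (huv : B u v ≠ 0) : B v u ≠ 0 := fun h0 ↦ huv (by rw [h.symm, h0, mul_zero])

/-- Irreducibility of `W`, obtained from the operators in `surj`. If `U` is proper, two elements of
`U` with nonzero pairing would move any vector into `U`, so `U` is isotropic. On the other hand, `U`
contains everything orthogonal to `u`, and isotropy then places `U` inside the line of `u`. So a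
subspace of codimension at most one would be contained in a line, which dimension at least three
forbids. -/
theorem ClassicalAction.eq_top_of_stable (h : ClassicalAction ρ B s)
    (h3 : 3 ≤ Module.finrank K W) {U : Submodule K W}
    (hU : ∀ x, ∀ u ∈ U, ρ x u ∈ U) {u : W} (hu : u ∈ U) (hu0 : u ≠ 0) : U = ⊤ := by
  by_contra hne
  obtain ⟨a, ha⟩ : ∃ a, a ∉ U := by
    by_contra! hall
    exact hne ((Submodule.eq_top_iff').2 hall)
  have hiso : ∀ w ∈ U, ∀ z ∈ U, B w z = 0 := by
    intro w hw z hz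
    by_contra h0
    obtain ⟨x, hx⟩ := h.surj w a
    have h1 := U.add_mem (hU x z hz) (U.smul_mem (s * B a z) hw)
    rw [hx, sub_add_cancel] at h1
    exact ha ((U.smul_mem_iff h0).1 h1)
  obtain ⟨w, hw⟩ := h.exists_apply_ne_zero hu0
  replace hw : B w u ≠ 0 := h.apply_ne_zero_comm hw
  have hperp : ∀ v, B v u = 0 → v ∈ U := by
    intro v hv
    obtain ⟨x, hx⟩ := h.surj w v
    have h1 := hU x u hu
    rw [hx, hv, mul_zero, zero_smul, sub_zero] at h1
    exact (U.smul_mem_iff hw).1 h1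
  have hspan : U ≤ K ∙ u := by
    intro z hz
    have hz0 : z - (B w z / B w u) • u = 0 := by
      apply h.nondegenerate
      intro v
      rw [h.symm]
      have hy : v - (B v u / B w u) • w ∈ U := hperp _ (by
        simp [hw])
      have h1 := hiso _ hy _ (U.sub_mem hz (U.smul_mem (B w z / B w u) hu))
      have h2 : B w (z - (B w z / B w u) • u) = 0 := by simp [hw]
      rw [map_sub B, map_smul B, LinearMap.sub_apply, LinearMap.smul_apply, h2, smul_zero,
        sub_zero] at h1
      rw [h1, mul_zero]
    rw [sub_eq_zero.1 hz0]
    exact Submodule.smul_mem _ _ (Submodule.mem_span_singleton_self u)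
  have hker : LinearMap.ker (B.flip u) ≤ K ∙ u := fun v hv ↦ hspan (hperp v (by simpa using hv))
  have h1 := Submodule.finrank_mono hker
  rw [finrank_span_singleton hu0] at h1
  have h2 := LinearMap.finrank_range_add_finrank_ker (B.flip u)
  have h4 := Submodule.finrank_le (LinearMap.range (B.flip u))
  rw [Module.finrank_self] at h4
  omega

variable [IsKilling K L] {H : LieSubalgebra K L} [H.IsCartanSubalgebra]

/-- The weight spaces of a Cartan subalgebra in a representation. -/
def wtSpace (ρ : L →ₗ[K] Module.End K W) (H : LieSubalgebra K L) (χ : Module.Dual K H) :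
    Submodule K W :=
  simWeight (fun h : H ↦ ρ h) χ

theorem ClassicalAction.apply_mem_wtSpace (h : ClassicalAction ρ B s) {α χ : Module.Dual K H}
    {x : L} {w : W} (hx : x ∈ rootSpace H α) (hw : w ∈ wtSpace ρ H χ) :
    ρ x w ∈ wtSpace ρ H (α + χ) := by
  intro t
  have h1 := h.map_lie t x w
  have h2 := lie_eq_smul_of_mem_rootSpace hx t
  rw [LieSubalgebra.coe_bracket_of_module] at h2
  rw [h2, map_smul, LinearMap.smul_apply, hw t, map_smul] at h1
  rw [LinearMap.add_apply, add_smul, h1, sub_add_cancel]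

theorem apply_mem_of_rootSpace {U : Submodule K W}
    (hU : ∀ (α : Module.Dual K H), ∀ x ∈ rootSpace H α, ∀ u ∈ U, ρ x u ∈ U) (x : L) :
    ∀ u ∈ U, ρ x u ∈ U := by
  have hx : x ∈ (⨆ α : LieModule.Weight K H L, rootSpace H α : LieSubmodule K H L) := by
    rw [LieModule.iSup_genWeightSpace_eq_top']
    trivial
  rw [← LieSubmodule.mem_toSubmodule, LieSubmodule.iSup_toSubmodule] at hx
  induction hx using Submodule.iSup_induction' with
  | mem α x hx => exact hU α.toLinear x hx
  | zero => simp
  | add x y _ _ h1 h2 =>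
    intro u hu
    rw [map_add]
    exact U.add_mem (h1 u hu) (h2 u hu)

/-- Lie's theorem for the solvable algebra `H`, with `W` regarded as an `H`-module. -/
theorem ClassicalAction.exists_mem_wtSpace (h : ClassicalAction ρ B s) [Nontrivial W]
    (H : LieSubalgebra K L) [H.IsCartanSubalgebra] :
    ∃ (χ : Module.Dual K H) (w : W), w ≠ 0 ∧ w ∈ wtSpace ρ H χ := by
  let _ : LieRingModule H W :=
    { bracket := fun t w ↦ ρ t w
      add_lie := by intro x y w; simp
      lie_add := by intro x y w; simp
      leibniz_lie := by
        intro x y w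
        change ρ x (ρ y w) = ρ ⁅(x : L), (y : L)⁆ w + ρ y (ρ x w)
        rw [h.map_lie, sub_add_cancel] }
  let _ : LieModule K H W :=
    { smul_lie := by
        intro c x w
        change ρ (c • (x : L)) w = c • ρ x w
        simp
      lie_smul := by
        intro c x w
        change ρ x (c • w) = c • ρ x w
        simp }
  obtain ⟨χ, hχ⟩ := LieModule.exists_nontrivial_weightSpace_of_isSolvable K H W
  obtain ⟨w, hw⟩ := exists_ne (0 : LieModule.weightSpace W χ)
  refine ⟨χ, w, by simpa using hw, fun t ↦ ?_⟩
  exact (LieModule.mem_weightSpace _ _).1 w.2 t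

/-- Root vectors permute weight spaces, so their sum is stable; it is nonzero by Lie's theorem and
everything by irreducibility. -/
theorem ClassicalAction.iSup_wtSpace (h : ClassicalAction ρ B s)
    (h3 : 3 ≤ Module.finrank K W) (H : LieSubalgebra K L) [H.IsCartanSubalgebra] :
    ⨆ χ : Module.Dual K H, wtSpace ρ H χ = ⊤ := by
  have : Nontrivial W := Module.nontrivial_of_finrank_pos (R := K) (by omega)
  obtain ⟨χ, w, hw0, hw⟩ := h.exists_mem_wtSpace H
  refine h.eq_top_of_stable h3 (apply_mem_of_rootSpace (H := H) fun α x hx u hu ↦ ?_)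
    (Submodule.mem_iSup_of_mem χ hw) hw0
  induction hu using Submodule.iSup_induction' with
  | mem ψ u hu => exact Submodule.mem_iSup_of_mem _ (h.apply_mem_wtSpace hx hu)
  | zero => simp
  | add x y _ _ h1 h2 =>
    rw [map_add]
    exact Submodule.add_mem _ h1 h2

theorem ClassicalAction.form_eq_zero (h : ClassicalAction ρ B s) {χ ψ : Module.Dual K H}
    (hne : χ + ψ ≠ 0) {u v : W} (hu : u ∈ wtSpace ρ H χ) (hv : v ∈ wtSpace ρ H ψ) :
    B u v = 0 := by
  obtain ⟨t, ht⟩ := DFunLike.ne_iff.1 hne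
  have h1 := h.skew t u v
  rw [hu t, hv t, map_smul, map_smul, LinearMap.smul_apply, ← add_smul] at h1
  exact (smul_eq_zero.1 h1).resolve_left ht

theorem ClassicalAction.exists_dual (h : ClassicalAction ρ B s)
    (h3 : 3 ≤ Module.finrank K W) {χ : Module.Dual K H} {u : W} (hu : u ∈ wtSpace ρ H χ)
    (hu0 : u ≠ 0) : ∃ v ∈ wtSpace ρ H (-χ), B u v ≠ 0 := by
  by_contra! hcon
  refine hu0 (h.nondegenerate u fun v ↦ ?_)
  have hv : v ∈ ⨆ χ : Module.Dual K H, wtSpace ρ H χ := by rw [h.iSup_wtSpace h3]; trivial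
  induction hv using Submodule.iSup_induction' with
  | mem ψ v hv =>
    by_cases hψ : χ + ψ = 0
    · exact hcon v ((eq_neg_of_add_eq_zero_right hψ) ▸ hv)
    · exact h.form_eq_zero hψ hu hv
  | zero => simp
  | add x y _ _ h1 h2 => rw [map_add, h1, h2, add_zero]

/-- The element of the Lie algebra given by two weight vectors is a weight vector. -/
theorem ClassicalAction.mem_rootSpace (h : ClassicalAction ρ B s) {χ ψ : Module.Dual K H}
    {u v : W} (hu : u ∈ wtSpace ρ H χ) (hv : v ∈ wtSpace ρ H ψ) {x : L}
    (hx : ∀ w, ρ x w = B u w • v - (s * B v w) • u) : x ∈ rootSpace H (χ + ψ : Module.Dual K H) := by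
  have hw : x ∈ LieModule.weightSpace L (χ + ψ : Module.Dual K H) := by
    rw [LieModule.mem_weightSpace]
    intro t
    rw [← sub_eq_zero]
    apply h.faithful
    ext w
    have h1 := h.skew t u w
    have h2 := h.skew t v w
    rw [hu t, map_smul, LinearMap.smul_apply] at h1
    rw [hv t, map_smul, LinearMap.smul_apply] at h2
    rw [LieSubalgebra.coe_bracket_of_module, map_sub, map_smul, LinearMap.sub_apply,
      LinearMap.smul_apply, h.map_lie, hx, hx, map_sub, map_smul, map_smul, hu t, hv t,
      LinearMap.zero_apply, eq_neg_of_add_eq_zero_right h1, eq_neg_of_add_eq_zero_right h2]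
    simp only [LinearMap.add_apply, smul_eq_mul]
    module
  exact LieModule.weightSpace_le_genWeightSpace _ _ hw

/-- With `v` of weight `-χ` pairing nontrivially with `u'`, the operator of `surj` for `u` and `v`
has weight zero, so it belongs to `H` and acts on `u'` by a scalar. For `χ ≠ 0` the vectors `u` and
`u'` are orthogonal and the resulting equation expresses `u` through `u'`. For `χ = 0` the scalar
vanishes and both vectors are multiples of `v`. -/
theorem ClassicalAction.finrank_le_one (h : ClassicalAction ρ B s)
    (h3 : 3 ≤ Module.finrank K W) (hs : s = 1 ∨ s = -1) {χ : Module.Dual K H}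
    {u u' : W} (hu : u ∈ wtSpace ρ H χ) (hu' : u' ∈ wtSpace ρ H χ) (hu0 : u' ≠ 0) :
    ∃ c : K, u = c • u' := by
  obtain ⟨v, hv, huv⟩ := h.exists_dual h3 hu' hu0
  replace huv := h.apply_ne_zero_comm huv
  have hs0 : s ≠ 0 := by rcases hs with rfl | rfl <;> simp
  have hne : s * B v u' ≠ 0 := mul_ne_zero hs0 huv
  have key : ∀ u ∈ wtSpace ρ H χ, ∃ t : H, B u u' • v - (s * B v u') • u = χ t • u' := by
    intro u hu
    obtain ⟨x, hx⟩ := h.surj u v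
    have hxH := h.mem_rootSpace hu hv hx
    rw [add_neg_cancel] at hxH
    change x ∈ rootSpace H (0 : H → K) at hxH
    rw [rootSpace_zero_eq] at hxH
    have hxH' : x ∈ H := hxH
    exact ⟨⟨x, hxH'⟩, (hx u').symm.trans (hu' ⟨x, hxH'⟩)⟩
  by_cases hχ : χ = 0
  · subst hχ
    have key' : ∀ u ∈ wtSpace ρ H 0, u = ((s * B v u')⁻¹ * B u u') • v := by
      intro u hu
      obtain ⟨t, ht⟩ := key u hu
      rw [LinearMap.zero_apply, zero_smul, sub_eq_zero] at ht
      rw [mul_smul, ht, smul_smul, inv_mul_cancel₀ hne, one_smul]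
    have h1 := key' u hu
    have h2 := key' u' hu'
    set d := (s * B v u')⁻¹ * B u' u'
    have hd : d ≠ 0 := fun h0 ↦ hu0 (by rw [h2, h0, zero_smul])
    refine ⟨((s * B v u')⁻¹ * B u u') * d⁻¹, ?_⟩
    have h3 : v = d⁻¹ • u' := by rw [eq_inv_smul_iff₀ hd]; exact h2.symm
    rw [mul_smul, ← h3]
    exact h1
  · obtain ⟨t, ht⟩ := key u hu
    have hB : B u u' = 0 := by
      refine h.form_eq_zero (fun h0 ↦ hχ ?_) hu hu'
      rwa [← two_smul K, smul_eq_zero_iff_right two_ne_zero] at h0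
    rw [hB, zero_smul, zero_sub] at ht
    refine ⟨-(s * B v u')⁻¹ * χ t, ?_⟩
    rw [mul_smul, ← ht, smul_neg, neg_smul, neg_neg, smul_smul, inv_mul_cancel₀ hne, one_smul]

end Classical

end LongAbelian

namespace LongAbelian

/-- A finite set without zero that is closed under negation consists of the elements of a finite
family and their negatives. -/
theorem exists_signed_family {G : Type*} [AddCommGroup G] [IsAddTorsionFree G] (S : Finset G) :
    (0 : G) ∉ S → (∀ x ∈ S, -x ∈ S) → ∃ (q : ℕ) (ε : Fin q → G), S.card = 2 * q ∧
      (∀ x, x ∈ S ↔ ∃ i, ∃ s : ℤˣ, x = (s : ℤ) • ε i) ∧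
      ∀ i j, ∀ s : ℤˣ, ε i = (s : ℤ) • ε j → i = j := by
  classical
  induction hn : S.card using Nat.strong_induction_on generalizing S with
  | _ n ih =>
    intro h0 hneg
    subst hn
    rcases S.eq_empty_or_nonempty with rfl | ⟨a, ha⟩
    · exact ⟨0, Fin.elim0, by simp, by simp, fun i ↦ i.elim0⟩
    have ha0 : a ≠ 0 := fun h ↦ h0 (h ▸ ha)
    have hane : a ≠ -a := fun h ↦ ha0 (self_eq_neg.1 h)
    have hcard : ((S.erase a).erase (-a)).card + 2 = S.card := by
      have h1 := Finset.card_erase_add_one ha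
      have h2 := Finset.card_erase_add_one (Finset.mem_erase.2 ⟨hane.symm, hneg a ha⟩)
      omega
    obtain ⟨q, ε, hq, hmem, hinj⟩ := ih _ (by omega) ((S.erase a).erase (-a)) rfl (by simp [h0])
      (by
        intro x hx
        simp only [Finset.mem_erase] at hx ⊢
        exact ⟨fun h ↦ hx.2.1 (neg_inj.1 h), fun h ↦ hx.1 (by rw [← h, neg_neg]), hneg x hx.2.2⟩)
    have hεa : ∀ i, ∀ s : ℤˣ, ε i ≠ (s : ℤ) • a := by
      intro i s h
      have h1 : ε i ∈ (S.erase a).erase (-a) := (hmem _).2 ⟨i, 1, by simp⟩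
      rw [h] at h1
      rcases Int.units_eq_one_or s with rfl | rfl <;> simp at h1
    refine ⟨q + 1, Fin.cons a ε, by omega, fun x ↦ ?_, ?_⟩
    · constructor
      · intro hx
        by_cases h1 : x = a
        · exact ⟨0, 1, by simp [h1]⟩
        by_cases h2 : x = -a
        · exact ⟨0, -1, by simp [h2]⟩
        obtain ⟨i, s, hs⟩ := (hmem x).1 (by simp [h1, h2, hx])
        exact ⟨i.succ, s, by simpa using hs⟩
      · rintro ⟨i, s, rfl⟩
        cases i using Fin.cases with
        | zero =>
          rcases Int.units_eq_one_or s with rfl | rfl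
          · simpa using ha
          · simpa using hneg a ha
        | succ i =>
          have h1 := (hmem _).2 ⟨i, s, rfl⟩
          simp only [Finset.mem_erase] at h1
          simpa using h1.2.2
    · intro i j s h
      cases i using Fin.cases with
      | zero =>
        cases j using Fin.cases with
        | zero => rfl
        | succ j =>
          simp only [Fin.cons_zero, Fin.cons_succ] at h
          exfalso
          refine hεa j s ?_
          rcases Int.units_eq_one_or s with rfl | rfl <;> simp [h]
      | succ i =>
        cases j using Fin.cases with
        | zero =>
          simp only [Fin.cons_zero, Fin.cons_succ] at h
          exact absurd h (hεa i s)
        | succ j =>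
          simp only [Fin.cons_succ] at h
          rw [hinj i j s h]

/-! ### Roots as sums of weights of the natural representation. -/

section Classical

open LieAlgebra LieAlgebra.IsKilling

variable {K L W : Type*} [Field K] [CharZero K] [IsAlgClosed K] [LieRing L] [LieAlgebra K L]
  [FiniteDimensional K L] [AddCommGroup W] [Module K W] [FiniteDimensional K W]
  {ρ : L →ₗ[K] Module.End K W} {B : W →ₗ[K] W →ₗ[K] K} {s : K}
  [IsKilling K L] {H : LieSubalgebra K L} [H.IsCartanSubalgebra]

/-- Weight spaces are lines spanning `W`, so one vector from each gives a basis. -/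
theorem ClassicalAction.exists_weights (h : ClassicalAction ρ B s)
    (h3 : 3 ≤ Module.finrank K W) (hs : s = 1 ∨ s = -1) (H : LieSubalgebra K L)
    [H.IsCartanSubalgebra] :
    ∃ S : Finset (Module.Dual K H), S.card = Module.finrank K W ∧
      ∀ χ, χ ∈ S ↔ wtSpace ρ H χ ≠ ⊥ := by
  classical
  let X := {χ : Module.Dual K H // wtSpace ρ H χ ≠ ⊥}
  have hX : ∀ χ : X, ∃ w ∈ wtSpace ρ H χ.1, w ≠ 0 := fun χ ↦ Submodule.exists_mem_ne_zero_of_ne_bot χ.2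
  choose u hu hu0 using hX
  have hind : iSupIndep fun χ : X ↦ wtSpace ρ H χ.1 :=
    (iSupIndep_simWeight (T := fun t : H ↦ ρ t) (χ := fun (χ : X) (t : H) ↦ χ.1 t)
      (fun χ ψ hχ ↦ Subtype.ext (DFunLike.coe_injective hχ)))
  have hli : LinearIndependent K u := hind.linearIndependent _ hu hu0
  have hsp : ⊤ ≤ Submodule.span K (Set.range u) := by
    rw [← h.iSup_wtSpace h3 H]
    refine iSup_le fun χ w hw ↦ ?_
    by_cases hw0 : w = 0
    · rw [hw0]
      exact Submodule.zero_mem _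
    have hχ : wtSpace ρ H χ ≠ ⊥ := fun hb ↦ hw0 (by rw [hb] at hw; simpa using hw)
    obtain ⟨c, rfl⟩ := h.finrank_le_one h3 hs hw (hu ⟨χ, hχ⟩) (hu0 ⟨χ, hχ⟩)
    exact Submodule.smul_mem _ _ (Submodule.subset_span ⟨_, rfl⟩)
  let bas := Module.Basis.mk hli hsp
  have : Finite X := Module.Finite.finite_basis bas
  have hfin : {χ : Module.Dual K H | wtSpace ρ H χ ≠ ⊥}.Finite := Set.finite_coe_iff.1 this
  refine ⟨hfin.toFinset, ?_, fun χ ↦ by simp⟩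
  rw [Module.finrank_eq_nat_card_basis bas, ← Set.ncard_eq_toFinset_card _ hfin]
  rfl

theorem ClassicalAction.neg_weight (h : ClassicalAction ρ B s)
    (h3 : 3 ≤ Module.finrank K W) {χ : Module.Dual K H} (hχ : wtSpace ρ H χ ≠ ⊥) :
    wtSpace ρ H (-χ) ≠ ⊥ := by
  obtain ⟨u, hu, hu0⟩ := Submodule.exists_mem_ne_zero_of_ne_bot hχ
  obtain ⟨v, hv, huv⟩ := h.exists_dual h3 hu hu0
  intro hb
  rw [hb, Submodule.mem_bot] at hv
  exact huv (by rw [hv, map_zero])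

/-- The zero weight space would be a line paired nontrivially with itself, which an alternating form
does not allow. -/
theorem ClassicalAction.wtSpace_zero (h : ClassicalAction ρ B (-1))
    (h3 : 3 ≤ Module.finrank K W) : wtSpace ρ H 0 = ⊥ := by
  by_contra hb
  obtain ⟨u, hu, hu0⟩ := Submodule.exists_mem_ne_zero_of_ne_bot hb
  obtain ⟨v, hv, huv⟩ := h.exists_dual h3 hu hu0
  rw [neg_zero] at hv
  obtain ⟨c, rfl⟩ := h.finrank_le_one h3 (Or.inr rfl) hv hu hu0
  have h1 := h.symm u u
  rw [map_smul, smul_eq_mul] at huv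
  exact huv (by linear_combination (c / 2) * h1)

/-- The operator built from dual vectors of weights `ε i` and `-ε i` is an element of `H` on which
`ε i` is nonzero and all other `ε j` vanish. These elements form a dual family up to scalars. -/
theorem ClassicalAction.linearIndependent_weights (h : ClassicalAction ρ B s)
    (h3 : 3 ≤ Module.finrank K W) (hs : s = 1 ∨ s = -1) {q : ℕ} {ε : Fin q → Module.Dual K H}
    (hε0 : ∀ i, ε i ≠ 0) (hε : ∀ i, wtSpace ρ H (ε i) ≠ ⊥)
    (hinj : ∀ i j, ∀ s : ℤˣ, ε i = (s : ℤ) • ε j → i = j) : LinearIndependent K ε := by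
  have hs0 : s ≠ 0 := by rcases hs with rfl | rfl <;> simp
  have key : ∀ i, ∃ x : H, ε i x ≠ 0 ∧ ∀ j, j ≠ i → ε j x = 0 := by
    intro i
    obtain ⟨u, hu, hu0⟩ := Submodule.exists_mem_ne_zero_of_ne_bot (hε i)
    obtain ⟨v, hv, huv⟩ := h.exists_dual h3 hu hu0
    replace huv := h.apply_ne_zero_comm huv
    obtain ⟨x, hx⟩ := h.surj u v
    have hxH := h.mem_rootSpace hu hv hx
    rw [add_neg_cancel] at hxH
    change x ∈ rootSpace H (0 : H → K) at hxH
    rw [rootSpace_zero_eq] at hxH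
    have hxH' : x ∈ H := hxH
    refine ⟨⟨x, hxH'⟩, fun h0 ↦ ?_, fun j hj ↦ ?_⟩
    · have h1 := hu ⟨x, hxH'⟩
      change ρ x u = ε i ⟨x, hxH'⟩ • u at h1
      have huu : B u u = 0 := h.form_eq_zero (fun h2 ↦ hε0 i (by
        rwa [← two_smul K, smul_eq_zero_iff_right two_ne_zero] at h2)) hu hu
      rw [hx, h0, huu, zero_smul, zero_smul, zero_sub, neg_eq_zero] at h1
      exact smul_ne_zero (mul_ne_zero hs0 huv) hu0 h1
    · obtain ⟨w, hw, hw0⟩ := Submodule.exists_mem_ne_zero_of_ne_bot (hε j)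
      have h1 := hw ⟨x, hxH'⟩
      change ρ x w = ε j ⟨x, hxH'⟩ • w at h1
      have e1 : B u w = 0 := h.form_eq_zero (fun h2 ↦ hj (hinj j i (-1) (by
        simpa using eq_neg_of_add_eq_zero_right h2))) hu hw
      have e2 : B v w = 0 := h.form_eq_zero (fun h2 ↦ hj (hinj j i 1 (by
        simpa using eq_neg_of_add_eq_zero_right h2))) hv hw
      rw [hx, e1, e2, mul_zero, zero_smul, zero_smul, sub_zero] at h1
      exact (smul_eq_zero.1 h1.symm).resolve_right hw0
  choose x hx hx' using key
  rw [linearIndependent_iff']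
  intro F c hc i hi
  have h1 := LinearMap.congr_fun hc (x i)
  rw [LinearMap.sum_apply, Finset.sum_eq_single_of_mem i hi (fun j _ hj ↦ by
    rw [LinearMap.smul_apply, hx' i j hj, smul_zero])] at h1
  exact (smul_eq_zero.1 h1).resolve_right (hx i)

theorem mem_range_root_iff {α : Module.Dual K H} :
    α ∈ Set.range (rootSystem H).root ↔ α ≠ 0 ∧ ∃ x ∈ rootSpace H α, x ≠ 0 := by
  constructor
  · rintro ⟨i, rfl⟩
    refine ⟨(rootSystem H).ne_zero i, ?_⟩
    obtain ⟨x, hx, hx0⟩ := i.1.exists_ne_zero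
    exact ⟨x, hx, hx0⟩
  · rintro ⟨h0, x, hx, hx0⟩
    have hne : rootSpace H α ≠ ⊥ := fun hb ↦ hx0 (by rw [hb] at hx; simpa using hx)
    let w : LieModule.Weight K H L := ⟨α, hne⟩
    have hw : w.IsNonZero := fun hz ↦ h0 (DFunLike.coe_injective hz)
    exact ⟨⟨w, by simpa using hw⟩, by ext; rfl⟩

/-- By faithfulness a root vector moves some weight vector; hence every root is a difference of two
weights. -/
theorem ClassicalAction.exists_weights_of_root (h : ClassicalAction ρ B s)
    (h3 : 3 ≤ Module.finrank K W) {α : Module.Dual K H}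
    (hα : α ∈ Set.range (rootSystem H).root) : ∃ (ψ : Module.Dual K H) (x : L) (u : W),
      x ∈ rootSpace H α ∧ u ∈ wtSpace ρ H ψ ∧ ρ x u ≠ 0 := by
  obtain ⟨-, x, hx, hx0⟩ := mem_range_root_iff.1 hα
  by_contra! hcon
  refine hx0 (h.faithful x (LinearMap.ext fun w ↦ ?_))
  have hw : w ∈ ⨆ χ : Module.Dual K H, wtSpace ρ H χ := by rw [h.iSup_wtSpace h3]; trivial
  induction hw using Submodule.iSup_induction' with
  | mem ψ v hv => exact hcon ψ x v hx hv
  | zero => simp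
  | add x y _ _ h1 h2 => rw [map_add, h1, h2]; simp

/-- The operator of `surj` for vectors of weights `χ` and `ψ` has weight `χ + ψ`; only its
nonvanishing is at issue. For `χ = ψ` it can be taken with equal vectors, where its two terms
reinforce each other if the form is alternating and cancel if it is symmetric. This is why `2 ε i`
is a root for `sp` and not for `so`. -/
theorem ClassicalAction.add_mem_range_root (h : ClassicalAction ρ B s)
    (h3 : 3 ≤ Module.finrank K W) {χ ψ : Module.Dual K H} (hχ : wtSpace ρ H χ ≠ ⊥)
    (hψ : wtSpace ρ H ψ ≠ ⊥) (h0 : χ + ψ ≠ 0) (hne : χ ≠ ψ ∨ s = -1) :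
    χ + ψ ∈ Set.range (rootSystem H).root := by
  obtain ⟨u, hu, hu0⟩ := Submodule.exists_mem_ne_zero_of_ne_bot hχ
  obtain ⟨w, hw, huw⟩ := h.exists_dual h3 hu hu0
  by_cases hc : χ = ψ
  · subst hc
    obtain rfl := hne.resolve_left (by simp)
    obtain ⟨x, hx⟩ := h.surj u u
    refine mem_range_root_iff.2 ⟨h0, x, h.mem_rootSpace hu hu hx, ?_⟩
    rintro rfl
    have h1 := hx w
    rw [map_zero, LinearMap.zero_apply, ← sub_smul] at h1
    have h2 := (smul_eq_zero.1 h1.symm).resolve_right hu0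
    exact huw (by linear_combination h2 / 2)
  · obtain ⟨v, hv, hv0⟩ := Submodule.exists_mem_ne_zero_of_ne_bot hψ
    obtain ⟨x, hx⟩ := h.surj u v
    refine mem_range_root_iff.2 ⟨h0, x, h.mem_rootSpace hu hv hx, ?_⟩
    rintro rfl
    have h1 := hx w
    have h2 : B v w = 0 := h.form_eq_zero (fun h2 ↦ hc (by
      rw [← sub_eq_add_neg, sub_eq_zero] at h2
      exact h2.symm)) hv hw
    rw [map_zero, LinearMap.zero_apply, h2, mul_zero, zero_smul, sub_zero] at h1
    exact smul_ne_zero huw hv0 h1.symm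

theorem add_ne_zero_of_signed {q : ℕ} {G : Type*} [AddCommGroup G] {ε : Fin q → G}
    (hinj : ∀ i j, ∀ s : ℤˣ, ε i = (s : ℤ) • ε j → i = j) {i j : Fin q} (hij : i ≠ j) (s t : ℤˣ) :
    (s : ℤ) • ε i + (t : ℤ) • ε j ≠ 0 ∧ (s : ℤ) • ε i ≠ (t : ℤ) • ε j := by
  constructor <;> intro h <;> apply hij
  · apply hinj i j (-s * t)
    have h1 := eq_neg_of_add_eq_zero_left h
    rcases Int.units_eq_one_or s with rfl | rfl <;> simpa using h1
  · apply hinj i j (s * t)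
    rcases Int.units_eq_one_or s with rfl | rfl <;> simpa [neg_eq_iff_eq_neg] using h

/-- Zero is not a weight, so the `2 p` weights form `p` pairs of opposite ones. Roots are
differences of weights, and all nonzero sums of two weights occur. -/
theorem ClassicalAction.exists_bcRoots_skew (h : ClassicalAction ρ B (-1)) {p : ℕ}
    (hp : 2 ≤ p) (hW : Module.finrank K W = 2 * p) (H : LieSubalgebra K L)
    [H.IsCartanSubalgebra] :
    ∃ ε : Fin p → Module.Dual K H, LinearIndependent K ε ∧
      Set.range (rootSystem H).root = bcRoots 2 ε := by
  have h3 : 3 ≤ Module.finrank K W := by omega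
  have : IsAddTorsionFree (Module.Dual K H) := .of_isTorsionFree K _
  obtain ⟨S, hS, hmem⟩ := h.exists_weights h3 (Or.inr rfl) H
  have hS0 : (0 : Module.Dual K H) ∉ S := by
    rw [hmem, h.wtSpace_zero h3]
    simp
  obtain ⟨q, ε, hq, hε, hinj⟩ := exists_signed_family S hS0 (fun χ hχ ↦ by
    rw [hmem] at hχ ⊢
    exact h.neg_weight h3 hχ)
  obtain rfl : q = p := by omega
  have hwt : ∀ i, ∀ s : ℤˣ, (s : ℤ) • ε i ∈ S := fun i s ↦ (hε _).2 ⟨i, s, rfl⟩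
  have hmem0 : ∀ i, ε i ∈ S := fun i ↦ by simpa using hwt i 1
  have hε0 : ∀ i, ε i ≠ 0 := fun i h0 ↦ hS0 (h0 ▸ hmem0 i)
  refine ⟨ε, h.linearIndependent_weights h3 (Or.inr rfl) hε0 (fun i ↦ (hmem _).1 (hmem0 i)) hinj, ?_⟩
  ext α
  constructor
  · intro hα
    have hα0 := (mem_range_root_iff.1 hα).1
    obtain ⟨ψ, x, u, hx, hu, hxu⟩ := h.exists_weights_of_root h3 hα
    have hu0 : u ≠ 0 := by rintro rfl; simp at hxu
    have hxu' := h.apply_mem_wtSpace hx hu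
    obtain ⟨i, s, hi⟩ := (hε _).1 ((hmem _).2 (Submodule.ne_bot_iff _ |>.2 ⟨_, hu, hu0⟩))
    obtain ⟨j, t, hj⟩ := (hε _).1 ((hmem _).2 (Submodule.ne_bot_iff _ |>.2 ⟨_, hxu', hxu⟩))
    have hα' : α = (t : ℤ) • ε j - (s : ℤ) • ε i := by rw [← hj, ← hi, add_sub_cancel_right]
    by_cases hij : j = i
    · subst hij
      refine Or.inl ⟨j, t, ?_⟩
      rcases Int.units_eq_one_or s with rfl | rfl <;> rcases Int.units_eq_one_or t with rfl | rfl
      · exact absurd (by simpa using hα') hα0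
      · rw [hα']; simp [two_smul]; abel
      · rw [hα']; simp [two_smul]
      · exact absurd (by simpa using hα') hα0
    · refine Or.inr ⟨j, i, hij, t, -s, ?_⟩
      rw [hα']
      simp [sub_eq_add_neg]
  · rintro (⟨i, s, rfl⟩ | ⟨i, j, hij, s, t, rfl⟩)
    · have h2 : (s : ℤ) • (2 : ℤ) • ε i = (s : ℤ) • ε i + (s : ℤ) • ε i := by
        rw [two_smul, smul_add]
      have h0 : (s : ℤ) • ε i ≠ 0 := fun h0 ↦ hS0 (h0 ▸ hwt i s)
      rw [h2]
      refine h.add_mem_range_root h3 ((hmem _).1 (hwt i s)) ((hmem _).1 (hwt i s)) ?_ (Or.inr rfl)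
      rwa [← two_smul K, smul_ne_zero_iff_right two_ne_zero]
    · obtain ⟨h1, h2⟩ := add_ne_zero_of_signed hinj hij s t
      exact h.add_mem_range_root h3 ((hmem _).1 (hwt i s)) ((hmem _).1 (hwt j t)) h1 (Or.inl h2)

/-- Nonzero weights come in opposite pairs and the dimension is odd, so zero is a weight and there
are `p` pairs. The zero weight supplies the roots `± ε i`. -/
theorem ClassicalAction.exists_bcRoots_symm (h : ClassicalAction ρ B 1) {p : ℕ}
    (hp : 2 ≤ p) (hW : Module.finrank K W = 2 * p + 1) (H : LieSubalgebra K L)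
    [H.IsCartanSubalgebra] :
    ∃ ε : Fin p → Module.Dual K H, LinearIndependent K ε ∧
      Set.range (rootSystem H).root = bcRoots 1 ε := by
  classical
  have h3 : 3 ≤ Module.finrank K W := by omega
  have : IsAddTorsionFree (Module.Dual K H) := .of_isTorsionFree K _
  obtain ⟨S, hS, hmem⟩ := h.exists_weights h3 (Or.inl rfl) H
  obtain ⟨q, ε, hq, hε, hinj⟩ := exists_signed_family (S.erase 0) (by simp) (fun χ hχ ↦ by
    rw [Finset.mem_erase, hmem] at hχ ⊢
    exact ⟨neg_ne_zero.2 hχ.1, h.neg_weight h3 hχ.2⟩)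
  have hS0 : (0 : Module.Dual K H) ∈ S := by
    by_contra h0
    rw [Finset.erase_eq_of_notMem h0] at hq
    omega
  have hcard := Finset.card_erase_add_one hS0
  obtain rfl : q = p := by omega
  have hwt : ∀ i, ∀ s : ℤˣ, (s : ℤ) • ε i ≠ 0 ∧ (s : ℤ) • ε i ∈ S :=
    fun i s ↦ Finset.mem_erase.1 ((hε _).2 ⟨i, s, rfl⟩)
  have hmem0 : ∀ i, ε i ≠ 0 ∧ ε i ∈ S := fun i ↦ by simpa using hwt i 1
  refine ⟨ε, h.linearIndependent_weights h3 (Or.inl rfl) (fun i ↦ (hmem0 i).1)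
    (fun i ↦ (hmem _).1 (hmem0 i).2) hinj, ?_⟩
  have hcase : ∀ χ ∈ S, χ = 0 ∨ ∃ i, ∃ s : ℤˣ, χ = (s : ℤ) • ε i := by
    intro χ hχ
    by_cases h0 : χ = 0
    · exact Or.inl h0
    · exact Or.inr ((hε _).1 (Finset.mem_erase.2 ⟨h0, hχ⟩))
  ext α
  constructor
  · intro hα
    have hα0 := (mem_range_root_iff.1 hα).1
    obtain ⟨ψ, x, u, hx, hu, hxu⟩ := h.exists_weights_of_root h3 hα
    have hu0 : u ≠ 0 := by rintro rfl; simp at hxu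
    have hxu' := h.apply_mem_wtSpace hx hu
    have hi := hcase _ ((hmem _).2 (Submodule.ne_bot_iff _ |>.2 ⟨_, hu, hu0⟩))
    have hj := hcase _ ((hmem _).2 (Submodule.ne_bot_iff _ |>.2 ⟨_, hxu', hxu⟩))
    rcases hi with hi | ⟨i, s, hi⟩
    · rcases hj with hj | ⟨j, t, hj⟩
      · exact absurd (by simpa [hi] using hj) hα0
      · exact Or.inl ⟨j, t, by simpa [hi] using hj⟩
    rcases hj with hj | ⟨j, t, hj⟩
    · exact Or.inl ⟨i, -s, by rw [eq_neg_of_add_eq_zero_left hj, hi]; simp⟩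
    have hα' : α = (t : ℤ) • ε j - (s : ℤ) • ε i := by rw [← hj, ← hi, add_sub_cancel_right]
    by_cases hij : j = i
    · subst hij
      exfalso
      -- Here the root vector `x` carries weight `ψ` to `-ψ`. Then `ρ x u` would pair nontrivially
      -- with `u`, whereas skewness and symmetry give `B (ρ x u) u = 0`.
      have hneg : -(α + ψ) = ψ := by
        rw [hj, hi]
        by_cases hst : t = s
        · exact absurd (by rw [hα', hst, sub_self]) hα0
        · rcases Int.units_eq_one_or s with rfl | rfl <;>
            rcases Int.units_eq_one_or t with rfl | rfl <;> simp at hst ⊢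
      obtain ⟨v, hv, hv'⟩ := h.exists_dual h3 hxu' hxu
      rw [hneg] at hv
      obtain ⟨c, rfl⟩ := h.finrank_le_one h3 (Or.inl rfl) hv hu hu0
      have h1 := h.skew x u u
      rw [h.symm u, one_mul, ← two_mul] at h1
      rw [map_smul, smul_eq_mul] at hv'
      exact hv' (by rw [(mul_eq_zero.1 h1).resolve_left two_ne_zero, mul_zero])
    · refine Or.inr ⟨j, i, hij, t, -s, ?_⟩
      rw [hα']
      simp [sub_eq_add_neg]
  · rintro (⟨i, s, rfl⟩ | ⟨i, j, hij, s, t, rfl⟩)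
    · have := h.add_mem_range_root h3 ((hmem _).1 (hwt i s).2) ((hmem _).1 hS0)
        (by rw [add_zero]; exact (hwt i s).1) (Or.inl (hwt i s).1)
      simpa using this
    · obtain ⟨h1, h2⟩ := add_ne_zero_of_signed hinj hij s t
      exact h.add_mem_range_root h3 ((hmem _).1 (hwt i s).2) ((hmem _).1 (hwt j t).2) h1
        (Or.inl h2)

end Classical

end LongAbelian

namespace LongAbelian

/-! ### The matrix algebras so and sp. -/

section Realization

open LieAlgebra LieAlgebra.IsKilling Matrix

variable {K L n : Type*} [Field K] [CharZero K] [IsAlgClosed K] [LieRing L] [LieAlgebra K L]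
  [FiniteDimensional K L] [Fintype n] [DecidableEq n]

/-- The natural representation of a Lie algebra of skew-adjoint matrices. -/
def naturalRep {J : Matrix n n K} (e : L ≃ₗ⁅K⁆ skewAdjointMatricesLieSubalgebra J) :
    L →ₗ[K] Module.End K (n → K) where
  toFun x := Matrix.toLin' (e x).1
  map_add' x y := by
    rw [← map_add, map_add e]
    rfl
  map_smul' c x := by
    rw [RingHom.id_apply, ← map_smul, map_smul e]
    rfl

theorem naturalRep_apply {J : Matrix n n K} (e : L ≃ₗ⁅K⁆ skewAdjointMatricesLieSubalgebra J)
    (x : L) (w : n → K) : naturalRep e x w = (e x).1 *ᵥ w := rfl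

theorem mem_skewAdjointMatrices_iff {J A : Matrix n n K} :
    A ∈ skewAdjointMatricesLieSubalgebra J ↔ Aᵀ * J = J * (-A) := by
  rw [mem_skewAdjointMatricesLieSubalgebra, mem_skewAdjointMatricesSubmodule]
  rfl

/-- One argument for both algebras: `J = 1`, `s = 1` for `so`, and the standard alternating matrix
with `s = -1` for `sp`. The condition `Jᵀ = s • J` makes the rank-two matrices needed for `surj`
skew-adjoint. -/
theorem classicalAction_naturalRep {J : Matrix n n K} {s : K} (hJ : Jᵀ = s • J) (hs : s * s = 1)
    (hdet : IsUnit J) (e : L ≃ₗ⁅K⁆ skewAdjointMatricesLieSubalgebra J) :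
    ClassicalAction (naturalRep e) (Matrix.toLinearMap₂' K J) s where
  map_lie x y w := by
    have h1 : (e ⁅x, y⁆).1 = (e x).1 * (e y).1 - (e y).1 * (e x).1 :=
      congrArg Subtype.val (e.map_lie x y)
    rw [naturalRep_apply, h1, Matrix.sub_mulVec]
    simp only [naturalRep_apply, Matrix.mulVec_mulVec]
  faithful x hx := by
    have h1 : (e x).1 = 0 := Matrix.toLin'.injective (by rw [map_zero]; exact hx)
    have h2 : e x = 0 := Subtype.ext h1
    exact e.injective (h2.trans (map_zero e).symm)
  symm u v := by
    rw [Matrix.toLinearMap₂'_apply', Matrix.toLinearMap₂'_apply', Matrix.dotProduct_mulVec,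
      ← Matrix.mulVec_transpose, hJ, Matrix.smul_mulVec, smul_dotProduct, dotProduct_comm,
      smul_eq_mul]
  nondegenerate u hu := by
    have h1 : u ᵥ* J = 0 := by
      refine dotProduct_eq_zero _ fun v ↦ ?_
      rw [← Matrix.dotProduct_mulVec, ← Matrix.toLinearMap₂'_apply']
      exact hu v
    have h2 := congrArg (· ᵥ* J⁻¹) h1
    simp only [Matrix.vecMul_vecMul, Matrix.zero_vecMul] at h2
    rwa [Matrix.mul_nonsing_inv _ ((Matrix.isUnit_iff_isUnit_det J).1 hdet),
      Matrix.vecMul_one] at h2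
  skew x u v := by
    have h1 := mem_skewAdjointMatrices_iff.1 (e x).2
    rw [Matrix.toLinearMap₂'_apply', Matrix.toLinearMap₂'_apply', naturalRep_apply,
      naturalRep_apply, ← Matrix.vecMul_transpose, ← Matrix.dotProduct_mulVec,
      Matrix.mulVec_mulVec, h1, Matrix.mulVec_mulVec, Matrix.mul_neg, Matrix.neg_mulVec,
      dotProduct_neg, neg_add_cancel]
  surj u v := by
    have hJv : ∀ v, J *ᵥ v = s • (v ᵥ* J) := fun v ↦ by
      rw [← Matrix.mulVec_transpose, hJ, Matrix.smul_mulVec, smul_smul, hs, one_smul]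
    have hA : vecMulVec v (u ᵥ* J) - s • vecMulVec u (v ᵥ* J) ∈
        skewAdjointMatricesLieSubalgebra J := by
      rw [mem_skewAdjointMatrices_iff, Matrix.transpose_sub, Matrix.transpose_smul,
        Matrix.transpose_vecMulVec, Matrix.transpose_vecMulVec, Matrix.sub_mul, Matrix.smul_mul,
        Matrix.vecMulVec_mul, Matrix.vecMulVec_mul, Matrix.mul_neg, Matrix.mul_sub,
        Matrix.mul_smul, Matrix.mul_vecMulVec, Matrix.mul_vecMulVec, hJv, hJv,
        Matrix.smul_vecMulVec, Matrix.smul_vecMulVec, smul_smul, hs, one_smul, neg_sub]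
    refine ⟨e.symm ⟨_, hA⟩, fun w ↦ ?_⟩
    rw [naturalRep_apply, LieEquiv.apply_symm_apply, Matrix.sub_mulVec, Matrix.smul_mulVec,
      Matrix.vecMulVec_mulVec, Matrix.vecMulVec_mulVec, Matrix.toLinearMap₂'_apply',
      Matrix.toLinearMap₂'_apply', Matrix.dotProduct_mulVec, Matrix.dotProduct_mulVec, mul_smul]
    simp

variable [IsKilling K L] (H : LieSubalgebra K L) [H.IsCartanSubalgebra]

theorem exists_bcRoots_of_so {p : ℕ} (hp : 2 ≤ p)
    (e : L ≃ₗ⁅K⁆ LieAlgebra.Orthogonal.so (Fin (2 * p + 1)) K) :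
    ∃ ε : Fin p → Module.Dual K H, LinearIndependent K ε ∧
      Set.range (rootSystem H).root = bcRoots 1 ε :=
  (classicalAction_naturalRep (J := 1) (s := 1) (by simp) (by simp) isUnit_one e).exists_bcRoots_symm
    hp (by simp) H

theorem exists_bcRoots_of_sp {p : ℕ} (hp : 2 ≤ p)
    (e : L ≃ₗ⁅K⁆ LieAlgebra.Symplectic.sp (Fin p) K) :
    ∃ ε : Fin p → Module.Dual K H, LinearIndependent K ε ∧
      Set.range (rootSystem H).root = bcRoots 2 ε :=
  (classicalAction_naturalRep (J := Matrix.J (Fin p) K) (s := -1)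
    (by rw [Matrix.J_transpose, neg_one_smul]) (by simp)
    ((Matrix.isUnit_iff_isUnit_det _).2 (Matrix.isUnit_det_J _ _)) e).exists_bcRoots_skew
    hp (by simp; ring) H

end Realization

end LongAbelian

namespace LongAbelian

/-! ### From stable subspaces to sets of weights. -/

section StableSubspaces

variable {M K L : Type*} [AddCommGroup M] [Field K] [LieRing L] [LieAlgebra K L]

/-- Commutative stable sums of lines of different weights are determined by their weights, and the
sets of weights that occur are described by a combinatorial condition. -/
theorem ncard_eq_ncard_stableFamily {H : Set L} {R E : M → Submodule K L} {A T D : Set M}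
    (hDT : D ⊆ T) (hE : ∀ γ ∈ T, ∃ e, e ≠ 0 ∧ E γ = K ∙ e) (hind : iSupIndep E)
    (hH : ∀ x ∈ H, ∀ γ ∈ T, ∀ y ∈ E γ, ⁅x, y⁆ ∈ E γ)
    (hR : ∀ α ∈ A, ∀ γ ∈ T, ∀ x ∈ R α, ∀ y ∈ E γ, ⁅x, y⁆ ∈ E (γ + α))
    (hR1 : ∀ α ∈ A, ∀ γ ∈ T, γ + α ∈ T → ∃ x ∈ R α, ∃ y ∈ E γ, ⁅x, y⁆ ≠ 0)
    (hR0 : ∀ α ∈ A, ∀ γ ∈ T, γ + α ∉ T → ∀ x ∈ R α, ∀ y ∈ E γ, ⁅x, y⁆ = 0)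
    (hE1 : ∀ γ ∈ T, ∀ δ ∈ T, γ + δ ∈ A → ∃ x ∈ E γ, ∃ y ∈ E δ, ⁅x, y⁆ ≠ 0)
    (hE0 : ∀ γ ∈ T, ∀ δ ∈ T, γ + δ ∉ A → ∀ x ∈ E γ, ∀ y ∈ E δ, ⁅x, y⁆ = 0)
    {C : Set (Submodule K L)}
    (hC : ∀ U, U ∈ C ↔ (∃ S ⊆ D, U = ⨆ γ ∈ S, E γ) ∧
      (∀ x ∈ H, ∀ y ∈ U, ⁅x, y⁆ ∈ U) ∧ (∀ α ∈ A, ∀ x ∈ R α, ∀ y ∈ U, ⁅x, y⁆ ∈ U) ∧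
      ∀ x ∈ U, ∀ y ∈ U, ⁅x, y⁆ = 0) :
    C.ncard = (stableFamily A T D).ncard := by
  have hle : ∀ {S : Set M} {γ : M}, γ ∈ S → E γ ≤ ⨆ γ ∈ S, E γ := fun {S γ} h ↦
    le_biSup E h
  have hmem : ∀ {S : Set M} {γ : M} {x : L}, x ∈ E γ → x ∈ (⨆ γ ∈ S, E γ) → x ≠ 0 → γ ∈ S := by
    intro S γ x hx hx' hx0
    by_contra h
    exact hx0 ((Submodule.disjoint_def.1 (hind.disjoint_biSup h)) x hx hx')
  have hC' : C = (fun S ↦ ⨆ γ ∈ S, E γ) '' stableFamily A T D := by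
    ext U
    rw [hC]
    constructor
    · rintro ⟨⟨S, hS, rfl⟩, -, hU, hcomm⟩
      refine ⟨S, ⟨hS, fun γ hγ α hα hT ↦ ?_, fun γ hγ δ hδ hA ↦ ?_⟩, rfl⟩
      · obtain ⟨x, hx, y, hy, hxy⟩ := hR1 α hα γ (hDT (hS hγ)) hT
        exact hmem (hR α hα γ (hDT (hS hγ)) x hx y hy) (hU α hα x hx y (hle hγ hy)) hxy
      · obtain ⟨x, hx, y, hy, hxy⟩ := hE1 γ (hDT (hS hγ)) δ (hDT (hS hδ)) hA
        exact hxy (hcomm x (hle hγ hx) y (hle hδ hy))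
    · rintro ⟨S, ⟨hS, hcl, hcomm⟩, rfl⟩
      have hind : ∀ {N : Submodule K L} {x : L}, (∀ γ ∈ S, ∀ y ∈ E γ, ⁅x, y⁆ ∈ N) →
          ∀ y ∈ ⨆ γ ∈ S, E γ, ⁅x, y⁆ ∈ N := by
        intro N x h
        have : ⨆ γ ∈ S, E γ ≤ N.comap (LieAlgebra.ad K L x : L →ₗ[K] L) :=
          iSup₂_le fun γ hγ y hy ↦ h γ hγ y hy
        exact this
      refine ⟨⟨S, hS, rfl⟩, fun x hx ↦ hind fun γ hγ y hy ↦
        hle hγ (hH x hx γ (hDT (hS hγ)) y hy), fun α hα x hx ↦ hind fun γ hγ y hy ↦ ?_, ?_⟩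
      · by_cases hT : γ + α ∈ T
        · exact hle (hcl γ hγ α hα hT) (hR α hα γ (hDT (hS hγ)) x hx y hy)
        · rw [hR0 α hα γ (hDT (hS hγ)) hT x hx y hy]
          exact Submodule.zero_mem _
      · intro x hx y hy
        -- `hind` extends a statement in the second argument of the bracket only; skew-symmetry lets
        -- it be used for the first argument too.
        have key := hind (N := ⊥) (x := x) (fun δ hδ y hy ↦ by
          have := hind (N := ⊥) (x := y) (fun γ hγ x hx ↦ by
            rw [Submodule.mem_bot]
            exact hE0 δ (hDT (hS hδ)) γ (hDT (hS hγ)) (hcomm δ hδ γ hγ) y hy x hx) x hx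
          rw [Submodule.mem_bot] at this ⊢
          rw [← lie_skew, this, neg_zero]) y hy
        exact (Submodule.mem_bot K).1 key
  rw [hC']
  refine Set.InjOn.ncard_image fun S hS S' hS' h ↦ ?_
  have key : ∀ {S S' : Set M}, S ∈ stableFamily A T D → ⨆ γ ∈ S, E γ = ⨆ γ ∈ S', E γ →
      S ⊆ S' := by
    intro S S' hS h γ hγ
    obtain ⟨e, he0, he⟩ := hE γ (hDT (hS.1 hγ))
    have h1 : e ∈ E γ := he ▸ Submodule.mem_span_singleton_self e
    exact hmem h1 (h ▸ hle hγ h1) he0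
  exact (key hS h).antisymm (key hS' h.symm)

end StableSubspaces

/-! ### Root vectors, `sl₂`-triples and brackets of root spaces. -/

section RootSpaces

open LieAlgebra LieAlgebra.IsKilling

variable {K L : Type*} [Field K] [CharZero K] [IsAlgClosed K] [LieRing L] [LieAlgebra K L]
  [FiniteDimensional K L] [IsKilling K L] {H : LieSubalgebra K L} [H.IsCartanSubalgebra]

theorem rootSpace_eq_span (i : H.root) {x : L} (hx : x ∈ rootSpace H i.1) (hx0 : x ≠ 0) :
    (rootSpace H i.1).toSubmodule = K ∙ x := by
  have h1 := finrank_rootSpace_eq_one i.1 (LieSubalgebra.isNonZero_coe_root i)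
  refine le_antisymm (fun y hy ↦ ?_) ((Submodule.span_singleton_le_iff_mem _ _).2 hx)
  obtain ⟨c, hc⟩ := (finrank_eq_one_iff_of_nonzero' (⟨x, hx⟩ : rootSpace H i.1)
    (by simpa [Subtype.ext_iff] using hx0)).1 h1 ⟨y, hy⟩
  exact Submodule.mem_span_singleton.2 ⟨c, congrArg Subtype.val hc⟩

theorem exists_rootSpace_ne_zero (i : H.root) : ∃ x ∈ rootSpace H i.1, x ≠ 0 :=
  i.1.exists_ne_zero

/-- A triple exists for some root vector; as the root space is a line, rescaling `e` and `f`
inversely makes `x` its raising element. -/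
theorem exists_isSl2Triple (i : H.root) {x : L} (hx : x ∈ rootSpace H i.1) (hx0 : x ≠ 0) :
    ∃ f ∈ rootSpace H (-i.1 : H → K), IsSl2Triple (coroot i.1 : L) x f := by
  have hi : i.1.IsNonZero := LieSubalgebra.isNonZero_coe_root i
  obtain ⟨h, e, f, ht, he, hf⟩ := exists_isSl2Triple_of_weight_isNonZero hi
  obtain rfl := ht.h_eq_coroot hi he hf
  have h1 : e ∈ K ∙ x := by
    rw [← rootSpace_eq_span i hx hx0]
    exact he
  obtain ⟨c, rfl⟩ := Submodule.mem_span_singleton.1 h1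
  have hc : c ≠ 0 := fun h0 ↦ ht.e_ne_zero (by rw [h0, zero_smul])
  refine ⟨c • f, Submodule.smul_mem _ _ hf, ht.h_ne_zero, ?_, ?_, ?_⟩
  · rw [lie_smul, ← smul_lie, ht.lie_e_f]
  · have := ht.lie_h_e_nsmul
    rw [lie_smul, smul_comm] at this
    exact smul_right_injective L hc this
  · rw [lie_smul, ht.lie_h_f_nsmul, smul_neg, smul_comm]

section Modules

variable {M : Type*} [AddCommGroup M] [Module K M] [LieRingModule L M] [LieModule K L M]
  [FiniteDimensional K M]

/-- The weight of a vector killed by a root vector is nonnegative on the corresponding coroot. -/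
theorem exists_nat_of_lie_eq_zero (i : H.root) {x : L} (hx : x ∈ rootSpace H i.1) (hx0 : x ≠ 0)
    {m : M} (hm0 : m ≠ 0) {c : K} (hm : ⁅(coroot i.1 : L), m⁆ = c • m) (h : ⁅x, m⁆ = 0) :
    ∃ n : ℕ, c = n := by
  obtain ⟨f, hf, ht⟩ := exists_isSl2Triple i hx hx0
  exact IsSl2Triple.HasPrimitiveVectorWith.exists_nat (t := ht) ⟨hm0, hm, h⟩

end Modules

/-- Opposite root spaces are lines. If these two vectors were orthogonal, `x` would be orthogonal to
the whole opposite root space and lie in the radical of the Killing form. -/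
theorem killingForm_ne_zero (i : H.root) {x y : L} (hx : x ∈ rootSpace H i.1) (hx0 : x ≠ 0)
    (hy : y ∈ rootSpace H (-i.1 : H → K)) (hy0 : y ≠ 0) : killingForm K L x y ≠ 0 := by
  intro h
  refine hx0 ?_
  have h1 : x ∈ LinearMap.ker (killingForm K L) := by
    refine mem_ker_killingForm_of_mem_rootSpace_of_forall_rootSpace_neg K L H hx fun z hz ↦ ?_
    have hneg : (-i.1 : LieModule.Weight K H L).IsNonZero := by
      rw [LieModule.Weight.isNonZero_neg]
      exact LieSubalgebra.isNonZero_coe_root i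
    have h2 : z ∈ K ∙ y := by
      rw [← rootSpace_eq_span ⟨-i.1, by simpa using hneg⟩ hy hy0]
      exact hz
    obtain ⟨c, rfl⟩ := Submodule.mem_span_singleton.1 h2
    rw [map_smul, h, smul_zero]
  simpa using h1

theorem exists_neg_root (i : H.root) : ∃ j : H.root, (j.1 : H → K) = -i.1 ∧
    (rootSystem H).root j = -(rootSystem H).root i := by
  have hneg : (-i.1 : LieModule.Weight K H L).IsNonZero := by
    rw [LieModule.Weight.isNonZero_neg]
    exact LieSubalgebra.isNonZero_coe_root i
  exact ⟨⟨-i.1, by simpa using hneg⟩, rfl, rfl⟩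

/-- The bracket of two root spaces whose roots add up to a root is nonzero. -/
theorem lie_ne_zero_of_add_root {i j k : H.root}
    (h : (rootSystem H).root i + (rootSystem H).root j = (rootSystem H).root k) {x y : L}
    (hx : x ∈ rootSpace H i.1) (hx0 : x ≠ 0) (hy : y ∈ rootSpace H j.1) (hy0 : y ≠ 0) :
    ⁅x, y⁆ ≠ 0 := by
  intro hxy
  -- Let `z` be a root vector for the negative of the sum. If `x` killed both `y` and `z`, their
  -- values on the coroot of `i` would be natural numbers `n` and `m` with `2 + n + m = 0`. So `⁅x,
  -- z⁆` is nonzero and opposite to `y`, and invariance of the Killing form contradicts `⁅x, y⁆ =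
  -- 0`.
  obtain ⟨l, hl, hl'⟩ := exists_neg_root k
  obtain ⟨z, hz, hz0⟩ := exists_rootSpace_ne_zero l
  have hH : ∀ {i : H.root} {x : L} (t : H), x ∈ rootSpace H i.1 → ⁅(t : L), x⁆ = i.1 t • x :=
    fun t hx ↦ lie_eq_smul_of_mem_rootSpace hx t
  obtain ⟨n, hn⟩ := exists_nat_of_lie_eq_zero i hx hx0 hy0 (hH _ hy) hxy
  have hfun : ∀ t : H, i.1 t + j.1 t = k.1 t := fun t ↦ LinearMap.congr_fun h t
  have hxz : ⁅x, z⁆ ≠ 0 := by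
    intro hxz
    obtain ⟨m, hm⟩ := exists_nat_of_lie_eq_zero i hx hx0 hz0 (hH _ hz) hxz
    have h1 := hfun (coroot i.1)
    rw [root_apply_coroot (LieSubalgebra.isNonZero_coe_root i), hn, ← neg_eq_iff_eq_neg.2 (congrFun hl _), hm] at h1
    have h2 : ((2 + n + m : ℕ) : K) = 0 := by
      push_cast
      linear_combination h1
    exact absurd (Nat.cast_eq_zero.1 h2) (by omega)
  have hmem : ⁅x, z⁆ ∈ rootSpace H (-j.1 : H → K) := by
    have h1 := lie_mem_genWeightSpace_of_mem_genWeightSpace hx hz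
    convert h1 using 2
    rw [hl]
    funext t
    have := hfun t
    simp only [Pi.neg_apply, Pi.add_apply]
    linear_combination -this
  refine killingForm_ne_zero j hy hy0 hmem hxz ?_
  rw [← LieModule.traceForm_apply_lie_apply, ← lie_skew, hxy, neg_zero, map_zero,
    LinearMap.zero_apply]

theorem stable_borel_iff (b : (rootSystem H).Base) {M : Type*} [AddCommGroup M] [Module K M]
    [LieRingModule L M] [LieModule K L M] {U : Submodule K M} :
    (∀ x ∈ borel b, ∀ y ∈ U, ⁅x, y⁆ ∈ U) ↔ (∀ x ∈ H, ∀ y ∈ U, ⁅x, y⁆ ∈ U) ∧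
      ∀ i : H.root, b.IsPos i → ∀ x ∈ rootSpace H i.1, ∀ y ∈ U, ⁅x, y⁆ ∈ U := by
  constructor
  · refine fun h ↦ ⟨fun x hx ↦ h x (Submodule.mem_sup_left hx), fun i hi x hx ↦
      h x (Submodule.mem_sup_right (Submodule.mem_iSup_of_mem
        (p := fun γ : {γ : H.root // b.IsPos γ} => (rootSpace H γ.1.1).toSubmodule) ⟨i, hi⟩ hx))⟩
  · rintro ⟨h1, h2⟩ x hx y hy
    obtain ⟨t, ht, n, hn, rfl⟩ := Submodule.mem_sup.1 hx
    rw [add_lie]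
    refine U.add_mem (h1 t ht y hy) ?_
    clear hx
    induction hn using Submodule.iSup_induction' with
    | mem γ n hn => exact h2 γ.1 γ.2 n hn y hy
    | zero => simp
    | add n n' _ _ h h' => rw [add_lie]; exact U.add_mem h h'

end RootSpaces

end LongAbelian

namespace LongAbelian

/-! ### Long Abelian ideals as stable families. -/

section Borel

open LieAlgebra LieAlgebra.IsKilling

variable {K L : Type*} [Field K] [CharZero K] [IsAlgClosed K] [LieRing L] [LieAlgebra K L]
  [FiniteDimensional K L] [IsKilling K L] {H : LieSubalgebra K L} [H.IsCartanSubalgebra]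

/-- A Cartan subalgebra acts diagonalizably, so generalized eigenspaces are eigenspaces and the
results on simultaneous eigenspaces apply. -/
theorem rootSpace_eq_simWeight (γ : Module.Dual K H) :
    (rootSpace H γ).toSubmodule = simWeight (fun t : H ↦ (LieModule.toEnd K H L t)) γ := by
  ext x
  exact ⟨fun hx t ↦ lie_eq_smul_of_mem_rootSpace hx t, fun hx ↦
    LieModule.weightSpace_le_genWeightSpace L _ ((LieModule.mem_weightSpace _ _).2 hx)⟩

theorem iSupIndep_rootSpace :
    iSupIndep fun γ : Module.Dual K H ↦ (rootSpace H γ).toSubmodule := by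
  simp_rw [rootSpace_eq_simWeight]
  exact iSupIndep_simWeight DFunLike.coe_injective

variable (b : (rootSystem H).Base)

theorem add_ne_zero_of_mem_posRoots {γ δ : Module.Dual K H} (hγ : γ ∈ posRoots b)
    (hδ : δ ∈ posRoots b) : γ + δ ≠ 0 := by
  obtain ⟨f, hf⟩ := exists_heightFunctional b
  obtain ⟨i, hi, rfl⟩ := hγ
  obtain ⟨j, hj, rfl⟩ := hδ
  intro h
  have h1 := congrArg f h
  rw [map_add, hf, hf, map_zero] at h1
  have h2 : b.height i + b.height j = 0 := by exact_mod_cast h1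
  have h3 : 0 < b.height i := hi
  have h4 : 0 < b.height j := hj
  omega

theorem add_mem_posRoots {γ δ : Module.Dual K H} (hγ : γ ∈ posRoots b)
    (hδ : δ ∈ posRoots b) (h : γ + δ ∈ Set.range (rootSystem H).root) : γ + δ ∈ posRoots b := by
  obtain ⟨i, hi, rfl⟩ := hγ
  obtain ⟨j, hj, rfl⟩ := hδ
  obtain ⟨k, hk⟩ := h
  exact ⟨k, hi.add hj hk, hk⟩

theorem lie_eq_zero_of_add_notMem_posRoots {γ δ : Module.Dual K H} (hγ : γ ∈ posRoots b)
    (hδ : δ ∈ posRoots b) (h : γ + δ ∉ posRoots b) {x y : L} (hx : x ∈ rootSpace H γ)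
    (hy : y ∈ rootSpace H δ) : ⁅x, y⁆ = 0 := by
  by_contra h0
  exact h (add_mem_posRoots b hγ hδ (mem_range_root_iff.2 ⟨add_ne_zero_of_mem_posRoots b hγ hδ,
    _, LieAlgebra.lie_mem_genWeightSpace_of_mem_genWeightSpace hx hy, h0⟩))

theorem exists_lie_ne_zero {γ δ : Module.Dual K H} (hγ : γ ∈ posRoots b)
    (hδ : δ ∈ posRoots b) (h : γ + δ ∈ posRoots b) :
    ∃ x ∈ rootSpace H γ, ∃ y ∈ rootSpace H δ, ⁅x, y⁆ ≠ 0 := by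
  obtain ⟨i, hi, rfl⟩ := hγ
  obtain ⟨j, hj, rfl⟩ := hδ
  obtain ⟨k, hk, hk'⟩ := h
  obtain ⟨x, hx, hx0⟩ := exists_rootSpace_ne_zero i
  obtain ⟨y, hy, hy0⟩ := exists_rootSpace_ne_zero j
  exact ⟨x, hx, y, hy, lie_ne_zero_of_add_root hk'.symm hx hx0 hy hy0⟩

theorem borel_le : (borel b).toSubmodule ≤
    ⨆ γ ∈ insert 0 (posRoots b), (rootSpace H (γ : Module.Dual K H)).toSubmodule := by
  refine sup_le ?_ (iSup_le fun γ ↦ ?_)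
  · intro x hx
    refine Submodule.mem_iSup_of_mem 0 (Submodule.mem_iSup_of_mem (Set.mem_insert _ _) ?_)
    change x ∈ rootSpace H (0 : H → K)
    rw [rootSpace_zero_eq]
    exact hx
  · intro x hx
    exact Submodule.mem_iSup_of_mem ((rootSystem H).root γ.1) (Submodule.mem_iSup_of_mem
      (Set.mem_insert_of_mem _ ⟨γ.1, γ.2, rfl⟩) hx)

theorem isPos_or_neg (i : H.root) :
    b.IsPos i ∨ ∃ j, b.IsPos j ∧ (rootSystem H).root j = -(rootSystem H).root i := by
  by_cases hi : b.IsPos i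
  · exact Or.inl hi
  · obtain ⟨j, -, hj⟩ := exists_neg_root i
    refine Or.inr ⟨j, ?_, hj⟩
    obtain ⟨f, hf⟩ := exists_heightFunctional b
    have h1 : b.height j = -b.height i := by
      have h2 := congrArg f hj
      rw [map_neg, hf, hf] at h2
      exact_mod_cast h2
    have h3 : b.height i ≠ 0 := b.height_ne_zero i
    have h4 : ¬ 0 < b.height i := hi
    change 0 < b.height j
    omega

theorem eq_zero_of_forall_pos {x : H}
    (h : ∀ i : H.root, b.IsPos i → i.1 x = 0) : x = 0 := by
  have hx : x ∈ ⨅ α : LieModule.Weight K H L, α.ker := by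
    rw [Submodule.mem_iInf]
    intro α
    by_cases hα : α.IsNonZero
    · rcases isPos_or_neg b ⟨α, by simpa using hα⟩ with hi | ⟨j, hj, hj'⟩
      · exact h _ hi
      · have h1 := LinearMap.congr_fun hj' x
        have h2 := h j hj
        have h3 : j.1 x = -α x := h1
        rw [h2, zero_eq_neg] at h3
        exact h3
    · rw [LieModule.Weight.IsNonZero, not_not] at hα
      exact congrFun hα x
  rw [iInf_ker_weight_eq_bot] at hx
  simpa using hx

/-- A commutative stable subspace of the Borel subalgebra is a sum of root spaces. -/
theorem exists_eq_iSup_rootSpace {U : Submodule K L} (hU : U ≤ (borel b).toSubmodule)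
    (hst : ∀ x ∈ borel b, ∀ y ∈ U, ⁅x, y⁆ ∈ U) (hcomm : ∀ x ∈ U, ∀ y ∈ U, ⁅x, y⁆ = 0) :
    U = ⨆ γ ∈ {γ : Module.Dual K H | γ ∈ posRoots b ∧ (rootSpace H γ).toSubmodule ≤ U},
      (rootSpace H γ).toSubmodule := by
  refine le_antisymm ?_ (iSup₂_le fun γ hγ ↦ hγ.2)
  have hle : U ≤ ⨆ γ : Module.Dual K H, (rootSpace H γ).toSubmodule :=
    (hU.trans (borel_le b)).trans (iSup_mono fun γ ↦ iSup_le fun _ ↦ le_rfl)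
  simp_rw [rootSpace_eq_simWeight] at hle
  have hle' := le_iSup_inf_simWeight (U := U) (T := fun t : H ↦ LieModule.toEnd K H L t)
    (χ := fun γ : Module.Dual K H ↦ (γ : H → K)) DFunLike.coe_injective
    (fun t u hu ↦ hst t (Submodule.mem_sup_left t.2) u hu) hle
  simp_rw [← rootSpace_eq_simWeight] at hle'
  refine hle'.trans (iSup_le fun γ x hx ↦ ?_)
  by_cases hx0 : x = 0
  · rw [hx0]
    exact Submodule.zero_mem _
  have hγ : γ ∈ insert 0 (posRoots b) := by
    by_contra hγ
    exact hx0 ((Submodule.disjoint_def.1 (iSupIndep_rootSpace.disjoint_biSup hγ)) x hx.2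
      (borel_le b (hU hx.1)))
  rcases hγ with rfl | hγ
  -- For `x` in the Cartan subalgebra and a positive root vector `e`, both `x` and `⁅e, x⁆` lie in
  -- `U`. That they commute makes the square of the root vanish at `x`, so all positive roots vanish
  -- there and `x = 0`.
  · exfalso
    have hxH : x ∈ rootSpace H (0 : H → K) := hx.2
    rw [rootSpace_zero_eq] at hxH
    replace hxH : x ∈ H := hxH
    refine hx0 (congrArg Subtype.val (eq_zero_of_forall_pos b (x := ⟨x, hxH⟩) fun i hi ↦ ?_))
    obtain ⟨e, he, he0⟩ := exists_rootSpace_ne_zero i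
    have h1 : ⁅x, e⁆ = i.1 ⟨x, hxH⟩ • e := lie_eq_smul_of_mem_rootSpace he ⟨x, hxH⟩
    have h2 := ((stable_borel_iff b).1 hst).2 i hi e he x hx.1
    have h3 := hcomm x hx.1 _ h2
    rw [← lie_skew e x, h1, lie_neg, lie_smul, h1, smul_smul, neg_eq_zero] at h3
    exact mul_self_eq_zero.1 ((smul_eq_zero.1 h3).resolve_right he0)
  · obtain ⟨i, hi, rfl⟩ := hγ
    have h1 : (rootSpace H i.1).toSubmodule ≤ U := by
      rw [rootSpace_eq_span i hx.2 hx0, Submodule.span_singleton_le_iff_mem]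
      exact hx.1
    exact le_biSup (fun γ : Module.Dual K H ↦ (rootSpace H γ).toSubmodule)
      (show (rootSystem H).root i ∈ {γ : Module.Dual K H | γ ∈ posRoots b ∧
        (rootSpace H γ).toSubmodule ≤ U} from ⟨⟨i, hi, rfl⟩, h1⟩) hx.2

theorem isLieAbelian_iff {L : Type*} [LieRing L] [LieAlgebra K L] (a : LieIdeal K L) :
    IsLieAbelian a ↔ ∀ x ∈ a, ∀ y ∈ a, ⁅x, y⁆ = 0 := by
  constructor
  · intro h x hx y hy
    exact congrArg Subtype.val (h.trivial ⟨x, hx⟩ ⟨y, hy⟩)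
  · exact fun h ↦ ⟨fun x y ↦ Subtype.ext (h x.1 x.2 y.1 y.2)⟩

/-- Ideals of the Borel subalgebra are the same as stable subspaces of `L` contained in it. Here `T`
contains all positive roots: a long root must not be raised to a short one. -/
theorem ncard_longAbelianIdeals : (longAbelianIdeals b).ncard =
    (stableFamily (posRoots b) (posRoots b) (longPosRoots b)).ncard := by
  let Φ : LieIdeal K (borel b) → Submodule K L :=
    fun a ↦ a.toSubmodule.map (borel b).toSubmodule.subtype
  have hΦ : Function.Injective Φ := (Submodule.map_injective_of_injective
    (Submodule.injective_subtype _)).comp (LieSubmodule.toSubmodule_injective)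
  have hmem : ∀ (a : LieIdeal K (borel b)) (x : borel b), (x : L) ∈ Φ a ↔ x ∈ a := by
    intro a x
    constructor
    · rintro ⟨y, hy, hyx⟩
      obtain rfl : y = x := Subtype.ext hyx
      exact hy
    · exact fun hx ↦ ⟨x, hx, rfl⟩
  have hsub : longPosRoots b ⊆ posRoots b := Set.image_mono fun i hi ↦ hi.1
  rw [← Set.ncard_image_of_injective _ hΦ]
  refine ncard_eq_ncard_stableFamily (H := (H : Set L))
    (R := fun γ : Module.Dual K H ↦ (rootSpace H γ).toSubmodule)
    (E := fun γ : Module.Dual K H ↦ (rootSpace H γ).toSubmodule) hsub ?_ iSupIndep_rootSpace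
    ?_ ?_ ?_ ?_ ?_ ?_ fun U ↦ ?_
  · rintro _ ⟨i, -, rfl⟩
    obtain ⟨x, hx, hx0⟩ := exists_rootSpace_ne_zero i
    exact ⟨x, hx0, rootSpace_eq_span i hx hx0⟩
  · intro x hx γ _ y hy
    have h1 : ⁅x, y⁆ = γ ⟨x, hx⟩ • y := lie_eq_smul_of_mem_rootSpace hy ⟨x, hx⟩
    rw [h1]
    exact Submodule.smul_mem _ _ hy
  · intro α _ γ _ x hx y hy
    rw [add_comm]
    exact LieAlgebra.lie_mem_genWeightSpace_of_mem_genWeightSpace hx hy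
  · intro α hα γ hγ h
    exact exists_lie_ne_zero b hα hγ (by rwa [add_comm])
  · intro α hα γ hγ h x hx y hy
    exact lie_eq_zero_of_add_notMem_posRoots b hα hγ (by rwa [add_comm]) hx hy
  · intro γ hγ δ hδ h
    exact exists_lie_ne_zero b hγ hδ h
  · intro γ hγ δ hδ h x hx y hy
    exact lie_eq_zero_of_add_notMem_posRoots b hγ hδ h hx hy
  have hst : ((∀ x ∈ (H : Set L), ∀ y ∈ U, ⁅x, y⁆ ∈ U) ∧
      ∀ α ∈ posRoots b, ∀ x ∈ (rootSpace H α).toSubmodule, ∀ y ∈ U, ⁅x, y⁆ ∈ U) ↔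
      ∀ x ∈ borel b, ∀ y ∈ U, ⁅x, y⁆ ∈ U := by
    rw [stable_borel_iff]
    refine and_congr Iff.rfl ⟨fun h i hi ↦ h ((rootSystem H).root i) ⟨i, hi, rfl⟩, ?_⟩
    rintro h _ ⟨i, hi, rfl⟩
    exact h i hi
  refine Iff.trans ?_ (and_congr_right' ((and_congr_left' hst.symm).trans and_assoc))
  constructor
  · rintro ⟨a, ⟨hab, hlong⟩, rfl⟩
    rw [isLieAbelian_iff] at hab
    have hle : Φ a ≤ (borel b).toSubmodule := Submodule.map_subtype_le _ _
    have hst : ∀ x ∈ borel b, ∀ y ∈ Φ a, ⁅x, y⁆ ∈ Φ a := by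
      rintro x hx _ ⟨y, hy, rfl⟩
      exact ⟨⁅⟨x, hx⟩, y⁆, a.lie_mem hy, rfl⟩
    have hcomm : ∀ x ∈ Φ a, ∀ y ∈ Φ a, ⁅x, y⁆ = 0 := by
      rintro _ ⟨x, hx, rfl⟩ _ ⟨y, hy, rfl⟩
      exact congrArg Subtype.val (hab x hx y hy)
    refine ⟨⟨_, ?_, exists_eq_iSup_rootSpace b hle hst hcomm⟩, hst, hcomm⟩
    rintro _ ⟨⟨i, hi, rfl⟩, h⟩
    exact ⟨i, ⟨hi, hlong i ⟨hi, fun x hx ↦ (hmem a x).1 (h hx)⟩⟩, rfl⟩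
  · rintro ⟨⟨S, hS, rfl⟩, hst, hcomm⟩
    set U := ⨆ γ ∈ S, (rootSpace H γ).toSubmodule with hU
    have hle : U ≤ (borel b).toSubmodule := by
      refine iSup₂_le fun γ hγ ↦ ?_
      obtain ⟨i, hi, rfl⟩ := hS hγ
      exact le_sup_of_le_right (le_iSup (fun γ : {γ : H.root // b.IsPos γ} =>
        (rootSpace H γ.1.1).toSubmodule) ⟨i, hi.1⟩)
    let a : LieIdeal K (borel b) :=
      { toSubmodule := U.comap (borel b).toSubmodule.subtype
        lie_mem := fun {x y} hy ↦ hst x.1 x.2 y.1 hy }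
    have ha : Φ a = U := by
      change Submodule.map _ (Submodule.comap _ U) = U
      rw [Submodule.map_comap_subtype, inf_eq_right.2 hle]
    refine ⟨a, ⟨(isLieAbelian_iff a).2 fun x hx y hy ↦ Subtype.ext (hcomm x hx y hy), ?_⟩, ha⟩
    rintro i ⟨hi, h⟩
    obtain ⟨x, hx, hx0⟩ := exists_rootSpace_ne_zero i
    have hxb : x ∈ borel b := Submodule.mem_sup_right (Submodule.mem_iSup_of_mem
      (p := fun γ : {γ : H.root // b.IsPos γ} => (rootSpace H γ.1.1).toSubmodule) ⟨i, hi⟩ hx)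
    have hxU : x ∈ U := h ⟨x, hxb⟩ hx
    by_cases hiS : (rootSystem H).root i ∈ S
    · obtain ⟨j, hj, hji⟩ := hS hiS
      rw [← (rootSystem H).root.injective hji]
      exact hj.2
    · exact absurd ((Submodule.disjoint_def.1 (iSupIndep_rootSpace.disjoint_biSup hiS)) x hx hxU)
        hx0

end Borel

end LongAbelian

namespace LongAbelian

/-! ### Lengths in the root lattice. -/

section RootLattice

open RootPairing

variable {ι K M N : Type*} [Fintype ι] [Field K] [CharZero K] [AddCommGroup M] [Module K M]
  [AddCommGroup N] [Module K N] {P : RootPairing ι K M N} [P.IsCrystallographic]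

/-- The squared length of an element of the root lattice. -/
def latticeNorm (x : P.rootSpan ℤ) : ℤ := (P.posRootForm ℤ).posForm x x

theorem latticeNorm_root (i : ι) :
    latticeNorm (P.rootSpanMem ℤ i) = (P.posRootForm ℤ).rootLength i := rfl

theorem posForm_comm (x y : P.rootSpan ℤ) :
    (P.posRootForm ℤ).posForm x y = (P.posRootForm ℤ).posForm y x :=
  (P.posRootForm ℤ).isSymm_posForm.eq x y

theorem two_mul_posForm_root (x : P.rootSpan ℤ) (i : ι) :
    2 * (P.posRootForm ℤ).posForm x (P.rootSpanMem ℤ i) =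
      P.coroot'In ℤ i x * (P.posRootForm ℤ).rootLength i := by
  apply FaithfulSMul.algebraMap_injective ℤ K
  have h := two_mul_form_root (P.posRootForm ℤ).toInvariantForm (x : M) i
  rw [map_mul, map_mul, RootPositiveForm.algebraMap_posForm, RootPairing.algebraMap_coroot'In_apply,
    RootPositiveForm.algebraMap_rootLength, map_ofNat]
  exact h

theorem latticeNorm_add (x y : P.rootSpan ℤ) : latticeNorm (x + y) =
    latticeNorm x + 2 * (P.posRootForm ℤ).posForm x y + latticeNorm y := by
  simp only [latticeNorm, map_add, LinearMap.add_apply]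
  rw [posForm_comm y x]
  ring

/-- The length argument rests on this formula: `k = -⟨x, α^∨⟩` is the reflection and preserves the
norm, while adding `α` strictly increases it once the pairing is nonnegative. -/
theorem latticeNorm_add_zsmul_root (x : P.rootSpan ℤ) (i : ι) (k : ℤ) :
    latticeNorm (x + k • P.rootSpanMem ℤ i) = latticeNorm x +
      (P.coroot'In ℤ i x + k) * k * (P.posRootForm ℤ).rootLength i := by
  have h1 : latticeNorm (k • P.rootSpanMem ℤ i) = k * k * (P.posRootForm ℤ).rootLength i := by
    simp only [latticeNorm, map_smul, LinearMap.smul_apply, smul_eq_mul, RootPositiveForm.rootLength]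
    ring
  rw [latticeNorm_add, h1, map_smul, smul_eq_mul]
  linear_combination k * two_mul_posForm_root x i

theorem latticeNorm_pos {x : P.rootSpan ℤ} (hx : x ≠ 0) : 0 < latticeNorm x :=
  P.posRootForm_posForm_pos_of_ne_zero ℤ hx

variable [P.IsReduced] [P.IsIrreducible]

theorem rootLength_cast_ne {i j : ι}
    (h : (P.posRootForm ℤ).rootLength i ≠ (P.posRootForm ℤ).rootLength j) :
    (P.posRootForm ℤ).toInvariantForm.form (P.root i) (P.root i) ≠
      (P.posRootForm ℤ).toInvariantForm.form (P.root j) (P.root j) := by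
  intro h'
  apply h
  apply FaithfulSMul.algebraMap_injective ℤ K
  rw [RootPositiveForm.algebraMap_rootLength, RootPositiveForm.algebraMap_rootLength]
  exact h'

/-- An irreducible reduced root system has at most two root lengths. -/
theorem rootLength_eq_of_isShortRoot {i j : ι} (hi : IsShortRoot P i) (hj : IsShortRoot P j) :
    (P.posRootForm ℤ).rootLength i = (P.posRootForm ℤ).rootLength j := by
  obtain ⟨k, hk⟩ := hi
  obtain ⟨l, hl⟩ := hj
  have key : ∀ m, (P.posRootForm ℤ).rootLength m = (P.posRootForm ℤ).rootLength i ∨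
      (P.posRootForm ℤ).rootLength m = (P.posRootForm ℤ).rootLength k := by
    intro m
    by_contra! h
    rcases (P.posRootForm ℤ).toInvariantForm.apply_eq_or_of_apply_ne (rootLength_cast_ne hk.ne) m
      with h' | h'
    · exact rootLength_cast_ne h.1 h'
    · exact rootLength_cast_ne h.2 h'
  rcases key j with h | h <;> rcases key l with h' | h' <;> omega

theorem isShortRoot_of_rootLength_eq {i j : ι} (hi : IsShortRoot P i)
    (h : (P.posRootForm ℤ).rootLength j = (P.posRootForm ℤ).rootLength i) : IsShortRoot P j := by
  obtain ⟨k, hk⟩ := hi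
  exact ⟨k, h ▸ hk⟩

/-- The ratio of two squared lengths is `1`, `2` or `3` or an inverse of these, and shortness of `i`
excludes the inverses. -/
theorem dvd_rootLength {i : ι} (hi : IsShortRoot P i) (j : ι) :
    (P.posRootForm ℤ).rootLength i ∣ (P.posRootForm ℤ).rootLength j := by
  by_cases hj : IsShortRoot P j
  · rw [rootLength_eq_of_isShortRoot hi hj]
  have hle : (P.posRootForm ℤ).rootLength i ≤ (P.posRootForm ℤ).rootLength j := by
    by_contra! h
    exact hj ⟨i, h⟩
  have hpos := (P.posRootForm ℤ).rootLength_pos i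
  have hpos' := (P.posRootForm ℤ).rootLength_pos j
  have hcast : ∀ (k : ℤ) (a c : ι), (P.posRootForm ℤ).toInvariantForm.form (P.root a) (P.root a) =
      k * (P.posRootForm ℤ).toInvariantForm.form (P.root c) (P.root c) →
      (P.posRootForm ℤ).rootLength a = k * (P.posRootForm ℤ).rootLength c := by
    intro k a c h
    apply FaithfulSMul.algebraMap_injective ℤ K
    rw [map_mul, RootPositiveForm.algebraMap_rootLength, RootPositiveForm.algebraMap_rootLength]
    exact h
  rcases (P.posRootForm ℤ).toInvariantForm.apply_eq_or j i with h | h | h | h | h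
  · exact ⟨1, by rw [hcast 1 j i (by simpa using h)]; ring⟩
  · exact ⟨2, by rw [hcast 2 j i (by simpa using h)]; ring⟩
  · exact ⟨3, by rw [hcast 3 j i (by simpa using h)]; ring⟩
  · have := hcast 2 i j (by simpa using h)
    omega
  · have := hcast 3 i j (by simpa using h)
    omega

/-- Roots have norm divisible by the short length, and so do the cross terms, since `2 (x, α)` is an
integer multiple of the squared length of `α`. In particular a nonzero lattice element is at least
as long as a short root. -/
theorem dvd_latticeNorm {i : ι} (hi : IsShortRoot P i) (x : P.rootSpan ℤ) :
    (P.posRootForm ℤ).rootLength i ∣ latticeNorm x := by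
  have h1 : ∀ (x : P.rootSpan ℤ) (j : ι), (P.posRootForm ℤ).rootLength i ∣
      2 * (P.posRootForm ℤ).posForm x (P.rootSpanMem ℤ j) := fun x j ↦ by
    rw [two_mul_posForm_root]
    exact (dvd_rootLength hi j).mul_left _
  have h2 : ∀ x y : P.rootSpan ℤ, (P.posRootForm ℤ).rootLength i ∣
      2 * (P.posRootForm ℤ).posForm x y := by
    rintro x ⟨y, hy⟩
    induction hy using Submodule.span_induction with
    | mem y hy =>
      obtain ⟨j, rfl⟩ := hy
      exact h1 x j
    | zero =>
      have : (P.posRootForm ℤ).posForm x 0 = 0 := map_zero _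
      exact ⟨0, by rw [mul_zero]; exact mul_eq_zero_of_right _ this⟩
    | add y z hy hz h h' =>
      have := dvd_add h h'
      rw [← mul_add, ← map_add] at this
      exact this
    | smul a y hy h =>
      have := h.mul_left a
      rw [mul_left_comm, ← smul_eq_mul (a := a) (b := _), ← map_smul] at this
      exact this
  obtain ⟨x, hx⟩ := x
  induction hx using Submodule.span_induction with
  | mem y hy =>
    obtain ⟨j, rfl⟩ := hy
    exact dvd_rootLength hi j
  | zero =>
    have : latticeNorm (0 : P.rootSpan ℤ) = 0 := map_zero _
    exact this ▸ dvd_zero _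
  | add y z hy hz h h' =>
    have := dvd_add (dvd_add h (h2 ⟨y, hy⟩ ⟨z, hz⟩)) h'
    rw [← latticeNorm_add] at this
    exact this
  | smul a y hy h =>
    have h3 : latticeNorm (a • (⟨y, hy⟩ : P.rootSpan ℤ)) =
        a * a * latticeNorm (⟨y, hy⟩ : P.rootSpan ℤ) := by
      simp only [latticeNorm, map_smul, LinearMap.smul_apply, smul_eq_mul]
      ring
    have := h.mul_left (a * a)
    rw [← h3] at this
    exact this

/-- A set of roots that is stable under reflections and contains a root contains all roots of the
same length. -/
theorem mem_of_reflection_stable [P.IsRootSystem] {X : Set ι}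
    (hX : ∀ i ∈ X, ∀ k, P.reflectionPerm k i ∈ X) {i : ι} (hi : i ∈ X)
    (hlen : ∀ k ∈ X, (P.posRootForm ℤ).rootLength k = (P.posRootForm ℤ).rootLength i) {j : ι}
    (hj : (P.posRootForm ℤ).rootLength j = (P.posRootForm ℤ).rootLength i) : j ∈ X := by
  -- Otherwise the coroot of `j` kills the span of `X`. That span is nonzero and reflection-stable,
  -- hence everything by irreducibility, but the coroot is `2` on its own root.
  obtain ⟨k, hk, hkj⟩ : ∃ k ∈ X, P.pairing k j ≠ 0 := by
    by_contra! h
    let q : Submodule K M := Submodule.span K (P.root '' X)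
    have hq : q = ⊤ := by
      refine IsIrreducible.eq_top_of_invtSubmodule_reflection (P := P) q (fun l ↦ ?_) ?_
      · rw [Module.End.mem_invtSubmodule, Submodule.span_le]
        rintro _ ⟨m, hm, rfl⟩
        exact Submodule.subset_span ⟨_, hX m hm l, P.root_reflectionPerm l m⟩
      · intro hb
        have : P.root i ∈ q := Submodule.subset_span ⟨i, hi, rfl⟩
        rw [hb, Submodule.mem_bot] at this
        exact P.ne_zero i this
    have hle : q ≤ LinearMap.ker (P.coroot' j) := by
      rw [Submodule.span_le]
      rintro _ ⟨m, hm, rfl⟩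
      rw [SetLike.mem_coe, LinearMap.mem_ker, RootPairing.root_coroot'_eq_pairing]
      exact h m hm
    have h2 : P.root j ∈ LinearMap.ker (P.coroot' j) := hle (hq ▸ Submodule.mem_top)
    rw [LinearMap.mem_ker, RootPairing.root_coroot'_eq_pairing, RootPairing.pairing_same] at h2
    exact two_ne_zero h2
  by_cases hkj' : k = j
  · exact hkj' ▸ hk
  by_cases hneg : P.root k = -P.root j
  · have h1 := hX k hk k
    have h2 : P.reflectionPerm k k = j := P.root.injective (by
      rw [RootPairing.root_reflectionPerm, RootPairing.reflection_apply_self, hneg, neg_neg])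
    exact h2 ▸ h1
  have hform : (P.posRootForm ℤ).toInvariantForm.form (P.root k) (P.root k) =
      (P.posRootForm ℤ).toInvariantForm.form (P.root j) (P.root j) := by
    by_contra h
    refine h ?_
    have h1 := (P.posRootForm ℤ).algebraMap_rootLength k
    rw [hlen k hk, ← hj, (P.posRootForm ℤ).algebraMap_rootLength] at h1
    exact h1.symm
  have hpair := P.pairingIn_pairingIn_mem_set_of_length_eq_of_ne hform hkj' hneg
  have hc1 : P.pairing k j = (P.pairingIn ℤ k j : K) := (P.algebraMap_pairingIn ℤ k j).symm
  have hc2 : P.pairing j k = (P.pairingIn ℤ j k : K) := (P.algebraMap_pairingIn ℤ j k).symm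
  -- The product of the reflections in `j` and then `k` takes `k` to `j` if the pairings are `-1`,
  -- and to `-j` if they are `1`; in the latter case one more reflection gives `j`.
  have h3 := hX _ (hX k hk j) k
  simp only [Set.mem_insert_iff, Set.mem_singleton_iff, Prod.mk.injEq] at hpair
  rcases hpair with ⟨e1, e2⟩ | ⟨e1, e2⟩ | ⟨e1, e2⟩
  · rw [e1] at hc1
    exact absurd (by simpa using hc1) hkj
  · have h4 := hX _ h3 (P.reflectionPerm k (P.reflectionPerm j k))
    rw [e1] at hc1
    rw [e2] at hc2
    convert h4
    apply P.root.injective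
    rw [RootPairing.root_reflectionPerm, RootPairing.reflection_apply_self,
      RootPairing.root_reflectionPerm, RootPairing.root_reflectionPerm,
      RootPairing.reflection_apply_root, map_sub, map_smul, RootPairing.reflection_apply_self,
      RootPairing.reflection_apply_root, hc1, hc2]
    simp
  · rw [e1] at hc1
    rw [e2] at hc2
    convert h3
    apply P.root.injective
    rw [RootPairing.root_reflectionPerm, RootPairing.root_reflectionPerm,
      RootPairing.reflection_apply_root, map_sub, map_smul, RootPairing.reflection_apply_self,
      RootPairing.reflection_apply_root, hc1, hc2]
    simp

end RootLattice

end LongAbelian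

namespace LongAbelian

/-! ### Highest weight vectors and weights of maximal length. -/

section HighestWeight

open LieAlgebra LieAlgebra.IsKilling

variable {K L : Type*} [Field K] [CharZero K] [IsAlgClosed K] [LieRing L] [LieAlgebra K L]
  [FiniteDimensional K L] [IsKilling K L] {H : LieSubalgebra K L} [H.IsCartanSubalgebra]
  {M : Type*} [AddCommGroup M] [Module K M] [LieRingModule L M] [LieModule K L M]

variable (H M) in
/-- The eigenspaces of a Cartan subalgebra in a module. -/
def mwt (γ : Module.Dual K H) : Submodule K M :=
  simWeight (fun t : H ↦ LieModule.toEnd K L M t) γ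

theorem mem_mwt {γ : Module.Dual K H} {m : M} :
    m ∈ mwt H M γ ↔ ∀ t : H, ⁅(t : L), m⁆ = γ t • m := Iff.rfl

theorem iSupIndep_mwt : iSupIndep (mwt H M) :=
  iSupIndep_simWeight (χ := fun γ : Module.Dual K H ↦ (γ : H → K)) DFunLike.coe_injective

theorem lie_mem_mwt {α γ : Module.Dual K H} {x : L} {m : M} (hx : x ∈ rootSpace H α)
    (hm : m ∈ mwt H M γ) : ⁅x, m⁆ ∈ mwt H M (γ + α) := by
  intro t
  have h1 : ⁅(t : L), x⁆ = α t • x := lie_eq_smul_of_mem_rootSpace hx t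
  change ⁅(t : L), ⁅x, m⁆⁆ = (γ + α) t • ⁅x, m⁆
  rw [leibniz_lie, h1, mem_mwt.1 hm t, smul_lie, lie_smul, LinearMap.add_apply, add_smul, add_comm]

variable (b : (rootSystem H).Base)

theorem eq_top_of_borel_opposite {Q : Submodule K L} (hH : H.toSubmodule ≤ Q)
    (hpos : ∀ i, b.IsPos i → (rootSpace H i.1).toSubmodule ≤ Q)
    (hneg : ∀ i, b.IsPos i →
      (rootSpace H (-(rootSystem H).root i : Module.Dual K H)).toSubmodule ≤ Q) : Q = ⊤ := by
  rw [Submodule.eq_top_iff']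
  intro x
  have hx : x ∈ (⨆ α : LieModule.Weight K H L, rootSpace H α : LieSubmodule K H L) := by
    rw [LieModule.iSup_genWeightSpace_eq_top']
    trivial
  rw [← LieSubmodule.mem_toSubmodule, LieSubmodule.iSup_toSubmodule] at hx
  refine (iSup_le fun α ↦ ?_ : _ ≤ Q) hx
  by_cases hα : α.IsNonZero
  · rcases isPos_or_neg b ⟨α, by simpa using hα⟩ with hi | ⟨j, hj, hj'⟩
    · have h1 := hpos _ hi
      exact h1
    · have := hneg j hj
      rw [hj', neg_neg] at this
      exact this
  · rw [LieModule.Weight.IsNonZero, not_not] at hα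
    have hα' : (α : H → K) = 0 := hα
    rw [hα', rootSpace_zero_eq]
    exact hH

/-- A vector of weight `θ` killed by the positive root spaces. -/
structure IsHighestWeightVector (θ : Module.Dual K H) (v : M) : Prop where
  ne_zero : v ≠ 0
  mem : v ∈ mwt H M θ
  lie_eq_zero : ∀ i : H.root, b.IsPos i → ∀ x ∈ rootSpace H i.1, ⁅x, v⁆ = 0

/-- The linear function that takes the value one on the simple roots. -/
def heightFun : Module.Dual K H →ₗ[K] K := (exists_heightFunctional b).choose

theorem heightFun_root (i : H.root) : heightFun b ((rootSystem H).root i) = b.height i :=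
  (exists_heightFunctional b).choose_spec i

/-- The elements below a given one with respect to the order given by a base. -/
def belowWeights (θ : Module.Dual K H) : Set (Module.Dual K H) :=
  {γ | θ - γ ∈ (rootSystem H).rootSpan ℤ ∧ ∃ n : ℕ, heightFun b (θ - γ) = n + 1}

theorem self_notMem_belowWeights (θ : Module.Dual K H) : θ ∉ belowWeights b θ := by
  rintro ⟨-, n, hn⟩
  rw [sub_self, map_zero] at hn
  exact Nat.cast_add_one_ne_zero n hn.symm

theorem notMem_belowWeights {θ γ : Module.Dual K H} (h : γ ∈ belowWeights b θ) :
    θ ∉ belowWeights b γ := by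
  rintro ⟨-, n, hn⟩
  obtain ⟨-, m, hm⟩ := h
  have h1 : ((n + m + 2 : ℕ) : K) = 0 := by
    rw [← neg_sub, map_neg, hm] at hn
    push_cast
    linear_combination -hn
  exact absurd (Nat.cast_eq_zero.1 h1) (by omega)

theorem sub_root_mem_belowWeights (θ : Module.Dual K H) {i : H.root} (hi : b.IsPos i) :
    θ - (rootSystem H).root i ∈ belowWeights b θ := by
  refine ⟨?_, (b.height i - 1).toNat, ?_⟩
  · rw [sub_sub_cancel]
    exact Submodule.subset_span ⟨i, rfl⟩
  · have h1 : 0 < b.height i := hi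
    have h2 : ((b.height i - 1).toNat : ℤ) = b.height i - 1 := Int.toNat_of_nonneg (by omega)
    rw [sub_sub_cancel, heightFun_root]
    have h3 : (((b.height i - 1).toNat : ℤ) : K) = ((b.height i - 1 : ℤ) : K) := by rw [h2]
    push_cast at h3
    rw [h3]
    ring

theorem belowWeights_trans {θ γ δ : Module.Dual K H} (h : γ ∈ belowWeights b θ)
    (h' : δ ∈ belowWeights b γ) : δ ∈ belowWeights b θ := by
  obtain ⟨h1, n, hn⟩ := h
  obtain ⟨h2, m, hm⟩ := h'
  have h3 : θ - δ = (θ - γ) + (γ - δ) := by abel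
  refine ⟨h3 ▸ Submodule.add_mem _ h1 h2, n + m + 1, ?_⟩
  rw [h3, map_add, hn, hm]
  push_cast
  ring

namespace IsHighestWeightVector

variable {b} {θ : Module.Dual K H} {v : M} [LieModule.IsIrreducible K L M]

/-- A highest weight vector of an irreducible module generates it under the negative root
spaces. -/
theorem eq_top_of_stable (h : IsHighestWeightVector b θ v) {U : Submodule K M} (hv : v ∈ U)
    (hU : ∀ i, b.IsPos i → ∀ x ∈ rootSpace H (-(rootSystem H).root i : Module.Dual K H),
      ∀ u ∈ U, ⁅x, u⁆ ∈ U) : U = ⊤ := by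
  let X : Set (Submodule K M) := {U | v ∈ U ∧ ∀ i, b.IsPos i →
    ∀ x ∈ rootSpace H (-(rootSystem H).root i : Module.Dual K H), ∀ u ∈ U, ⁅x, u⁆ ∈ U}
  let U0 : Submodule K M := sInf X
  have hv0 : v ∈ U0 := Submodule.mem_sInf.2 fun p hp ↦ hp.1
  have hf0 : ∀ i, b.IsPos i → ∀ x ∈ rootSpace H (-(rootSystem H).root i : Module.Dual K H),
      ∀ u ∈ U0, ⁅x, u⁆ ∈ U0 := fun i hi x hx u hu ↦
    Submodule.mem_sInf.2 fun p hp ↦ hp.2 i hi x hx u (Submodule.mem_sInf.1 hu p hp)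
  -- `U0` is the least subspace that contains `v` and is stable under negative root vectors. Its
  -- part `U1`, which all of `L` maps into `U0`, has the same two properties. So `U1` is `U0`, and
  -- `U0` is a submodule. This replaces an ordering argument in the enveloping algebra.
  let U1 : Submodule K M :=
    { carrier := {u | u ∈ U0 ∧ ∀ x : L, ⁅x, u⁆ ∈ U0}
      add_mem' := fun ha hb ↦ ⟨U0.add_mem ha.1 hb.1, fun x ↦ by
        rw [lie_add]
        exact U0.add_mem (ha.2 x) (hb.2 x)⟩
      zero_mem' := ⟨U0.zero_mem, fun x ↦ by
        rw [lie_zero]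
        exact U0.zero_mem⟩
      smul_mem' := fun c u hu ↦ ⟨U0.smul_mem c hu.1, fun x ↦ by
        rw [lie_smul]
        exact U0.smul_mem c (hu.2 x)⟩ }
  have h1 : U1 ∈ X := by
    refine ⟨⟨hv0, ?_⟩, fun i hi x hx u hu ↦ ⟨hf0 i hi x hx u hu.1, fun y ↦ ?_⟩⟩
    · have : U0.comap ((LieModule.toEnd K L M : L →ₗ[K] Module.End K M).flip v) = ⊤ := by
        refine eq_top_of_borel_opposite b (fun t ht ↦ ?_) (fun i hi x hx ↦ ?_)
          (fun i hi x hx ↦ hf0 i hi x hx v hv0)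
        · change ⁅t, v⁆ ∈ U0
          rw [mem_mwt.1 h.mem ⟨t, ht⟩]
          exact U0.smul_mem _ hv0
        · change ⁅x, v⁆ ∈ U0
          rw [h.lie_eq_zero i hi x hx]
          exact U0.zero_mem
      intro x
      have hx : x ∈ U0.comap ((LieModule.toEnd K L M : L →ₗ[K] Module.End K M).flip v) := by
        rw [this]
        trivial
      exact hx
    · rw [leibniz_lie]
      exact U0.add_mem (hu.2 _) (hf0 i hi x hx _ (hu.2 y))
  have h01 : U0 ≤ U1 := sInf_le h1
  let N : LieSubmodule K L M := { U0 with lie_mem := fun {x u} hu ↦ (h01 hu).2 x }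
  have hN : N = ⊤ := (eq_bot_or_eq_top N).resolve_left fun hb ↦ h.ne_zero (by
    have : v ∈ N := hv0
    rwa [hb, LieSubmodule.mem_bot] at this)
  rw [Submodule.eq_top_iff']
  intro m
  have hm : m ∈ N := by
    rw [hN]
    trivial
  exact (sInf_le (show U ∈ X from ⟨hv, hU⟩) : U0 ≤ U) hm

/-- `belowWeights` keeps only integrality and the sign of the height difference. This is enough for
the span to be stable under negative root vectors, and for the highest weight to be separated from
the rest. -/
theorem sup_eq_top (h : IsHighestWeightVector b θ v) :
    K ∙ v ⊔ ⨆ γ ∈ belowWeights b θ, mwt H M γ = ⊤ := by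
  refine h.eq_top_of_stable (Submodule.mem_sup_left (Submodule.mem_span_singleton_self v)) ?_
  intro i hi x hx u hu
  have key : K ∙ v ⊔ ⨆ γ ∈ belowWeights b θ, mwt H M γ ≤
      (K ∙ v ⊔ ⨆ γ ∈ belowWeights b θ, mwt H M γ).comap (LieModule.toEnd K L M x) := by
    have hmem : ∀ γ ∈ belowWeights b θ, mwt H M γ ≤
        K ∙ v ⊔ ⨆ γ ∈ belowWeights b θ, mwt H M γ := fun γ hγ ↦
      le_sup_of_le_right (le_biSup (mwt H M) hγ)
    refine sup_le ?_ (iSup₂_le fun γ hγ u hu ↦ ?_)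
    · rw [Submodule.span_singleton_le_iff_mem]
      have h1 := lie_mem_mwt hx h.mem
      rw [← sub_eq_add_neg] at h1
      exact hmem _ (sub_root_mem_belowWeights b θ hi) h1
    · have h1 := lie_mem_mwt hx hu
      rw [← sub_eq_add_neg] at h1
      exact hmem _ (belowWeights_trans b hγ (sub_root_mem_belowWeights b γ hi)) h1
  exact key hu

theorem mwt_eq_span (h : IsHighestWeightVector b θ v) : mwt H M θ = K ∙ v := by
  refine le_antisymm (fun w hw ↦ ?_) ((Submodule.span_singleton_le_iff_mem _ _).2 h.mem)
  have hw' : w ∈ K ∙ v ⊔ ⨆ γ ∈ belowWeights b θ, mwt H M γ := by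
    rw [h.sup_eq_top]
    trivial
  obtain ⟨u, hu, q, hq, rfl⟩ := Submodule.mem_sup.1 hw'
  have hu' : u ∈ mwt H M θ := (Submodule.span_singleton_le_iff_mem _ _).2 h.mem hu
  have hq' : q ∈ mwt H M θ := by
    have := Submodule.sub_mem _ hw hu'
    rwa [add_sub_cancel_left] at this
  rw [(Submodule.disjoint_def.1 (iSupIndep_mwt.disjoint_biSup (self_notMem_belowWeights b θ)))
    q hq' hq, add_zero]
  exact hu

theorem eq_or_mem_belowWeights (h : IsHighestWeightVector b θ v) {γ : Module.Dual K H}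
    (hγ : mwt H M γ ≠ ⊥) : γ = θ ∨ γ ∈ belowWeights b θ := by
  by_contra! hcon
  refine hγ ((Submodule.eq_bot_iff _).2 fun u hu ↦ ?_)
  have hγ' : γ ∉ insert θ (belowWeights b θ) := by simpa using hcon
  refine (Submodule.disjoint_def.1 (iSupIndep_mwt.disjoint_biSup hγ')) u hu ?_
  rw [iSup_insert, h.mwt_eq_span, h.sup_eq_top]
  trivial

theorem iSup_mwt (h : IsHighestWeightVector b θ v) : ⨆ γ, mwt H M γ = ⊤ := by
  rw [eq_top_iff, ← h.sup_eq_top, ← h.mwt_eq_span]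
  exact sup_le (le_iSup _ _) (iSup₂_le fun γ _ ↦ le_iSup _ _)

/-- If they differed, each of the two weights would be strictly below the other. -/
theorem weight_unique (h : IsHighestWeightVector b θ v) {μ : Module.Dual K H} {u : M}
    (h' : IsHighestWeightVector b μ u) : μ = θ := by
  have hμ : mwt H M μ ≠ ⊥ := (Submodule.ne_bot_iff _).2 ⟨u, h'.mem, h'.ne_zero⟩
  have hθ : mwt H M θ ≠ ⊥ := (Submodule.ne_bot_iff _).2 ⟨v, h.mem, h.ne_zero⟩
  rcases h.eq_or_mem_belowWeights hμ with h1 | h1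
  · exact h1
  rcases h'.eq_or_mem_belowWeights hθ with h2 | h2
  · exact h2.symm
  exact absurd h2 (notMem_belowWeights b h1)

end IsHighestWeightVector

variable [FiniteDimensional K M]

/-- Moving a vector of lowest weight of a root string to the other end of the string. -/
theorem pow_toEnd_mem_mwt (i : H.root) {γ : Module.Dual K H} {n : ℕ}
    (hn : γ (coroot i.1) = -(n : K)) {x : L} (hx : x ∈ rootSpace H i.1) (hx0 : x ≠ 0) {u : M}
    (hu : u ∈ mwt H M γ) (hu0 : u ≠ 0)
    (hker : ∀ y ∈ rootSpace H (-(rootSystem H).root i : Module.Dual K H), ⁅y, u⁆ = 0) :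
    (LieModule.toEnd K L M x ^ n) u ≠ 0 ∧
      (LieModule.toEnd K L M x ^ n) u ∈ mwt H M (γ + (n : ℤ) • (rootSystem H).root i) := by
  obtain ⟨f, hf, ht⟩ := exists_isSl2Triple i hx hx0
  constructor
  · have P : ht.symm.HasPrimitiveVectorWith u (n : K) :=
      { ne_zero := hu0
        lie_h := by rw [neg_lie, mem_mwt.1 hu, hn, neg_smul, neg_neg]
        lie_e := hker f hf }
    exact P.pow_toEnd_f_ne_zero_of_eq_nat rfl le_rfl
  · have key : ∀ m : ℕ, (LieModule.toEnd K L M x ^ m) u ∈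
        mwt H M (γ + (m : ℤ) • (rootSystem H).root i) := by
      intro m
      induction m with
      | zero => simpa using hu
      | succ m ih =>
        rw [pow_succ', Module.End.mul_apply, Nat.cast_succ, add_smul, one_smul, ← add_assoc]
        exact lie_mem_mwt hx ih
    exact key n

/-- A weight of maximal length. -/
def IsMaximalWeight (M : Type*) [AddCommGroup M] [Module K M] [LieRingModule L M]
    [LieModule K L M] (γ : (rootSystem H).rootSpan ℤ) : Prop :=
  mwt H M γ ≠ ⊥ ∧ ∀ δ : (rootSystem H).rootSpan ℤ, mwt H M δ ≠ ⊥ → latticeNorm δ ≤ latticeNorm γ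

theorem coroot'In_eq (i : H.root) (γ : (rootSystem H).rootSpan ℤ) :
    (γ : Module.Dual K H) (coroot i.1) = ((rootSystem H).coroot'In ℤ i γ : K) :=
  ((rootSystem H).algebraMap_coroot'In_apply ℤ i γ).symm

/-- When the pairing with a root is nonpositive, subtracting that root lengthens the weight, which
maximality forbids. -/
theorem IsMaximalWeight.lie_eq_zero {γ : (rootSystem H).rootSpan ℤ} (h : IsMaximalWeight M γ)
    {i : H.root} (hi : (rootSystem H).coroot'In ℤ i γ ≤ 0) {u : M} (hu : u ∈ mwt H M γ) {y : L}
    (hy : y ∈ rootSpace H (-(rootSystem H).root i : Module.Dual K H)) : ⁅y, u⁆ = 0 := by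
  by_contra h0
  have h1 := lie_mem_mwt hy hu
  have h2 := h.2 (γ + (-1 : ℤ) • (rootSystem H).rootSpanMem ℤ i)
    ((Submodule.ne_bot_iff _).2 ⟨_, by simpa using h1, h0⟩)
  rw [latticeNorm_add_zsmul_root] at h2
  have := ((rootSystem H).posRootForm ℤ).rootLength_pos i
  nlinarith

theorem IsMaximalWeight.pow_toEnd {γ : (rootSystem H).rootSpan ℤ} (h : IsMaximalWeight M γ)
    {i : H.root} {n : ℕ} (hi : (rootSystem H).coroot'In ℤ i γ = -n) {x : L}
    (hx : x ∈ rootSpace H i.1) (hx0 : x ≠ 0) {u : M} (hu : u ∈ mwt H M γ) (hu0 : u ≠ 0) :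
    (LieModule.toEnd K L M x ^ n) u ≠ 0 ∧ (LieModule.toEnd K L M x ^ n) u ∈
      mwt H M (γ + (n : ℤ) • (rootSystem H).rootSpanMem ℤ i : (rootSystem H).rootSpan ℤ) := by
  refine pow_toEnd_mem_mwt i ?_ hx hx0 hu hu0 fun y hy ↦ h.lie_eq_zero (by omega) hu hy
  rw [coroot'In_eq, hi]
  push_cast
  rfl

/-- The vector at the other end of the root string is nonzero by `sl₂`-theory, and its weight is the
reflected one, of equal norm. -/
theorem IsMaximalWeight.reflect_of_nonpos {γ : (rootSystem H).rootSpan ℤ}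
    (h : IsMaximalWeight M γ) {i : H.root} {n : ℕ}
    (hi : (rootSystem H).coroot'In ℤ i γ = -n) :
    IsMaximalWeight M (γ + (n : ℤ) • (rootSystem H).rootSpanMem ℤ i) := by
  obtain ⟨u, hu, hu0⟩ := Submodule.exists_mem_ne_zero_of_ne_bot h.1
  obtain ⟨x, hx, hx0⟩ := exists_rootSpace_ne_zero i
  obtain ⟨h1, h2⟩ := h.pow_toEnd hi hx hx0 hu hu0
  refine ⟨(Submodule.ne_bot_iff _).2 ⟨_, h2, h1⟩, fun δ hδ ↦ ?_⟩
  rw [latticeNorm_add_zsmul_root, hi, neg_add_cancel, zero_mul, zero_mul, add_zero]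
  exact h.2 δ hδ

end HighestWeight

end LongAbelian

namespace LongAbelian

/-! ### Weights of a module whose highest weight is a short root. -/

section ShortDominant

open LieAlgebra LieAlgebra.IsKilling

variable {K L : Type*} [Field K] [CharZero K] [IsAlgClosed K] [LieRing L] [LieAlgebra K L]
  [FiniteDimensional K L] [IsKilling K L] {H : LieSubalgebra K L} [H.IsCartanSubalgebra]
  {M : Type*} [AddCommGroup M] [Module K M] [LieRingModule L M] [LieModule K L M]
  [FiniteDimensional K M]

theorem coroot_eq_neg {i j : H.root}
    (h : (rootSystem H).root j = -(rootSystem H).root i) : coroot j.1 = -coroot i.1 := by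
  have h1 : j.1 = -i.1 := by
    ext t
    exact LinearMap.congr_fun h t
  rw [h1, coroot_neg]

theorem rootSpanMem_reflectionPerm_eq (i j : H.root) :
    (rootSystem H).rootSpanMem ℤ ((rootSystem H).reflectionPerm i j) =
      (rootSystem H).rootSpanMem ℤ j - (rootSystem H).coroot'In ℤ i
        ((rootSystem H).rootSpanMem ℤ j) • (rootSystem H).rootSpanMem ℤ i := by
  apply Subtype.ext
  change (rootSystem H).root _ = (rootSystem H).root j - _ • (rootSystem H).root i
  rw [RootPairing.root_reflectionPerm, RootPairing.reflection_apply_root,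
    RootPairing.coroot'In_rootSpanMem_eq_pairingIn, ← Int.cast_smul_eq_zsmul K,
    ← (rootSystem H).algebraMap_pairingIn ℤ]
  rfl

/-- Opposite roots define the same reflection, so the pairing may be taken nonpositive. -/
theorem IsMaximalWeight.reflectionPerm {i : H.root}
    (h : IsMaximalWeight M ((rootSystem H).rootSpanMem ℤ i)) (k : H.root) :
    IsMaximalWeight M ((rootSystem H).rootSpanMem ℤ ((rootSystem H).reflectionPerm k i)) := by
  set c := (rootSystem H).coroot'In ℤ k ((rootSystem H).rootSpanMem ℤ i) with hc
  rw [rootSpanMem_reflectionPerm_eq, ← hc]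
  rcases le_total c 0 with h0 | h0
  · have h1 : c = -((-c).toNat : ℤ) := by omega
    have h2 := h.reflect_of_nonpos (n := (-c).toNat) (hc.symm.trans h1)
    rwa [show (((-c).toNat : ℕ) : ℤ) = -c by omega, neg_smul, ← sub_eq_add_neg] at h2
  · obtain ⟨l, -, hl⟩ := exists_neg_root k
    have hcl : (rootSystem H).coroot'In ℤ l ((rootSystem H).rootSpanMem ℤ i) = -c := by
      have h1 := coroot'In_eq l ((rootSystem H).rootSpanMem ℤ i)
      rw [coroot_eq_neg hl, map_neg, coroot'In_eq k, ← hc] at h1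
      exact_mod_cast h1.symm
    have h2 := h.reflect_of_nonpos (n := c.toNat) (hcl.trans (by omega))
    have h3 : (rootSystem H).rootSpanMem ℤ l = -(rootSystem H).rootSpanMem ℤ k := Subtype.ext hl
    rwa [show ((c.toNat : ℕ) : ℤ) = c by omega, h3, smul_neg, ← sub_eq_add_neg] at h2

/-- Root spaces act nontrivially between weight spaces of short roots. -/
theorem lie_ne_zero_of_short [(rootSystem H).IsIrreducible] {i j k : H.root} (hi : IsShortRoot (rootSystem H) i)
    (hk : IsShortRoot (rootSystem H) k)
    (hijk : (rootSystem H).root i + (rootSystem H).root j = (rootSystem H).root k) {x : L}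
    (hx : x ∈ rootSpace H j.1) (hx0 : x ≠ 0) {m : M} (hm : m ∈ mwt H M ((rootSystem H).root i))
    (hm0 : m ≠ 0) : ⁅x, m⁆ ≠ 0 := by
  intro h0
  -- If `x` killed `m`, the pairing of `i` with the coroot of `j` would be nonnegative and the sum
  -- `k` strictly longer than `i`, although both are short.
  obtain ⟨n, hn⟩ := exists_nat_of_lie_eq_zero j hx hx0 hm0 (mem_mwt.1 hm (coroot j.1)) h0
  have h1 := coroot'In_eq j ((rootSystem H).rootSpanMem ℤ i)
  have h2 : (rootSystem H).coroot'In ℤ j ((rootSystem H).rootSpanMem ℤ i) = n := by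
    have h3 : (((rootSystem H).coroot'In ℤ j ((rootSystem H).rootSpanMem ℤ i) : ℤ) : K) = n :=
      h1.symm.trans hn
    exact_mod_cast h3
  have h4 : (rootSystem H).rootSpanMem ℤ k =
      (rootSystem H).rootSpanMem ℤ i + (1 : ℤ) • (rootSystem H).rootSpanMem ℤ j := by
    rw [one_smul]
    exact Subtype.ext hijk.symm
  have h5 := latticeNorm_add_zsmul_root ((rootSystem H).rootSpanMem ℤ i) j 1
  rw [← h4, h2, latticeNorm_root, latticeNorm_root, rootLength_eq_of_isShortRoot hi hk] at h5
  have := ((rootSystem H).posRootForm ℤ).rootLength_pos j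
  nlinarith

variable {b : (rootSystem H).Base} {t : H.root} {v : M} [LieModule.IsIrreducible K L M]

/-- Induction on the height distance to the highest weight. A longest weight `γ` other than the
highest is raised by some positive root vector, and maximality makes its pairing with that root
negative. The reflected weight is again longest and nearer to the top, so it is a root by induction,
and `γ` is its reflection. The power of the root vector that realizes the reflection is injective on
the weight space of `γ`, which is therefore a line. -/
theorem IsHighestWeightVector.exists_rootSpanMem
    (h : IsHighestWeightVector b ((rootSystem H).root t) v) (n : ℕ) :
    ∀ γ : (rootSystem H).rootSpan ℤ, IsMaximalWeight M γ →
      heightFun b ((rootSystem H).root t - γ) = n →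
      ∃ i, γ = (rootSystem H).rootSpanMem ℤ i ∧ ((rootSystem H).posRootForm ℤ).rootLength i =
        ((rootSystem H).posRootForm ℤ).rootLength t ∧ ∃ e, mwt H M γ = K ∙ e := by
  induction n using Nat.strong_induction_on with
  | _ n ih =>
    intro γ hγ hn
    by_cases hγt : (γ : Module.Dual K H) = (rootSystem H).root t
    · exact ⟨t, Subtype.ext hγt, rfl, v, by rw [hγt, h.mwt_eq_span]⟩
    obtain ⟨u, hu, hu0⟩ := Submodule.exists_mem_ne_zero_of_ne_bot hγ.1
    obtain ⟨i, hi, x, hx, hxu⟩ : ∃ i : H.root, b.IsPos i ∧ ∃ x ∈ rootSpace H i.1, ⁅x, u⁆ ≠ 0 := by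
      by_contra! hcon
      exact hγt (h.weight_unique ⟨hu0, hu, hcon⟩)
    have hx0 : x ≠ 0 := by
      rintro rfl
      exact hxu (zero_lie u)
    have hlen := ((rootSystem H).posRootForm ℤ).rootLength_pos i
    set c := (rootSystem H).coroot'In ℤ i γ with hc
    have hc1 : c ≤ -1 := by
      have h1 : ⁅x, u⁆ ∈ mwt H M (γ + (rootSystem H).root i) := lie_mem_mwt hx hu
      have h2 := hγ.2 (γ + (1 : ℤ) • (rootSystem H).rootSpanMem ℤ i)
        ((Submodule.ne_bot_iff _).2 ⟨_, by rw [one_smul]; exact h1, hxu⟩)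
      rw [latticeNorm_add_zsmul_root, ← hc] at h2
      by_contra! h3
      nlinarith
    obtain ⟨m, hm⟩ : ∃ m : ℕ, c = -m := ⟨(-c).toNat, by omega⟩
    have hγ' := hγ.reflect_of_nonpos (hc.symm.trans hm)
    set γ' := γ + (m : ℤ) • (rootSystem H).rootSpanMem ℤ i with hγ'def
    have hnorm : latticeNorm γ' = latticeNorm γ := by
      rw [hγ'def, latticeNorm_add_zsmul_root, ← hc, hm]
      ring
    have hcoe : (γ' : Module.Dual K H) = γ + (m : ℤ) • (rootSystem H).root i := rfl
    obtain ⟨k, hk⟩ : ∃ k : ℕ, heightFun b ((rootSystem H).root t - γ') = k := by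
      rcases h.eq_or_mem_belowWeights hγ'.1 with h1 | ⟨-, k, hk⟩
      · exact ⟨0, by rw [h1, sub_self, map_zero, Nat.cast_zero]⟩
      · exact ⟨k + 1, by rw [hk, Nat.cast_succ]⟩
    have hkn : k < n := by
      have h1 : (k : K) = n - m * b.height i := by
        rw [← hk, ← hn, hcoe, ← sub_sub, map_sub, map_zsmul, heightFun_root, zsmul_eq_mul]
        push_cast
        rfl
      have h2 : (k : ℤ) = n - m * b.height i := by exact_mod_cast h1
      have h3 : 0 < b.height i := hi
      have h4 : (0 : ℤ) < m := by omega
      have := mul_pos h4 h3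
      omega
    obtain ⟨j, hj, hjlen, e, he⟩ := ih k hkn γ' hγ' hk
    have hγj : γ = (rootSystem H).rootSpanMem ℤ ((rootSystem H).reflectionPerm i j) := by
      rw [rootSpanMem_reflectionPerm_eq, ← hj, hγ'def, map_add, map_zsmul, ← hc, hm,
        RootPairing.coroot'In_rootSpanMem_eq_pairingIn, RootPairing.pairingIn_same]
      module
    refine ⟨_, hγj, ?_, u, ?_⟩
    · rw [← latticeNorm_root, ← hγj, ← hnorm, hj, latticeNorm_root, hjlen]
    refine le_antisymm (fun w hw ↦ ?_) ((Submodule.span_singleton_le_iff_mem _ _).2 hu)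
    have hT : ∀ {z : M}, z ∈ mwt H M γ → z ≠ 0 → _ := fun {z} hz hz0 ↦
      hγ.pow_toEnd (hc.symm.trans hm) hx hx0 hz hz0
    have hTe : ∀ z ∈ mwt H M γ, ∃ a : K, (LieModule.toEnd K L M x ^ m) z = a • e := by
      intro z hz
      by_cases hz0 : z = 0
      · exact ⟨0, by rw [hz0, map_zero, zero_smul]⟩
      · have h1 := (hT hz hz0).2
        rw [← hγ'def, he] at h1
        obtain ⟨a, ha⟩ := Submodule.mem_span_singleton.1 h1
        exact ⟨a, ha.symm⟩
    obtain ⟨a, ha⟩ := hTe w hw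
    obtain ⟨d, hd⟩ := hTe u hu
    have hd0 : d ≠ 0 := by
      rintro rfl
      exact (hT hu hu0).1 (by rw [hd, zero_smul])
    refine Submodule.mem_span_singleton.2 ⟨a / d, ?_⟩
    rw [eq_comm, ← sub_eq_zero]
    by_contra hz0
    refine (hT (Submodule.sub_mem _ hw (Submodule.smul_mem _ (a / d) hu)) hz0).1 ?_
    rw [map_sub, map_smul, ha, hd, smul_smul, div_mul_cancel₀ a hd0, sub_self]

variable [(rootSystem H).IsIrreducible]

/-- There are finitely many weights, and a longest one in the root lattice has the length of the
highest weight by the preceding result. -/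
theorem IsHighestWeightVector.isMaximalWeight
    (h : IsHighestWeightVector b ((rootSystem H).root t) v) :
    IsMaximalWeight M ((rootSystem H).rootSpanMem ℤ t) := by
  have hθ : mwt H M ((rootSystem H).root t) ≠ ⊥ :=
    (Submodule.ne_bot_iff _).2 ⟨v, h.mem, h.ne_zero⟩
  let W : Set ((rootSystem H).rootSpan ℤ) := {γ | mwt H M γ ≠ ⊥}
  have hfin : W.Finite := by
    have h1 := WellFoundedGT.finite_ne_bot_of_iSupIndep (iSupIndep_mwt (H := H) (M := M))
    exact Set.Finite.preimage Subtype.val_injective.injOn h1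
  obtain ⟨γ, hγ, hmax⟩ := Set.exists_max_image W latticeNorm hfin
    ⟨(rootSystem H).rootSpanMem ℤ t, hθ⟩
  obtain ⟨n, hn⟩ : ∃ n : ℕ, heightFun b ((rootSystem H).root t - γ) = n := by
    rcases h.eq_or_mem_belowWeights hγ with h1 | ⟨-, k, hk⟩
    · exact ⟨0, by rw [h1, sub_self, map_zero, Nat.cast_zero]⟩
    · exact ⟨k + 1, by rw [hk, Nat.cast_succ]⟩
  obtain ⟨i, hi, hlen, -⟩ := h.exists_rootSpanMem n γ ⟨hγ, hmax⟩ hn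
  refine ⟨hθ, fun δ hδ ↦ ?_⟩
  rw [latticeNorm_root, ← hlen, ← latticeNorm_root, ← hi]
  exact hmax δ hδ

/-- The nonzero weights of the little adjoint module are short roots. -/
theorem IsHighestWeightVector.eq_zero_or_short
    (h : IsHighestWeightVector b ((rootSystem H).root t) v) (ht : IsShortRoot (rootSystem H) t)
    {γ : Module.Dual K H} (hγ : mwt H M γ ≠ ⊥) :
    γ = 0 ∨ ∃ i, IsShortRoot (rootSystem H) i ∧ γ = (rootSystem H).root i ∧
      ∃ e, mwt H M γ = K ∙ e := by
  have hmem : γ ∈ (rootSystem H).rootSpan ℤ := by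
    rcases h.eq_or_mem_belowWeights hγ with h1 | ⟨h1, -⟩
    · rw [h1]
      exact Submodule.subset_span ⟨t, rfl⟩
    · have h2 : (rootSystem H).root t ∈ (rootSystem H).rootSpan ℤ :=
        Submodule.subset_span ⟨t, rfl⟩
      have h3 := Submodule.sub_mem _ h2 h1
      rwa [sub_sub_cancel] at h3
  have hmax := h.isMaximalWeight
  obtain ⟨n, hn⟩ : ∃ n : ℕ, heightFun b ((rootSystem H).root t - γ) = n := by
    rcases h.eq_or_mem_belowWeights hγ with h1 | ⟨-, k, hk⟩
    · exact ⟨0, by rw [h1, sub_self, map_zero, Nat.cast_zero]⟩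
    · exact ⟨k + 1, by rw [hk, Nat.cast_succ]⟩
  by_cases h0 : γ = 0
  · exact Or.inl h0
  have hpos : 0 < latticeNorm (⟨γ, hmem⟩ : (rootSystem H).rootSpan ℤ) :=
    latticeNorm_pos fun h1 ↦ h0 (congrArg Subtype.val h1)
  -- No nonzero lattice element is shorter than the highest weight, which is itself a longest
  -- weight; so every nonzero weight is of maximal length.
  have hle := Int.le_of_dvd hpos (dvd_latticeNorm ht ⟨γ, hmem⟩)
  obtain ⟨i, hi, hlen, he⟩ := h.exists_rootSpanMem n ⟨γ, hmem⟩
    ⟨hγ, fun δ hδ ↦ (hmax.2 δ hδ).trans hle⟩ hn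
  exact Or.inr ⟨i, isShortRoot_of_rootLength_eq ht hlen, congrArg Subtype.val hi, he⟩

/-- The roots that are weights of maximal length form a reflection-stable set containing the highest
weight, hence containing all short roots. -/
theorem IsHighestWeightVector.mwt_short
    (h : IsHighestWeightVector b ((rootSystem H).root t) v) (ht : IsShortRoot (rootSystem H) t)
    {i : H.root} (hi : IsShortRoot (rootSystem H) i) :
    ∃ e, e ≠ 0 ∧ mwt H M ((rootSystem H).root i) = K ∙ e := by
  let X : Set H.root := {i | IsMaximalWeight M ((rootSystem H).rootSpanMem ℤ i)}
  have hX : ∀ i ∈ X, ∀ k, (rootSystem H).reflectionPerm k i ∈ X :=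
    fun i hi k ↦ IsMaximalWeight.reflectionPerm hi k
  have ht' : t ∈ X := h.isMaximalWeight
  have hlen : ∀ k ∈ X, ((rootSystem H).posRootForm ℤ).rootLength k =
      ((rootSystem H).posRootForm ℤ).rootLength t :=
    fun k hk ↦ le_antisymm (ht'.2 _ hk.1) (hk.2 _ ht'.1)
  have h1 : i ∈ X := mem_of_reflection_stable hX ht' hlen (rootLength_eq_of_isShortRoot hi ht)
  have h2 : mwt H M ((rootSystem H).root i) ≠ ⊥ := h1.1
  rcases h.eq_zero_or_short ht h2 with h3 | ⟨j, -, -, e, he⟩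
  · exact absurd h3 ((rootSystem H).ne_zero i)
  · refine ⟨e, ?_, he⟩
    rintro rfl
    exact h2 (by rw [he, Submodule.span_zero_singleton])

end ShortDominant

end LongAbelian

namespace LongAbelian

/-! ### Vectors of weight zero. -/

section ZeroWeight

open LieAlgebra LieAlgebra.IsKilling

variable {K L : Type*} [Field K] [CharZero K] [IsAlgClosed K] [LieRing L] [LieAlgebra K L]
  [FiniteDimensional K L] [IsKilling K L] {H : LieSubalgebra K L} [H.IsCartanSubalgebra]
  {M : Type*} [AddCommGroup M] [Module K M] [LieRingModule L M] [LieModule K L M]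
  [FiniteDimensional K M]

/-- A primitive vector of weight zero spans a trivial representation of the `sl₂`-triple. -/
theorem lie_eq_zero_of_mem_mwt_zero {i j : H.root}
    (hij : (rootSystem H).root j = -(rootSystem H).root i) {x y : L} (hx : x ∈ rootSpace H i.1)
    (hx0 : x ≠ 0) (hy : y ∈ rootSpace H j.1) {u : M} (hu : u ∈ mwt H M 0) (h : ⁅x, u⁆ = 0) :
    ⁅y, u⁆ = 0 := by
  by_cases hu0 : u = 0
  · rw [hu0, lie_zero]
  obtain ⟨f, hf, ht⟩ := exists_isSl2Triple i hx hx0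
  have P : ht.HasPrimitiveVectorWith u ((0 : ℕ) : K) :=
    { ne_zero := hu0
      lie_h := by rw [mem_mwt.1 hu, LinearMap.zero_apply, Nat.cast_zero]
      lie_e := h }
  have h1 := P.pow_toEnd_f_eq_zero_of_eq_nat rfl
  rw [zero_add, pow_one] at h1
  have hfj : f ∈ rootSpace H j.1 := by
    have h2 : (j.1 : H → K) = -i.1 := by
      funext t
      exact LinearMap.congr_fun hij t
    rw [h2]
    exact hf
  have h3 : y ∈ K ∙ f := by
    rw [← rootSpace_eq_span j hfj ht.f_ne_zero]
    exact hy
  obtain ⟨c, rfl⟩ := Submodule.mem_span_singleton.1 h3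
  rw [smul_lie]
  exact (congrArg (c • ·) h1).trans (smul_zero c)

end ZeroWeight

/-! ### The little adjoint module in a graded Lie algebra. -/

section LittleAdjoint

open LieAlgebra LieAlgebra.IsKilling

variable {K L : Type*} [Field K] [CharZero K] [IsAlgClosed K] [LieRing L] [LieAlgebra K L]
  [FiniteDimensional K L] {g : LieSubalgebra K L} [IsKilling K g] {H : LieSubalgebra K g}
  [H.IsCartanSubalgebra] {b : (rootSystem H).Base} {V : LieSubmodule K g L}

variable (H V) in
/-- The weight spaces of a Cartan subalgebra of `𝔤` in a `𝔤`-submodule of `L`. -/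
def submoduleWt (γ : Module.Dual K H) : Submodule K L := V.toSubmodule ⊓ mwt H L γ

theorem mem_submoduleWt_coe {γ : Module.Dual K H} {y : V} :
    (y : L) ∈ submoduleWt H V γ ↔ y ∈ mwt H V γ := by
  constructor
  · exact fun h t ↦ Subtype.ext (h.2 t)
  · exact fun h ↦ ⟨y.2, fun t ↦ congrArg Subtype.val (h t)⟩

theorem submoduleWt_eq_map (γ : Module.Dual K H) :
    submoduleWt H V γ = (mwt H V γ).map V.toSubmodule.subtype := by
  ext y
  constructor
  · exact fun hy ↦ ⟨⟨y, hy.1⟩, mem_submoduleWt_coe.1 hy, rfl⟩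
  · rintro ⟨z, hz, rfl⟩
    exact mem_submoduleWt_coe.2 hz

theorem iSupIndep_submoduleWt : iSupIndep (submoduleWt H V) :=
  iSupIndep_mwt.mono fun _ ↦ inf_le_right

theorem lie_mem_submoduleWt {α γ : Module.Dual K H} {x : g} {y : L} (hx : x ∈ rootSpace H α)
    (hy : y ∈ submoduleWt H V γ) : ⁅(x : L), y⁆ ∈ submoduleWt H V (γ + α) :=
  ⟨V.lie_mem hy.1 (x := x), lie_mem_mwt hx hy.2⟩

theorem IsLittleAdjointGrading.exists_highestWeightVector (h : IsLittleAdjointGrading b V) :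
    ∃ (t : H.root) (v : V), IsShortRoot (rootSystem H) t ∧
      IsHighestWeightVector b ((rootSystem H).root t) v := by
  obtain ⟨t, ht, -, v, hv, hv0, hvw, hvp⟩ := h.highestWeight
  exact ⟨t, ⟨v, hv⟩, ht, fun h0 ↦ hv0 (congrArg Subtype.val h0), fun s ↦ Subtype.ext (hvw s),
    fun i hi x hx ↦ Subtype.ext (hvp i hi x hx)⟩

theorem IsLittleAdjointGrading.iSup_submoduleWt (h : IsLittleAdjointGrading b V) :
    ⨆ γ, submoduleWt H V γ = V.toSubmodule := by
  obtain ⟨t, v, -, hv⟩ := h.exists_highestWeightVector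
  have := h.irreducible
  simp_rw [submoduleWt_eq_map]
  rw [← Submodule.map_iSup, hv.iSup_mwt, Submodule.map_subtype_top]

variable [(rootSystem H).IsIrreducible]

theorem IsLittleAdjointGrading.eq_zero_or_short (h : IsLittleAdjointGrading b V)
    {γ : Module.Dual K H} {y : L} (hy : y ∈ submoduleWt H V γ) (hy0 : y ≠ 0) :
    γ = 0 ∨ ∃ i, IsShortRoot (rootSystem H) i ∧ γ = (rootSystem H).root i := by
  obtain ⟨t, v, ht, hv⟩ := h.exists_highestWeightVector
  have := h.irreducible
  have h1 : mwt H V γ ≠ ⊥ := (Submodule.ne_bot_iff _).2 ⟨⟨y, hy.1⟩, mem_submoduleWt_coe.1 hy,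
    fun h0 ↦ hy0 (congrArg Subtype.val h0)⟩
  rcases hv.eq_zero_or_short ht h1 with h2 | ⟨i, hi, hγ, -⟩
  · exact Or.inl h2
  · exact Or.inr ⟨i, hi, hγ⟩

theorem IsLittleAdjointGrading.submoduleWt_short (h : IsLittleAdjointGrading b V) {i : H.root}
    (hi : IsShortRoot (rootSystem H) i) :
    ∃ e, e ≠ 0 ∧ submoduleWt H V ((rootSystem H).root i) = K ∙ e := by
  obtain ⟨t, v, ht, hv⟩ := h.exists_highestWeightVector
  have := h.irreducible
  obtain ⟨e, he0, he⟩ := hv.mwt_short ht hi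
  refine ⟨e, fun h0 ↦ he0 (Subtype.ext h0), ?_⟩
  rw [submoduleWt_eq_map, he, Submodule.map_span, Set.image_singleton]
  rfl

theorem IsLittleAdjointGrading.submoduleWt_eq_span (h : IsLittleAdjointGrading b V) {i : H.root}
    (hi : IsShortRoot (rootSystem H) i) {y : L}
    (hy : y ∈ submoduleWt H V ((rootSystem H).root i)) (hy0 : y ≠ 0) :
    submoduleWt H V ((rootSystem H).root i) = K ∙ y := by
  obtain ⟨e, he0, he⟩ := h.submoduleWt_short hi
  rw [he] at hy ⊢
  obtain ⟨c, rfl⟩ := Submodule.mem_span_singleton.1 hy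
  have hc : c ≠ 0 := fun h0 ↦ hy0 (by rw [h0, zero_smul])
  exact (Submodule.span_singleton_smul_eq (IsUnit.mk0 c hc) e).symm

theorem isShortRoot_neg {i j : H.root} (hi : IsShortRoot (rootSystem H) i)
    (hij : (rootSystem H).root j = -(rootSystem H).root i) : IsShortRoot (rootSystem H) j := by
  refine isShortRoot_of_rootLength_eq hi ?_
  have h1 : (rootSystem H).reflectionPerm i i = j := (rootSystem H).root.injective (by
    rw [RootPairing.root_reflectionPerm, RootPairing.reflection_apply_self, hij])
  rw [← h1, RootPairing.RootPositiveForm.rootLength_reflectionPerm_self]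

/-- The composite of `ad x` and `ad y` interchanges the even and the odd part, so its trace is zero.
-/
theorem IsLittleAdjointGrading.killingForm_eq_zero (h : IsLittleAdjointGrading b V) {x y : L}
    (hx : x ∈ g) (hy : y ∈ V) : killingForm K L x y = 0 := by
  have hint : DirectSum.IsInternal fun c : Bool ↦ cond c g.toSubmodule V.toSubmodule := by
    rw [DirectSum.isInternal_submodule_iff_isCompl (i := true) (j := false) _ (by simp)
      (by ext c; cases c <;> simp)]
    exact h.isCompl
  rw [killingForm_apply_apply]
  refine LinearMap.trace_eq_zero_of_mapsTo_ne hint (fun c ↦ !c) (by simp) ?_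
  rintro (_ | _) z hz
  · exact g.lie_mem hx (h.lie_mem y hy z hz)
  · change ⁅x, ⁅y, z⁆⁆ ∈ V
    have h1 : ⁅y, z⁆ ∈ V := by
      rw [← lie_skew]
      exact V.neg_mem (V.lie_mem hy (x := ⟨z, hz⟩))
    exact V.lie_mem h1 (x := ⟨x, hx⟩)

theorem killingForm_submoduleWt {μ ν : Module.Dual K H} {u z : L} (hu : u ∈ submoduleWt H V μ)
    (hz : z ∈ submoduleWt H V ν) (h0 : μ + ν ≠ 0) : killingForm K L u z = 0 := by
  obtain ⟨t, ht⟩ := DFunLike.ne_iff.1 h0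
  have e1 : ⁅((t : g) : L), u⁆ = μ t • u := mem_mwt.1 hu.2 t
  have e2 : ⁅((t : g) : L), z⁆ = ν t • z := mem_mwt.1 hz.2 t
  have h1 : killingForm K L ⁅u, ((t : g) : L)⁆ z = killingForm K L u ⁅((t : g) : L), z⁆ :=
    LieModule.traceForm_apply_lie_apply K L L u _ z
  rw [← lie_skew, e1, e2, map_neg, map_smul, LinearMap.neg_apply, LinearMap.smul_apply, map_smul,
    smul_eq_mul, smul_eq_mul] at h1
  refine (mul_eq_zero.1 (?_ : (μ + ν) t * killingForm K L u z = 0)).resolve_left ht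
  rw [LinearMap.add_apply]
  linear_combination -h1

variable [IsKilling K L]

/-- An odd vector of weight `μ` is orthogonal to `𝔤` and to all odd weight spaces but that of `-μ`;
nondegeneracy leaves only this one. -/
theorem IsLittleAdjointGrading.exists_killingForm_ne_zero (h : IsLittleAdjointGrading b V)
    {μ : Module.Dual K H} {u : L} (hu : u ∈ submoduleWt H V μ) (hu0 : u ≠ 0) :
    ∃ z ∈ submoduleWt H V (-μ), killingForm K L u z ≠ 0 := by
  by_contra! hcon
  have h1 : u ∈ LinearMap.ker (killingForm K L) := by
    rw [LinearMap.mem_ker]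
    ext z
    rw [LinearMap.zero_apply]
    have hz : z ∈ g.toSubmodule ⊔ V.toSubmodule := by
      rw [h.isCompl.sup_eq_top]
      trivial
    obtain ⟨z0, hz0, z1, hz1, rfl⟩ := Submodule.mem_sup.1 hz
    have e0 : killingForm K L u z0 = 0 :=
      (LieModule.traceForm_comm K L L u z0).trans (h.killingForm_eq_zero hz0 hu.1)
    rw [map_add, e0, zero_add]
    rw [← h.iSup_submoduleWt] at hz1
    have hle : ⨆ γ, submoduleWt H V γ ≤ LinearMap.ker (killingForm K L u) := by
      refine iSup_le fun γ z hz ↦ LinearMap.mem_ker.2 ?_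
      by_cases hγ : μ + γ = 0
      · exact hcon z (eq_neg_of_add_eq_zero_right hγ ▸ hz)
      · exact killingForm_submoduleWt hu hz hγ
    exact hle hz1
  rw [ker_killingForm_eq_bot] at h1
  exact hu0 (by simpa using h1)

theorem IsLittleAdjointGrading.killingForm_ne_zero (h : IsLittleAdjointGrading b V) {i j : H.root}
    (hi : IsShortRoot (rootSystem H) i) (hij : (rootSystem H).root j = -(rootSystem H).root i)
    {u z : L} (hu : u ∈ submoduleWt H V ((rootSystem H).root i)) (hu0 : u ≠ 0)
    (hz : z ∈ submoduleWt H V ((rootSystem H).root j)) (hz0 : z ≠ 0) :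
    killingForm K L u z ≠ 0 := by
  obtain ⟨w, hw, huw⟩ := h.exists_killingForm_ne_zero hu hu0
  rw [← hij, h.submoduleWt_eq_span (isShortRoot_neg hi hij) hz hz0] at hw
  obtain ⟨c, rfl⟩ := Submodule.mem_span_singleton.1 hw
  intro h0
  rw [map_smul, h0, smul_zero] at huw
  exact huw rfl

/-- The product of two weight vectors of short roots whose sum is a root is nonzero. -/
theorem IsLittleAdjointGrading.lie_ne_zero (h : IsLittleAdjointGrading b V) {i j k : H.root}
    (hi : IsShortRoot (rootSystem H) i) (hj : IsShortRoot (rootSystem H) j)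
    (hijk : (rootSystem H).root i + (rootSystem H).root j = (rootSystem H).root k) {x y : L}
    (hx : x ∈ submoduleWt H V ((rootSystem H).root i)) (hx0 : x ≠ 0)
    (hy : y ∈ submoduleWt H V ((rootSystem H).root j)) (hy0 : y ≠ 0) : ⁅x, y⁆ ≠ 0 := by
  intro hxy
  obtain ⟨l, -, hl⟩ := exists_neg_root k
  obtain ⟨m, -, hm⟩ := exists_neg_root i
  obtain ⟨z, hz, hz0⟩ := exists_rootSpace_ne_zero l
  have hsum : (rootSystem H).root j + (rootSystem H).root l = (rootSystem H).root m := by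
    rw [hl, hm, ← hijk]
    abel
  -- The vector `⁅z, y⁆` has weight opposite to that of `x`, so the two pair nontrivially; by
  -- invariance the pairing is, up to sign, that of `⁅x, y⁆` with `z`.
  have h1 : ⁅z, y⁆ ≠ 0 := lie_ne_zero_of_short hj (isShortRoot_neg hi hm) hsum hz hz0 hy.2 hy0
  have h2 : ⁅(z : L), y⁆ ∈ submoduleWt H V ((rootSystem H).root j + (rootSystem H).root l) :=
    lie_mem_submoduleWt hz hy
  rw [hsum] at h2
  refine h.killingForm_ne_zero hi hm hx hx0 h2 h1 ?_
  have h3 : killingForm K L ⁅x, y⁆ z = killingForm K L x ⁅y, (z : L)⁆ :=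
    LieModule.traceForm_apply_lie_apply K L L x y z
  rw [hxy, map_zero, LinearMap.zero_apply, ← lie_skew, map_neg, zero_eq_neg] at h3
  exact h3

/-- A commutative stable subspace of the little adjoint module has no zero weight vectors. -/
theorem IsLittleAdjointGrading.eq_zero_of_mem_zero (h : IsLittleAdjointGrading b V)
    {U : Submodule K L} (hst : ∀ x ∈ borel b, ∀ y ∈ U, ⁅(x : L), y⁆ ∈ U)
    (hcomm : ∀ x ∈ U, ∀ y ∈ U, ⁅x, y⁆ = 0) {u : L} (hu : u ∈ U)
    (hu' : u ∈ submoduleWt H V 0) : u = 0 := by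
  by_contra hu0
  obtain ⟨t, v, ht, hv⟩ := h.exists_highestWeightVector
  have := h.irreducible
  -- Zero is not the highest weight, so some positive root vector `x` moves `u`, and by `sl₂`-theory
  -- so does the opposite root vector `z`. Then `⁅x, u⁆` and `⁅z, u⁆` have opposite short weights
  -- and pair nontrivially, while invariance and `⁅⁅x, u⁆, u⁆ = 0` make this pairing vanish.
  obtain ⟨i, hi, x, hx, hxu⟩ : ∃ i : H.root, b.IsPos i ∧ ∃ x ∈ rootSpace H i.1,
      ⁅(x : L), u⁆ ≠ 0 := by
    by_contra! hcon
    have h1 : IsHighestWeightVector b 0 (⟨u, hu'.1⟩ : V) :=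
      ⟨fun h0 ↦ hu0 (congrArg Subtype.val h0), mem_submoduleWt_coe.1 hu',
        fun i hi x hx ↦ Subtype.ext (hcon i hi x hx)⟩
    exact (rootSystem H).ne_zero t (hv.weight_unique h1).symm
  have hw : ⁅(x : L), u⁆ ∈ submoduleWt H V ((rootSystem H).root i) := by
    have h1 : ⁅(x : L), u⁆ ∈ submoduleWt H V (0 + (rootSystem H).root i) :=
      lie_mem_submoduleWt hx hu'
    rwa [zero_add] at h1
  have hwU : ⁅(x : L), u⁆ ∈ U := ((stable_borel_iff b (M := L)).1 hst).2 i hi x hx u hu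
  have hshort : IsShortRoot (rootSystem H) i := by
    rcases h.eq_zero_or_short hw hxu with h1 | ⟨j, hj, hij⟩
    · exact absurd h1 ((rootSystem H).ne_zero i)
    · rwa [(rootSystem H).root.injective hij]
  obtain ⟨j, -, hj⟩ := exists_neg_root i
  obtain ⟨z, hz, hz0⟩ := exists_rootSpace_ne_zero j
  have hzu : ⁅(z : L), u⁆ ≠ 0 := fun h0 ↦
    hxu (lie_eq_zero_of_mem_mwt_zero (i := j) (j := i) (M := L) (by rw [hj, neg_neg]) hz hz0 hx
      hu'.2 h0)
  have hzu' : ⁅(z : L), u⁆ ∈ submoduleWt H V ((rootSystem H).root j) := by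
    have h1 : ⁅(z : L), u⁆ ∈ submoduleWt H V (0 + (rootSystem H).root j) :=
      lie_mem_submoduleWt hz hu'
    rwa [zero_add] at h1
  refine h.killingForm_ne_zero hshort hj hw hxu hzu' hzu ?_
  have h3 : killingForm K L ⁅⁅(x : L), u⁆, u⁆ z = killingForm K L ⁅(x : L), u⁆ ⁅u, (z : L)⁆ :=
    LieModule.traceForm_apply_lie_apply K L L _ u z
  rw [hcomm _ hwU u hu, map_zero, LinearMap.zero_apply, ← lie_skew u, map_neg, zero_eq_neg] at h3
  exact h3

/-- A vector of negative weight would be carried to weight zero by the opposite positive root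
vector, hence killed by it. Its weight would then be nonnegative on the corresponding coroot, but
the value is `-2`. -/
theorem IsLittleAdjointGrading.mem_shortPosRoots (h : IsLittleAdjointGrading b V)
    {U : Submodule K L} (hst : ∀ x ∈ borel b, ∀ y ∈ U, ⁅(x : L), y⁆ ∈ U)
    (hcomm : ∀ x ∈ U, ∀ y ∈ U, ⁅x, y⁆ = 0) {γ : Module.Dual K H} {u : L} (hu : u ∈ U)
    (hu' : u ∈ submoduleWt H V γ) (hu0 : u ≠ 0) : γ ∈ shortPosRoots b := by
  rcases h.eq_zero_or_short hu' hu0 with rfl | ⟨i, hi, rfl⟩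
  · exact absurd (h.eq_zero_of_mem_zero hst hcomm hu hu') hu0
  rcases isPos_or_neg b i with hpos | ⟨j, hj, hij⟩
  · exact ⟨i, ⟨hpos, hi⟩, rfl⟩
  exfalso
  obtain ⟨x, hx, hx0⟩ := exists_rootSpace_ne_zero j
  have hxu : ⁅(x : L), u⁆ ∈ submoduleWt H V 0 := by
    have h1 : ⁅(x : L), u⁆ ∈ submoduleWt H V ((rootSystem H).root i + (rootSystem H).root j) :=
      lie_mem_submoduleWt hx hu'
    rwa [hij, add_neg_cancel] at h1
  have h0 := h.eq_zero_of_mem_zero hst hcomm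
    (((stable_borel_iff b (M := L)).1 hst).2 j hj x hx u hu) hxu
  obtain ⟨n, hn⟩ := exists_nat_of_lie_eq_zero j hx hx0 (M := L) hu0
    (mem_mwt.1 hu'.2 (coroot j.1)) h0
  have h2 : (rootSystem H).root i = -(rootSystem H).root j := by rw [hij, neg_neg]
  have h3 : (rootSystem H).root j (coroot j.1) = 2 :=
    root_apply_coroot (LieSubalgebra.isNonZero_coe_root j)
  rw [h2, LinearMap.neg_apply, h3] at hn
  have h4 : ((n + 2 : ℕ) : K) = 0 := by
    push_cast
    linear_combination -hn
  exact absurd (Nat.cast_eq_zero.1 h4) (by omega)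

/-- A commutative stable subspace of the little adjoint module is a sum of weight spaces of short
positive roots. -/
theorem IsLittleAdjointGrading.eq_iSup_submoduleWt (h : IsLittleAdjointGrading b V)
    {U : Submodule K L} (hU : U ≤ V.toSubmodule)
    (hst : ∀ x ∈ borel b, ∀ y ∈ U, ⁅(x : L), y⁆ ∈ U)
    (hcomm : ∀ x ∈ U, ∀ y ∈ U, ⁅x, y⁆ = 0) :
    U = ⨆ γ ∈ {γ | γ ∈ shortPosRoots b ∧ submoduleWt H V γ ≤ U}, submoduleWt H V γ := by
  refine le_antisymm ?_ (iSup₂_le fun γ hγ ↦ hγ.2)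
  have hle : U ≤ ⨆ γ : Module.Dual K H, mwt H L γ := by
    rw [← h.iSup_submoduleWt] at hU
    exact hU.trans (iSup_mono fun γ ↦ inf_le_right)
  have hle' := le_iSup_inf_simWeight (U := U) (T := fun t : H ↦ LieModule.toEnd K g L t)
    (χ := fun γ : Module.Dual K H ↦ (γ : H → K)) DFunLike.coe_injective
    (fun t u hu ↦ hst t (Submodule.mem_sup_left t.2) u hu) hle
  refine hle'.trans (iSup_le fun γ x hx ↦ ?_)
  by_cases hx0 : x = 0
  · rw [hx0]
    exact Submodule.zero_mem _
  have hxV : x ∈ submoduleWt H V γ := ⟨hU hx.1, hx.2⟩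
  have hγ := h.mem_shortPosRoots hst hcomm hx.1 hxV hx0
  have h1 : submoduleWt H V γ ≤ U := by
    obtain ⟨i, hi, rfl⟩ := hγ
    rw [h.submoduleWt_eq_span hi.2 hxV hx0, Submodule.span_singleton_le_iff_mem]
    exact hx.1
  exact Submodule.mem_iSup_of_mem γ (Submodule.mem_iSup_of_mem ⟨hγ, h1⟩ hxV)

end LittleAdjoint

end LongAbelian

namespace LongAbelian

/-! ### Commutative subalgebras of the little adjoint module as stable families. -/

section LittleAdjointCount

open LieAlgebra LieAlgebra.IsKilling

variable {K L : Type*} [Field K] [CharZero K] [IsAlgClosed K] [LieRing L] [LieAlgebra K L]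
  [FiniteDimensional K L] [IsKilling K L] {g : LieSubalgebra K L} [IsKilling K g]
  {H : LieSubalgebra K g} [H.IsCartanSubalgebra] {b : (rootSystem H).Base}
  {V : LieSubmodule K g L} [(rootSystem H).IsIrreducible]

theorem isLieAbelian_subalgebra_iff (a : LieSubalgebra K L) :
    IsLieAbelian a ↔ ∀ x ∈ a, ∀ y ∈ a, ⁅x, y⁆ = 0 := by
  constructor
  · intro h x hx y hy
    exact congrArg Subtype.val (h.trivial ⟨x, hx⟩ ⟨y, hy⟩)
  · exact fun h ↦ ⟨fun x y ↦ Subtype.ext (h x.1 x.2 y.1 y.2)⟩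

theorem shortPosRoots_subset : shortPosRoots b ⊆ posRoots b := Set.image_mono fun _ hi ↦ hi.1

theorem IsLittleAdjointGrading.lie_eq_zero_of_notMem (h : IsLittleAdjointGrading b V)
    {α γ : Module.Dual K H} (hα : α ∈ posRoots b) (hγ : γ ∈ posRoots b)
    (hαγ : γ + α ∉ shortPosRoots b) {x : g} {y : L} (hx : x ∈ rootSpace H α)
    (hy : y ∈ submoduleWt H V γ) : ⁅(x : L), y⁆ = 0 := by
  by_contra h0
  rcases h.eq_zero_or_short (lie_mem_submoduleWt hx hy) h0 with h1 | ⟨i, hi, h1⟩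
  · exact add_ne_zero_of_mem_posRoots b hγ hα h1
  · obtain ⟨j, hj, hj'⟩ := add_mem_posRoots b hγ hα ⟨i, h1.symm⟩
    have hij : j = i := (rootSystem H).root.injective (hj'.trans h1)
    exact hαγ ⟨i, ⟨hij ▸ hj, hi⟩, h1.symm⟩

theorem IsLittleAdjointGrading.lie_eq_zero_of_notMem_posRoots (h : IsLittleAdjointGrading b V)
    {γ δ : Module.Dual K H} (hγ : γ ∈ posRoots b) (hδ : δ ∈ posRoots b)
    (hγδ : γ + δ ∉ posRoots b) {x y : L} (hx : x ∈ submoduleWt H V γ)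
    (hy : y ∈ submoduleWt H V δ) : ⁅x, y⁆ = 0 := by
  by_contra h0
  have hg := h.lie_mem x hx.1 y hy.1
  have h1 : (⟨⁅x, y⁆, hg⟩ : g) ∈ rootSpace H (γ + δ : Module.Dual K H) := by
    rw [← LieSubmodule.mem_toSubmodule, rootSpace_eq_simWeight]
    intro t
    refine Subtype.ext ?_
    have e1 : ⁅((t : g) : L), x⁆ = γ t • x := mem_mwt.1 hx.2 t
    have e2 : ⁅((t : g) : L), y⁆ = δ t • y := mem_mwt.1 hy.2 t
    change ⁅((t : g) : L), ⁅x, y⁆⁆ = (γ + δ) t • ⁅x, y⁆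
    rw [leibniz_lie, e1, e2, smul_lie, lie_smul, LinearMap.add_apply, add_smul]
  exact hγδ (add_mem_posRoots b hγ hδ (mem_range_root_iff.2
    ⟨add_ne_zero_of_mem_posRoots b hγ hδ, _, h1, fun h2 ↦ h0 (congrArg Subtype.val h2)⟩))

/-- Here `T` contains only short roots: long roots are not weights of `V`, so reaching one imposes
no closure condition. The set `A` still contains all positive roots, because `⁅V, V⁆` lies in `𝔤`,
so a sum that is a long root also obstructs commutativity. -/
theorem ncard_stableCommutativeSubalgebras (h : IsLittleAdjointGrading b V) :
    (stableCommutativeSubalgebras b V).ncard =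
      (stableFamily (posRoots b) (shortPosRoots b) (shortPosRoots b)).ncard := by
  rw [← Set.ncard_image_of_injective _ (LieSubalgebra.toSubmodule_injective (R := K) (L := L))]
  refine ncard_eq_ncard_stableFamily (H := {x : L | ∃ t : H, x = ((t : g) : L)})
    (R := fun γ : Module.Dual K H ↦ (rootSpace H γ).toSubmodule.map g.toSubmodule.subtype)
    (E := submoduleWt H V) subset_rfl ?_ iSupIndep_submoduleWt ?_ ?_ ?_ ?_ ?_ ?_ fun U ↦ ?_
  · rintro _ ⟨i, hi, rfl⟩
    exact h.submoduleWt_short hi.2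
  · rintro _ ⟨t, rfl⟩ γ _ y hy
    have h1 : ⁅((t : g) : L), y⁆ = γ t • y := mem_mwt.1 hy.2 t
    rw [h1]
    exact Submodule.smul_mem _ _ hy
  · rintro α _ γ _ _ ⟨x, hx, rfl⟩ y hy
    exact lie_mem_submoduleWt hx hy
  · rintro _ ⟨j, hj, rfl⟩ _ ⟨i, hi, rfl⟩ ⟨k, hk, hk'⟩
    obtain ⟨x, hx, hx0⟩ := exists_rootSpace_ne_zero j
    obtain ⟨y, hy0, hy⟩ := h.submoduleWt_short hi.2
    have hy' : y ∈ submoduleWt H V ((rootSystem H).root i) :=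
      hy ▸ Submodule.mem_span_singleton_self y
    exact ⟨x, ⟨x, hx, rfl⟩, y, hy', lie_ne_zero_of_short hi.2 hk.2 hk'.symm hx hx0 hy'.2 hy0⟩
  · rintro α hα γ hγ hαγ _ ⟨x, hx, rfl⟩ y hy
    exact h.lie_eq_zero_of_notMem hα (shortPosRoots_subset hγ) hαγ hx hy
  · rintro _ ⟨i, hi, rfl⟩ _ ⟨j, hj, rfl⟩ ⟨k, -, hk⟩
    obtain ⟨x, hx0, hx⟩ := h.submoduleWt_short hi.2
    obtain ⟨y, hy0, hy⟩ := h.submoduleWt_short hj.2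
    have hx' : x ∈ submoduleWt H V ((rootSystem H).root i) :=
      hx ▸ Submodule.mem_span_singleton_self x
    have hy' : y ∈ submoduleWt H V ((rootSystem H).root j) :=
      hy ▸ Submodule.mem_span_singleton_self y
    exact ⟨x, hx', y, hy', h.lie_ne_zero hi.2 hj.2 hk.symm hx' hx0 hy' hy0⟩
  · intro γ hγ δ hδ hγδ x hx y hy
    exact h.lie_eq_zero_of_notMem_posRoots (shortPosRoots_subset hγ) (shortPosRoots_subset hδ)
      hγδ hx hy
  have hst : ((∀ x ∈ {x : L | ∃ t : H, x = ((t : g) : L)}, ∀ y ∈ U, ⁅x, y⁆ ∈ U) ∧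
      ∀ α ∈ posRoots b, ∀ x ∈ (rootSpace H α).toSubmodule.map g.toSubmodule.subtype,
        ∀ y ∈ U, ⁅x, y⁆ ∈ U) ↔ ∀ x ∈ borel b, ∀ y ∈ U, ⁅(x : L), y⁆ ∈ U := by
    refine Iff.trans ?_ (stable_borel_iff b (M := L)).symm
    constructor
    · rintro ⟨h1, h2⟩
      exact ⟨fun x hx ↦ h1 x ⟨⟨x, hx⟩, rfl⟩, fun i hi x hx ↦
        h2 ((rootSystem H).root i) ⟨i, hi, rfl⟩ x ⟨x, hx, rfl⟩⟩
    · rintro ⟨h1, h2⟩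
      refine ⟨?_, ?_⟩
      · rintro _ ⟨t, rfl⟩
        exact h1 t t.2
      · rintro _ ⟨i, hi, rfl⟩ _ ⟨x, hx, rfl⟩
        exact h2 i hi x hx
  refine Iff.trans ?_ (and_congr_right' ((and_congr_left' hst.symm).trans and_assoc))
  constructor
  · rintro ⟨a, ⟨haV, hab, hb⟩, rfl⟩
    rw [isLieAbelian_subalgebra_iff] at hab
    exact ⟨⟨_, fun γ hγ ↦ hγ.1, h.eq_iSup_submoduleWt haV hb hab⟩, hb, hab⟩
  · rintro ⟨⟨S, hS, hU⟩, hst, hcomm⟩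
    let a : LieSubalgebra K L :=
      { U with
        lie_mem' := fun {x y} hx hy ↦ by
          have h1 : ⁅x, y⁆ = 0 := hcomm x hx y hy
          rw [h1]
          exact U.zero_mem }
    have hUV : U ≤ V.toSubmodule := by
      rw [hU]
      exact iSup₂_le fun γ _ ↦ inf_le_left
    exact ⟨a, ⟨fun x hx ↦ hUV hx, (isLieAbelian_subalgebra_iff a).2 hcomm, hst⟩, rfl⟩

end LittleAdjointCount

end LongAbelian

end

/-! ### The theorem, case by case. -/

theorem mainTheorem6 {K : Type*} [Field K] [IsAlgClosed K] [CharZero K] :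
    -- long Abelian ideals
    (∀ (p : ℕ) (_ : 2 ≤ p) (L : Type*) [LieRing L] [LieAlgebra K L] [FiniteDimensional K L]
      [LieAlgebra.IsSimple K L]
      (_ : Nonempty (L ≃ₗ⁅K⁆ LieAlgebra.Orthogonal.so (Fin (2 * p + 1)) K))
      (H : LieSubalgebra K L) [H.IsCartanSubalgebra] (b : (LieAlgebra.IsKilling.rootSystem H).Base),
      (LongAbelian.longAbelianIdeals b).ncard = 2 ^ (p - 1)) ∧
    (∀ (p : ℕ) (_ : 2 ≤ p) (L : Type*) [LieRing L] [LieAlgebra K L] [FiniteDimensional K L]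
      [LieAlgebra.IsSimple K L]
      (_ : Nonempty (L ≃ₗ⁅K⁆ LieAlgebra.Symplectic.sp (Fin p) K))
      (H : LieSubalgebra K L) [H.IsCartanSubalgebra] (b : (LieAlgebra.IsKilling.rootSystem H).Base),
      (LongAbelian.longAbelianIdeals b).ncard = 2) ∧
    (∀ (L : Type*) [LieRing L] [LieAlgebra K L] [FiniteDimensional K L] [LieAlgebra.IsSimple K L]
      (H : LieSubalgebra K L) [H.IsCartanSubalgebra] (b : (LieAlgebra.IsKilling.rootSystem H).Base),
      LongAbelian.HasCartanMatrix b CartanMatrix.F₄ →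
      (LongAbelian.longAbelianIdeals b).ncard = 4) ∧
    (∀ (L : Type*) [LieRing L] [LieAlgebra K L] [FiniteDimensional K L] [LieAlgebra.IsSimple K L]
      (H : LieSubalgebra K L) [H.IsCartanSubalgebra] (b : (LieAlgebra.IsKilling.rootSystem H).Base),
      LongAbelian.HasCartanMatrix b CartanMatrix.G₂ →
      (LongAbelian.longAbelianIdeals b).ncard = 3) ∧
    -- commutative subalgebras of the little adjoint modules
    (∀ (p : ℕ) (_ : 2 ≤ p) (L : Type*) [LieRing L] [LieAlgebra K L] [FiniteDimensional K L]
      [LieAlgebra.IsSimple K L] (g : LieSubalgebra K L) [LieAlgebra.IsSimple K g]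
      (_ : Nonempty (g ≃ₗ⁅K⁆ LieAlgebra.Symplectic.sp (Fin p) K))
      (H : LieSubalgebra K g) [H.IsCartanSubalgebra] (b : (LieAlgebra.IsKilling.rootSystem H).Base)
      (V : LieSubmodule K g L), LongAbelian.IsLittleAdjointGrading b V →
      (LongAbelian.stableCommutativeSubalgebras b V).ncard = 2 ^ (p - 1)) ∧
    (∀ (p : ℕ) (_ : 2 ≤ p) (L : Type*) [LieRing L] [LieAlgebra K L] [FiniteDimensional K L]
      [LieAlgebra.IsSimple K L] (g : LieSubalgebra K L) [LieAlgebra.IsSimple K g]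
      (_ : Nonempty (g ≃ₗ⁅K⁆ LieAlgebra.Orthogonal.so (Fin (2 * p + 1)) K))
      (H : LieSubalgebra K g) [H.IsCartanSubalgebra] (b : (LieAlgebra.IsKilling.rootSystem H).Base)
      (V : LieSubmodule K g L), LongAbelian.IsLittleAdjointGrading b V →
      (LongAbelian.stableCommutativeSubalgebras b V).ncard = 2) ∧
    (∀ (L : Type*) [LieRing L] [LieAlgebra K L] [FiniteDimensional K L]
      [LieAlgebra.IsSimple K L] (g : LieSubalgebra K L) [LieAlgebra.IsSimple K g]
      (H : LieSubalgebra K g) [H.IsCartanSubalgebra] (b : (LieAlgebra.IsKilling.rootSystem H).Base)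
      (V : LieSubmodule K g L), LongAbelian.HasCartanMatrix b CartanMatrix.F₄ →
      LongAbelian.IsLittleAdjointGrading b V →
      (LongAbelian.stableCommutativeSubalgebras b V).ncard = 4) := by
  refine ⟨?_, ?_, ?_, ?_, ?_, ?_, ?_⟩
  · rintro p hp L _ _ _ _ ⟨e⟩ H _ b
    obtain ⟨ε, hε, hR⟩ := LongAbelian.exists_bcRoots_of_so H hp e
    rw [LongAbelian.ncard_longAbelianIdeals]
    exact (LongAbelian.ncard_stableFamily_typeB b hp hε hR).1
  · rintro p hp L _ _ _ _ ⟨e⟩ H _ b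
    obtain ⟨ε, hε, hR⟩ := LongAbelian.exists_bcRoots_of_sp H hp e
    rw [LongAbelian.ncard_longAbelianIdeals]
    exact (LongAbelian.ncard_stableFamily_typeC b hp hε hR).1
  · intro L _ _ _ _ H _ b hA
    rw [LongAbelian.ncard_longAbelianIdeals]
    exact (LongAbelian.ncard_stableFamily_typeF4 b hA).1
  · intro L _ _ _ _ H _ b hA
    rw [LongAbelian.ncard_longAbelianIdeals]
    exact LongAbelian.ncard_stableFamily_typeG2 b hA
  · rintro p hp L _ _ _ _ g _ ⟨e⟩ H _ b V hV
    obtain ⟨ε, hε, hR⟩ := LongAbelian.exists_bcRoots_of_sp H hp e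
    rw [LongAbelian.ncard_stableCommutativeSubalgebras hV]
    exact (LongAbelian.ncard_stableFamily_typeC b hp hε hR).2
  · rintro p hp L _ _ _ _ g _ ⟨e⟩ H _ b V hV
    obtain ⟨ε, hε, hR⟩ := LongAbelian.exists_bcRoots_of_so H hp e
    rw [LongAbelian.ncard_stableCommutativeSubalgebras hV]
    exact (LongAbelian.ncard_stableFamily_typeB b hp hε hR).2
  · intro L _ _ _ _ g _ H _ b V hA hV
    rw [LongAbelian.ncard_stableCommutativeSubalgebras hV]
    exact (LongAbelian.ncard_stableFamily_typeF4 b hA).2
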